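/- **Formulae.** Frequency LTL over a finite set $Ap$ has the syntax $\varphi::=\mathbf{tt}\mid\mathbf{ff}\mid a\mid\neg a\mid\varphi\wedge\varphi\mid\varphi\vee\varphi\mid\mathbf X\varphi\mid\mathbf F\varphi\mid\mathbf G\varphi\mid\varphi\mathbf U\varphi\mid\mathbf G^{\bowtie p}_{\mathrm{ext}}\varphi$ with $a\in Ap$, ${\bowtie}\in\{\ge,>\}$, $p\in[0,1]\cap\mathbb Q$, $\mathrm{ext}\in\{\inf,\sup\}$. It is interpreted over words $w\in(2^{Ap})^\omega$ as usual, where $w\models\mathbf G^{\bowtie p}_{\inf}\varphi$ (resp. $\sup$) iff the limit inferior (resp. superior) of $\frac1i|\{j<i : w^{j\infty}\models\varphi\}|$ for $i\to\infty$ is $\bowtie p$; $w^{j\infty}$ is the suffix from position $j$. The fragment $\mathrm{fLTL}_{\setminus\mathbf{GU}}$ consists of the formulae in which $\mathbf U$ does not occur inside a $\mathbf G$- or $\mathbf G^{\bowtie p}_{\mathrm{ext}}$-formula. The length $|\varphi|$ is the number of symbols, frequency bounds counted with their binary digits. **Automata.** A deterministic generalized Rabin mean-payoff automaton (DGRMA)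 is a finite deterministic transition system (with a possibly partial transition function) together with an acceptance condition in disjunctive normal form over variables $\mathit{Inf}(S)$ ($S$ is visited infinitely often), $\mathit{Fin}(S)$ ($S$ is visited finitely often) and $\mathit{MP}^{\bowtie p}_{\mathrm{ext}}(r)$ (the limit inferior/superior of the prefix averages of the rewards $r$, a rational for each state, along the run is $\bowtie p$). It accepts the words that have a run satisfying the condition. The size of the condition is the number of occurrences of variables plus the number of disjuncts. **The automaton $\mathcal A_\varphi$.** Formulae are taken up to propositional equivalence, where formulae other than $\mathbf{tt}$, $\mathbf{ff}$, conjunctions and disjunctions count as propositional variables; $\Phi\vdash\psi$ is propositional consequence. $\mathsf{Unf}$ commutes with $\wedge,\vee$, and $\mathsf{Unf}(\mathbf F\psi)=\mathsf{Unf}(\psi)\vee\mathbf{XF}\psi$, $\mathsf{Unf}(\mathbf G\psi)=\mathsf{Unf}(\psi)\wedge\mathbf{XG}\psi$, $\mathsf{Unf}(\psi_1\mathbf U\psi_2)=\mathsf{Unf}(\psi_2)\vee(\mathsf{Unf}(\psi_1)\wedge\mathbf X(\psi_1\mathbf U\psi_2))$, $\mathsf{Unf}(\mathbf G^{\bowtie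 p}_{\mathrm{ext}}\psi)=\mathbf{tt}\wedge\mathbf{XG}^{\bowtie p}_{\mathrm{ext}}\psi$, $\mathsf{Unf}(\psi)=\psi$ otherwise. For $\nu\subseteq Ap$, $\psi[\nu]$ commutes with $\wedge,\vee$, replaces literals by their truth value under $\nu$, $(\mathbf X\psi)[\nu]=\psi$, and $\psi[\nu]=\psi$ otherwise. Let $\mathcal R\mathrm{ec}$ be the set of $\mathbf F$-, $\mathbf G$- and $\mathbf G^{\bowtie p}_{\mathrm{ext}}$-subformulas of $\varphi$. * The *master* starts in $\varphi$ and has the transitions $\psi\xrightarrow{\nu}\mathsf{Unf}(\psi)[\nu]$. * A *sink* is a $\psi$ with $\psi[\nu]=\psi$ for all $\nu$. The slave system of $\xi$ starts in $\xi$ and has the transitions $\psi\xrightarrow{\nu}\psi[\nu]$ for all $\psi$ that are not sinks. * The *slave automaton* of $\mathbf F\xi$, $\mathbf G\xi$ in $\mathcal R\mathrm{ec}$ has as states sets $\Psi$ of states of the slave system of $\xi$; in each step all tokens (the elements of $\Psi$) move along the slave system, those in sinks disappear, and a token is added in $\xi$; initially $\Psi=\{\xi\}$. For $\mathbf G^{\bowtie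 p}_{\mathrm{ext}}\xi$ it is the same, with the number $f(\psi)$ of tokens in each $\psi$ recorded. For $\mathcal R\subseteq\mathcal R\mathrm{ec}$ the slave acceptance condition is, for $\mathbf F\xi$: $\mathit{Inf}$ of the states with a token in a sink $\psi$ with $\mathcal R\vdash\psi$; for $\mathbf G\xi$: $\mathit{Fin}$ of the states with a token in a sink $\psi$ with $\mathcal R\not\vdash\psi$; for $\mathbf G^{\bowtie p}_{\mathrm{ext}}\xi$: $\mathit{MP}^{\bowtie p}_{\mathrm{ext}}(r)$, $r(f)$ being the number of tokens in sinks $\psi$ with $\mathcal R\vdash\psi$. * $\mathcal A_\varphi$ is the reachable part of the product of the master and the slave automata of all elements of $\mathcal R\mathrm{ec}$. Its acceptance condition is the disjunction over all $\mathcal R\subseteq\mathcal R\mathrm{ec}$ of the conjunction of the conditions (under $\mathcal R$) of the slaves of the elements of $\mathcal R$ and of $\mathit{Fin}$ of the set of states, with master component $\psi$ and token sets $\Psi_\xi$ of the slaves of $\mathbf G\xi$, for which $\mathcal R\cup\bigcup_{\mathbf G\xi\in\mathcal R}\Psi_\xi[(\mathcal R\mathrm{ec}\setminus\mathcal R)/\mathbf{ff}]\not\vdash\psi$;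 here $[Y/\mathbf{ff}]$ replaces the propositional variables in $Y$ by $\mathbf{ff}$. **Theorem.** For every finite $Ap$ and every $\mathrm{fLTL}_{\setminus\mathbf{GU}}$ formula $\varphi$ over $Ap$: 1. $\mathcal A_\varphi$ is a DGRMA (it has finitely many states), and it is equivalent to $\varphi$: (soundness) if $w\in\mathsf L(\mathcal A_\varphi)$ then $w\models\varphi$; (completeness) if $w\models\varphi$ then $w\in\mathsf L(\mathcal A_\varphi)$. 2. The acceptance condition of $\mathcal A_\varphi$ has exponential size: at most $2^{c|\varphi|}$, for a constant $c$ independent of $\varphi$ and $Ap$. 3. $\mathcal A_\varphi$ is constructible in doubly exponential time: there are one program and one polynomial $P$ such that for all $n$ and all $\mathrm{fLTL}_{\setminus\mathbf{GU}}$ formulae $\varphi$ over $Ap=\{0,\dots,n-1\}$ the program, given $n$ (in unary) and $\varphi$, halts within time $2^{2^{P(n+|\varphi|)}}$ and outputs $\mathcal A_\varphi$, written out in full up to a numbering of the states and the order of the disjuncts and conjuncts. (Programs are those of the WHILE language over binary trees, where reading a variable costs the size of its content.) -/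

import Mathlib

universe u v

namespace FLTL

/-! ## Frequency LTL -/

/-- Limit inferior or limit superior. -/
inductive Ext
  | inf
  | sup

/-- The comparisons `≥` and `>`. -/
inductive Cmp
  | ge
  | gt

/-- `c.holds x y` is `x ≥ y` or `x > y`. -/
def Cmp.holds : Cmp → ℝ → ℝ → Prop
  | .ge, x, y => x ≥ y
  | .gt, x, y => x > y

/-- The long-run average of a sequence: limit inferior or superior of its prefix averages. -/
noncomputable def lr (e : Ext) (q : ℕ → ℝ) : ℝ :=
  match e with
  | .inf => Filter.liminf (fun i : ℕ => (∑ j ∈ Finset.range i, q j) / (i : ℝ)) Filter.atTop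
  | .sup => Filter.limsup (fun i : ℕ => (∑ j ∈ Finset.range i, q j) / (i : ℝ)) Filter.atTop

/-- Formulae of frequency LTL over the atomic propositions `Ap`. `freq e c p φ` is the frequency
operator with bound `p ∈ [0,1] ∩ ℚ`. -/
inductive Formula (Ap : Type u) : Type u
  | tt : Formula Ap
  | ff : Formula Ap
  | atom (a : Ap) : Formula Ap
  | natom (a : Ap) : Formula Ap
  | and (φ ψ : Formula Ap) : Formula Ap
  | or (φ ψ : Formula Ap) : Formula Ap
  | X (φ : Formula Ap) : Formula Ap
  | F (φ : Formula Ap) : Formula Ap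
  | G (φ : Formula Ap) : Formula Ap
  | U (φ ψ : Formula Ap) : Formula Ap
  | freq (e : Ext) (c : Cmp) (p : Set.Icc (0 : ℚ) 1) (φ : Formula Ap) : Formula Ap

/-- Infinite words over the alphabet of subsets of `Ap`. -/
abbrev Word (Ap : Type u) : Type u := ℕ → Set Ap

/-- The suffix of a word that starts at position `k`. -/
def suffix {Ap : Type u} (w : Word Ap) (k : ℕ) : Word Ap := fun i => w (k + i)

open Classical in
/-- Satisfaction of a formula by a word. -/
noncomputable def Sat {Ap : Type u} : Word Ap → Formula Ap → Prop
  | _, .tt => True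
  | _, .ff => False
  | w, .atom a => a ∈ w 0
  | w, .natom a => a ∉ w 0
  | w, .and φ ψ => Sat w φ ∧ Sat w ψ
  | w, .or φ ψ => Sat w φ ∨ Sat w ψ
  | w, .X φ => Sat (suffix w 1) φ
  | w, .F φ => ∃ k, Sat (suffix w k) φ
  | w, .G φ => ∀ k, Sat (suffix w k) φ
  | w, .U φ ψ => ∃ k, Sat (suffix w k) ψ ∧ ∀ j < k, Sat (suffix w j) φ
  | w, .freq e c p φ =>
      c.holds (lr e (fun i => if Sat (suffix w i) φ then (1 : ℝ) else 0)) ((p : ℚ) : ℝ)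

namespace Formula

variable {Ap : Type u}

/-- The operator `U` does not occur. -/
def UFree : Formula Ap → Prop
  | .tt | .ff | .atom _ | .natom _ => True
  | .and φ ψ | .or φ ψ => UFree φ ∧ UFree ψ
  | .X φ | .F φ | .G φ | .freq _ _ _ φ => UFree φ
  | .U _ _ => False

/-- The fragment of fLTL in which `U` does not occur inside `G` or a frequency operator. -/
def NoUUnderG : Formula Ap → Prop
  | .tt | .ff | .atom _ | .natom _ => True
  | .and φ ψ | .or φ ψ | .U φ ψ => NoUUnderG φ ∧ NoUUnderG ψ
  | .X φ | .F φ => NoUUnderG φ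
  | .G φ | .freq _ _ _ φ => UFree φ

/-- The length of a formula: the number of its symbols, where a frequency bound counts with the
number of binary digits of its numerator and denominator. -/
def length : Formula Ap → ℕ
  | .tt | .ff | .atom _ | .natom _ => 1
  | .and φ ψ | .or φ ψ | .U φ ψ => 1 + length φ + length ψ
  | .X φ | .F φ | .G φ => 1 + length φ
  | .freq _ _ p φ => 1 + p.1.num.natAbs.size + p.1.den.size + length φ

/-- All subformulas. -/
def subformulas : Formula Ap → List (Formula Ap)
  | .tt => [.tt]
  | .ff => [.ff]
  | .atom a => [.atom a]
  | .natom a => [.natom a]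
  | .and φ ψ => .and φ ψ :: (subformulas φ ++ subformulas ψ)
  | .or φ ψ => .or φ ψ :: (subformulas φ ++ subformulas ψ)
  | .X φ => .X φ :: subformulas φ
  | .F φ => .F φ :: subformulas φ
  | .G φ => .G φ :: subformulas φ
  | .U φ ψ => .U φ ψ :: (subformulas φ ++ subformulas ψ)
  | .freq e c p φ => .freq e c p φ :: subformulas φ

/-- Whether the outermost operator is `F`, `G` or a frequency operator. -/
def isRec : Formula Ap → Bool
  | .F _ | .G _ | .freq _ _ _ _ => true
  | _ => false

open Classical in
/-- The set of `F`-, `G`- and frequency subformulas of a formula. -/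
noncomputable def recs (φ : Formula Ap) : Finset (Formula Ap) :=
  (φ.subformulas.filter isRec).toFinset

/-- One-step unfolding. -/
def unf : Formula Ap → Formula Ap
  | .and φ ψ => .and (unf φ) (unf ψ)
  | .or φ ψ => .or (unf φ) (unf ψ)
  | .F φ => .or (unf φ) (.X (.F φ))
  | .G φ => .and (unf φ) (.X (.G φ))
  | .U φ ψ => .or (unf ψ) (.and (unf φ) (.X (.U φ ψ)))
  | .freq e c p φ => .and .tt (.X (.freq e c p φ))
  | φ => φ

open Classical in
/-- The next step under a valuation, `φ[ν]`. -/
noncomputable def next (ν : Set Ap) : Formula Ap → Formula Ap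
  | .and φ ψ => .and (next ν φ) (next ν ψ)
  | .or φ ψ => .or (next ν φ) (next ν ψ)
  | .atom a => if a ∈ ν then .tt else .ff
  | .natom a => if a ∈ ν then .ff else .tt
  | .X φ => φ
  | φ => φ

open Classical in
/-- Propositional substitution of `ff` for the elements of `Y`, a set of formulae whose outermost
operators are neither Boolean connectives nor constants. -/
noncomputable def substFF (Y : Set (Formula Ap)) : Formula Ap → Formula Ap
  | .and φ ψ => .and (substFF Y φ) (substFF Y ψ)
  | .or φ ψ => .or (substFF Y φ) (substFF Y ψ)
  | .tt => .tt
  | .ff => .ff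
  | φ => if φ ∈ Y then .ff else φ

/-! ## Propositional reasoning -/

/-- The value of a formula under an assignment `V` of truth values to the formulae that are neither
conjunctions nor disjunctions nor constants (the other values of `V` are irrelevant). -/
def PSat (V : Formula Ap → Prop) : Formula Ap → Prop
  | .tt => True
  | .ff => False
  | .and φ ψ => PSat V φ ∧ PSat V ψ
  | .or φ ψ => PSat V φ ∨ PSat V ψ
  | φ => V φ

/-- Propositional equivalence. -/
instance propSetoid (Ap : Type u) : Setoid (Formula Ap) where
  r φ ψ := ∀ V, PSat V φ ↔ PSat V ψ
  iseqv := ⟨fun _ _ => Iff.rfl, fun h V => (h V).symm, fun h k V => (h V).trans (k V)⟩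

theorem psat_of_distrib (σ : Formula Ap → Formula Ap) (htt : σ .tt = .tt) (hff : σ .ff = .ff)
    (hand : ∀ φ ψ, σ (.and φ ψ) = .and (σ φ) (σ ψ)) (hor : ∀ φ ψ, σ (.or φ ψ) = .or (σ φ) (σ ψ))
    (V : Formula Ap → Prop) (φ : Formula Ap) :
    PSat V (σ φ) ↔ PSat (fun χ => PSat V (σ χ)) φ := by
  induction φ with
  | tt => rw [htt]; exact Iff.rfl
  | ff => rw [hff]; exact Iff.rfl
  | and φ ψ ih₁ ih₂ => rw [hand]; exact and_congr ih₁ ih₂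
  | or φ ψ ih₁ ih₂ => rw [hor]; exact or_congr ih₁ ih₂
  | _ => exact Iff.rfl

end Formula

/-- Boolean functions: formulae up to propositional equivalence. -/
abbrev BFun (Ap : Type u) : Type u := Quotient (Formula.propSetoid Ap)

namespace BFun

variable {Ap : Type u}

/-- The value of a Boolean function under an assignment. -/
def Holds (V : Formula Ap → Prop) : BFun Ap → Prop :=
  Quotient.lift (Formula.PSat V) (fun _ _ h => propext (h V))

/-- `Proves Φ ψ`: the set `Φ` propositionally proves `ψ`. -/
def Proves (Φ : Set (BFun Ap)) (ψ : BFun Ap) : Prop :=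
  ∀ V : Formula Ap → Prop, (∀ χ ∈ Φ, Holds V χ) → Holds V ψ

/-- The class of a formula. -/
def mk (φ : Formula Ap) : BFun Ap := Quotient.mk _ φ

/-- `ψ ↦ ψ[ν]` on Boolean functions. -/
noncomputable def next (ν : Set Ap) : BFun Ap → BFun Ap :=
  Quotient.map (Formula.next ν) (fun φ ψ h V => by
    have key := Formula.psat_of_distrib (Formula.next ν) rfl rfl (fun _ _ => rfl)
      (fun _ _ => rfl) V
    rw [key φ, key ψ]; exact h _)

/-- `ψ ↦ Unf(ψ)[ν]` on Boolean functions. -/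
noncomputable def unfNext (ν : Set Ap) : BFun Ap → BFun Ap :=
  Quotient.map (fun φ => Formula.next ν (Formula.unf φ)) (fun φ ψ h V => by
    have key := Formula.psat_of_distrib (fun φ => Formula.next ν (Formula.unf φ)) rfl rfl
      (fun _ _ => rfl) (fun _ _ => rfl) V
    exact (key φ).trans ((h _).trans (key ψ).symm))

/-- Substitution of `ff` for the elements of `Y` on Boolean functions. -/
noncomputable def substFF (Y : Set (Formula Ap)) : BFun Ap → BFun Ap :=
  Quotient.map (Formula.substFF Y) (fun φ ψ h V => by
    have key := Formula.psat_of_distrib (Formula.substFF Y) rfl rfl (fun _ _ => rfl)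
      (fun _ _ => rfl) V
    rw [key φ, key ψ]; exact h _)

/-- Sinks of the slave transition systems. -/
def IsSink (ψ : BFun Ap) : Prop := ∀ ν : Set Ap, next ν ψ = ψ

end BFun

/-! ## Transition systems and automata -/

/-- Deterministic labelled transition systems with a partial transition function. -/
structure LTS (A : Type u) (Q : Type v) where
  init : Q
  step : Q → A → Option Q

namespace LTS

variable {A : Type u} {Q : Type v}

/-- `ρ` is the run over `w`. -/
def IsRun (L : LTS A Q) (w : ℕ → A) (ρ : ℕ → Q) : Prop :=
  ρ 0 = L.init ∧ ∀ i, L.step (ρ i) (w i) = some (ρ (i + 1))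

/-- The states reachable from the initial state. -/
inductive Reachable (L : LTS A Q) : Q → Prop
  | init : Reachable L L.init
  | step {q : Q} {a : A} {q' : Q} : Reachable L q → L.step q a = some q' → Reachable L q'

/-- The restriction to the reachable states. -/
def reach (L : LTS A Q) : LTS A {q : Q // L.Reachable q} where
  init := ⟨L.init, .init⟩
  step q a := (L.step q.1 a).pmap (fun q' h => ⟨q', h⟩) (fun _ h => Reachable.step q.2 h)

/-- Synchronous product of two transition systems. -/
def prod {Q' : Type v} (L : LTS A Q) (L' : LTS A Q') : LTS A (Q × Q') where
  init := (L.init, L'.init)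
  step q a := (L.step q.1 a).bind fun q₁ => (L'.step q.2 a).map fun q₂ => (q₁, q₂)

open Classical in
/-- Synchronous product of a family of transition systems. -/
noncomputable def pi {I : Type u} {S : I → Type v} (L : ∀ i, LTS A (S i)) : LTS A (∀ i, S i) where
  init i := (L i).init
  step q a :=
    if h : ∀ i, ((L i).step (q i) a).isSome then some (fun i => ((L i).step (q i) a).get (h i))
    else none

end LTS

/-- The formal variables of acceptance conditions over the state set `Q`. -/
inductive AccVar (Q : Type v) : Type v
  | inf (S : Set Q) : AccVar Q
  | fin (S : Set Q) : AccVar Q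
  | mp (e : Ext) (c : Cmp) (p : ℚ) (r : Q → ℚ) : AccVar Q

namespace AccVar

/-- The truth value on a run. -/
noncomputable def Holds {Q : Type v} (ρ : ℕ → Q) : AccVar Q → Prop
  | .inf S => {i | ρ i ∈ S}.Infinite
  | .fin S => {i | ρ i ∈ S}.Finite
  | .mp e c p r => c.holds (lr e (fun i => ((r (ρ i) : ℚ) : ℝ))) (p : ℝ)

/-- The variable over `Q'` that holds on a sequence iff the given one holds on its image. -/
def comap {Q Q' : Type v} (f : Q' → Q) : AccVar Q → AccVar Q'
  | .inf S => .inf (f ⁻¹' S)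
  | .fin S => .fin (f ⁻¹' S)
  | .mp e c p r => .mp e c p (r ∘ f)

end AccVar

/-- Generalized Rabin mean-payoff acceptance conditions: positive Boolean formulae in disjunctive
normal form, given as the list of their disjuncts, each a list of conjoined variables. -/
abbrev GRMAcc (Q : Type v) : Type v := List (List (AccVar Q))

namespace GRMAcc

/-- The condition is satisfied by the run. -/
def Holds {Q : Type v} (ρ : ℕ → Q) (α : GRMAcc Q) : Prop :=
  ∃ C ∈ α, ∀ x ∈ C, x.Holds ρ

/-- The size of a condition: the number of occurrences of variables plus the number of disjuncts. -/
def size {Q : Type v} (α : GRMAcc Q) : ℕ := (α.map (fun C => C.length + 1)).sum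

/-- Pointwise inverse image of a condition. -/
def comap {Q Q' : Type v} (f : Q' → Q) (α : GRMAcc Q) : GRMAcc Q' :=
  α.map (fun C => C.map (AccVar.comap f))

/-- Equality up to the order of disjuncts and of conjuncts. -/
def Same {Q : Type v} (α β : GRMAcc Q) : Prop :=
  ((α.map (fun C => (C : Multiset (AccVar Q)))) : Multiset (Multiset (AccVar Q))) =
    (β.map (fun C => (C : Multiset (AccVar Q))) : List (Multiset (AccVar Q)))

end GRMAcc

/-- Deterministic generalized Rabin mean-payoff automata; finiteness of the state set `Q` is
demanded separately. -/
structure DGRMA (A : Type u) (Q : Type v) extends LTS A Q where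
  acc : GRMAcc Q

namespace DGRMA

variable {A : Type u} {Q : Type v}

/-- The language of an automaton. -/
def language (M : DGRMA A Q) : Set (ℕ → A) :=
  {w | ∃ ρ, M.IsRun w ρ ∧ M.acc.Holds ρ}

/-- The restriction of an automaton to its reachable states. -/
def reach (M : DGRMA A Q) : DGRMA A {q : Q // M.toLTS.Reachable q} where
  toLTS := M.toLTS.reach
  acc := M.acc.comap Subtype.val

/-- Isomorphism of automata along a renaming of the states. -/
def IsIso {Q' : Type v} (M : DGRMA A Q) (M' : DGRMA A Q') (e : Q ≃ Q') : Prop :=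
  e M.init = M'.init ∧ (∀ q a, M'.step (e q) a = (M.step q a).map e) ∧
    M.acc.Same (M'.acc.comap e)

end DGRMA

/-! ## The automaton of a formula -/

section Construction

variable {Ap : Type u}

/-- The master transition system. -/
noncomputable def master (φ : Formula Ap) : LTS (Set Ap) (BFun Ap) where
  init := .mk φ
  step ψ ν := some (ψ.unfNext ν)

open Classical in
/-- The slave transition system of `ξ`. -/
noncomputable def slaveLTS (ξ : Formula Ap) : LTS (Set Ap) (BFun Ap) where
  init := .mk ξ
  step ψ ν := if ψ.IsSink then none else some (ψ.next ν)

/-- The subset construction: sets of states of the slave that carry a token. -/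
noncomputable def tokenSetLTS (ξ : Formula Ap) : LTS (Set Ap) (Set (BFun Ap)) where
  init := {.mk ξ}
  step Ψ ν := some ({ψ' | ∃ ψ ∈ Ψ, (slaveLTS ξ).step ψ ν = some ψ'} ∪ {.mk ξ})

/-- The counting construction: the number of tokens in each state of the slave. -/
noncomputable def tokenCountLTS (ξ : Formula Ap) : LTS (Set Ap) (BFun Ap →₀ ℕ) where
  init := Finsupp.single (.mk ξ) 1
  step f ν := some (Finsupp.single (.mk ξ) 1 +
    f.sum (fun ψ k => match (slaveLTS ξ).step ψ ν with
      | some ψ' => Finsupp.single ψ' k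
      | none => 0))

/-- States of the slave automaton for an `F`-, `G`- or frequency formula (trivial otherwise). -/
def SlaveState : Formula Ap → Type u
  | .F _ => Set (BFun Ap)
  | .G _ => Set (BFun Ap)
  | .freq _ _ _ _ => BFun Ap →₀ ℕ
  | _ => PUnit

/-- The transition system of the slave automaton for an `F`-, `G`- or frequency formula. -/
noncomputable def slave : (χ : Formula Ap) → LTS (Set Ap) (SlaveState χ)
  | .F ξ => tokenSetLTS ξ
  | .G ξ => tokenSetLTS ξ
  | .freq _ _ _ ξ => tokenCountLTS ξ
  | .tt | .ff | .atom _ | .natom _ | .and _ _ | .or _ _ | .X _ | .U _ _ =>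
      ⟨PUnit.unit, fun _ _ => some PUnit.unit⟩

open Classical in
/-- The acceptance condition of the slave automaton under the assumptions `R`: Büchi for `F`,
co-Büchi for `G`, mean-payoff for frequency formulae. -/
noncomputable def slaveAcc (R : Set (BFun Ap)) : (χ : Formula Ap) → AccVar (SlaveState χ)
  | .F _ => .inf {Ψ : Set (BFun Ap) | ∃ ψ ∈ Ψ, ψ.IsSink ∧ BFun.Proves R ψ}
  | .G _ => .fin {Ψ : Set (BFun Ap) | ∃ ψ ∈ Ψ, ψ.IsSink ∧ ¬ BFun.Proves R ψ}
  | .freq e c p _ => .mp e c p (fun f : BFun Ap →₀ ℕ =>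
      f.sum (fun ψ k => if ψ.IsSink ∧ BFun.Proves R ψ then (k : ℚ) else 0))
  | .tt | .ff | .atom _ | .natom _ | .and _ _ | .or _ _ | .X _ | .U _ _ => .inf Set.univ

/-- The tokens of the slave of a `G`-formula (none for other formulae). -/
def gTokens : (χ : Formula Ap) → SlaveState χ → Set (BFun Ap)
  | .G _, Ψ => Ψ
  | _, _ => ∅

/-- The states of the product of the master and all slaves. -/
abbrev ProdState (φ : Formula Ap) : Type u :=
  BFun Ap × (∀ χ : {χ // χ ∈ φ.recs}, SlaveState χ.1)

/-- What the assumptions `R` and the tokens of the slaves of the `G`-formulae in `R` provide. -/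
def extendedAssumptions (φ : Formula Ap) (R : Finset (Formula Ap))
    (s : ∀ χ : {χ // χ ∈ φ.recs}, SlaveState χ.1) : Set (BFun Ap) :=
  BFun.mk '' (R : Set (Formula Ap)) ∪
    {b | ∃ χ : {χ // χ ∈ φ.recs}, χ.1 ∈ R ∧ ∃ ψ ∈ gTokens χ.1 (s χ),
      b = ψ.substFF {θ | θ ∈ φ.recs ∧ θ ∉ R}}

/-- The acceptance condition of the master under the assumptions `R`. -/
def masterAcc (φ : Formula Ap) (R : Finset (Formula Ap)) : AccVar (ProdState φ) :=
  .fin {q | ¬ BFun.Proves (extendedAssumptions φ R q.2) q.1}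

open Classical in
/-- The conjunction of the master condition and the slave conditions for the assumptions `R`. -/
noncomputable def clause (φ : Formula Ap) (R : Finset (Formula Ap)) : List (AccVar (ProdState φ)) :=
  masterAcc φ R ::
    (φ.recs.attach.filter (fun χ => χ.1 ∈ R)).toList.map
      (fun χ => (slaveAcc (BFun.mk '' (R : Set (Formula Ap))) χ.1).comap (fun q => q.2 χ))

/-- The product of the master and the slaves, with the disjunction over all sets of assumptions. -/
noncomputable def productAutomaton (φ : Formula Ap) : DGRMA (Set Ap) (ProdState φ) where
  toLTS := (master φ).prod (LTS.pi (fun χ : {χ // χ ∈ φ.recs} => slave χ.1))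
  acc := φ.recs.powerset.toList.map (clause φ)

/-- The states of the automaton of a formula: the reachable states of the product. -/
abbrev AutState (φ : Formula Ap) : Type u :=
  {q : ProdState φ // (productAutomaton φ).toLTS.Reachable q}

/-- The automaton of a formula. -/
noncomputable def automaton (φ : Formula Ap) : DGRMA (Set Ap) (AutState φ) :=
  (productAutomaton φ).reach

end Construction

/-! ## Machine model: the WHILE language over binary trees -/

/-- The data of the machine model: binary trees. -/
inductive Dat
  | nil
  | cons (l r : Dat)

namespace Dat

/-- The number of nodes, leaves included. -/
def size : Dat → ℕ
  | .nil => 1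
  | .cons l r => 1 + size l + size r

def hd : Dat → Dat
  | .nil => .nil
  | .cons l _ => l

def tl : Dat → Dat
  | .nil => .nil
  | .cons _ r => r

end Dat

/-- Contents of the variables. -/
abbrev Store : Type := ℕ → Dat

/-- Expressions. -/
inductive Exp
  | var (i : ℕ)
  | nil
  | cons (a b : Exp)
  | hd (a : Exp)
  | tl (a : Exp)

namespace Exp

def eval (σ : Store) : Exp → Dat
  | .var i => σ i
  | .nil => .nil
  | .cons a b => .cons (eval σ a) (eval σ b)
  | .hd a => (eval σ a).hd
  | .tl a => (eval σ a).tl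

/-- The cost of an evaluation. Reading a variable costs the size of its content (it is copied), every
other operation costs one; so the size of the value never exceeds the cost. -/
def cost (σ : Store) : Exp → ℕ
  | .var i => (σ i).size
  | .nil => 1
  | .cons a b => 1 + cost σ a + cost σ b
  | .hd a => 1 + cost σ a
  | .tl a => 1 + cost σ a

end Exp

/-- Programs: assignment, composition, conditional and loop; a test succeeds iff the value of the
expression is not `nil`. -/
inductive Prog
  | assign (i : ℕ) (e : Exp)
  | seq (c d : Prog)
  | ite (e : Exp) (c d : Prog)
  | while (e : Exp) (c : Prog)

/-- `Exec c σ t σ'`: started in the store `σ`, the program `c` halts in the store `σ'` after time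
`t`. -/
inductive Exec : Prog → Store → ℕ → Store → Prop
  | assign (i : ℕ) (e : Exp) (σ : Store) :
      Exec (.assign i e) σ (1 + e.cost σ) (Function.update σ i (e.eval σ))
  | seq {c d : Prog} {σ σ' σ'' : Store} {t t' : ℕ} :
      Exec c σ t σ' → Exec d σ' t' σ'' → Exec (.seq c d) σ (1 + t + t') σ''
  | ite_true {e : Exp} {c d : Prog} {σ σ' : Store} {t : ℕ} :
      e.eval σ ≠ .nil → Exec c σ t σ' → Exec (.ite e c d) σ (1 + e.cost σ + t) σ'
  | ite_false {e : Exp} {c d : Prog} {σ σ' : Store} {t : ℕ} :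
      e.eval σ = .nil → Exec d σ t σ' → Exec (.ite e c d) σ (1 + e.cost σ + t) σ'
  | while_true {e : Exp} {c : Prog} {σ σ' σ'' : Store} {t t' : ℕ} :
      e.eval σ ≠ .nil → Exec c σ t σ' → Exec (.while e c) σ' t' σ'' →
      Exec (.while e c) σ (1 + e.cost σ + t + t') σ''
  | while_false {e : Exp} {c : Prog} {σ : Store} :
      e.eval σ = .nil → Exec (.while e c) σ (1 + e.cost σ) σ

/-- On input `x` (in variable `0`, all other variables being `nil`), the program halts within time
`T` with output `y` (in variable `0`). -/
def Prog.OutputsWithin (c : Prog) (x y : Dat) (T : ℕ) : Prop :=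
  ∃ t ≤ T, ∃ σ', Exec c (Function.update (fun _ => Dat.nil) 0 x) t σ' ∧ σ' 0 = y

/-! ## Encoding of formulae and automata as trees -/

namespace Enc

def list : List Dat → Dat
  | [] => .nil
  | x :: xs => .cons x (list xs)

/-- Natural numbers in unary. -/
def unary : ℕ → Dat
  | 0 => .nil
  | k + 1 => .cons .nil (unary k)

def bool : Bool → Dat
  | false => .nil
  | true => .cons .nil .nil

def option : Option Dat → Dat
  | none => .nil
  | some x => .cons x .nil

/-- Natural numbers in binary, least significant digit first. -/
def binary (k : ℕ) : Dat := list (k.bits.map bool)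

/-- Rational numbers: sign, numerator and denominator. -/
def rat (q : ℚ) : Dat :=
  list [bool (decide (q < 0)), binary q.num.natAbs, binary q.den]

def ext : Ext → Dat
  | .inf => bool false
  | .sup => bool true

def cmp : Cmp → Dat
  | .ge => bool false
  | .gt => bool true

/-- Formulae over the propositions `0, …, n - 1`, as syntax trees with a tag for each operator. -/
def formula {n : ℕ} : Formula (Fin n) → Dat
  | .tt => list [unary 0]
  | .ff => list [unary 1]
  | .atom a => list [unary 2, unary a]
  | .natom a => list [unary 3, unary a]
  | .and φ ψ => list [unary 4, formula φ, formula ψ]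
  | .or φ ψ => list [unary 5, formula φ, formula ψ]
  | .X φ => list [unary 6, formula φ]
  | .F φ => list [unary 7, formula φ]
  | .G φ => list [unary 8, formula φ]
  | .U φ ψ => list [unary 9, formula φ, formula ψ]
  | .freq e c p φ => list [unary 10, ext e, cmp c, rat p, formula φ]

/-- The input: the number of propositions and the formula. -/
def input (n : ℕ) (φ : Formula (Fin n)) : Dat := .cons (unary n) (formula φ)

/-- The letter with number `k`: the set of the positions of the ones in the binary expansion. -/
def letter (n k : ℕ) : Set (Fin n) := {i | k.testBit i = true}

open Classical in
/-- Sets of states, as bit vectors. -/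
noncomputable def stateSet {N : ℕ} (S : Set (Fin N)) : Dat :=
  list (List.ofFn (fun q : Fin N => bool (decide (q ∈ S))))

/-- Variables of acceptance conditions; rewards are listed for all states. -/
noncomputable def accVar {N : ℕ} : AccVar (Fin N) → Dat
  | .inf S => list [unary 0, stateSet S]
  | .fin S => list [unary 1, stateSet S]
  | .mp e c p r => list [unary 2, ext e, cmp c, rat p, list (List.ofFn (fun q => rat (r q)))]

/-- Automata with states `0, …, N - 1`, written out in full: the initial state, the table of the
transition function, with a row for each state and an entry for each of the `2 ^ n` letters, and the
acceptance condition. -/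
noncomputable def automaton {n N : ℕ} (B : DGRMA (Set (Fin n)) (Fin N)) : Dat :=
  list [unary B.init,
    list (List.ofFn (fun q : Fin N => list (List.ofFn (fun k : Fin (2 ^ n) =>
      option ((B.step q (letter n k)).map (fun q' => unary q')))))),
    list (B.acc.map (fun C => list (C.map accVar)))]

end Enc

end FLTL

namespace FLTL

/-! ## Uniform computations of families of trees -/

/-! Slaves. A word has exactly one run in the product, so acceptance means that for some set `R` of
assumptions the master condition and the slave conditions of the elements of `R` hold along this run
(`mem_language_iff`). The token born at position `b` evaluates the body `ξ` of its slave within a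
bounded window and treats `F`-, `G`- and frequency formulae as variables. Formulae are positive, so
being provable from `R` is the same as being true under the least assignment that satisfies `R`
(`BFun.proves_iff`). Hence the sink reached by the token is provable from `R` iff `ξ` is true at `b`
when exactly the elements of `R` count as true (`TR`, `proves_token_iff`). So the slave conditions
say that `TR` holds of the body infinitely often, almost always, or with the required long-run
frequency. In the last case the sums of rewards and the numbers of good positions differ by a
bounded amount, since every good token is paid after a bounded delay (`slaveAcc_freq_iff`).

Soundness. By induction on formulae, assumptions whose slaves accept are true at almost all
positions (`eventually_sat_of_TR`). The master formula is true now iff `φ` was true at the start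
(`sat_after`), and at a late time it follows from assumptions and tokens that are all true.

Completeness. `R` consists of the `U`-free elements of `φ.recs` that are true at almost all
positions. At late positions truth implies `TR` (`eventually_TR_of_sat`), so the slaves accept. The
master formula becomes provable: obligations from `F` and `U` are met in finite time, and whatever a
`G`-formula keeps adding is matched by the tokens of its slave (`psat_after_of_token`,
`eventually_psat_after`). The latter needs `U`-free bodies, because tokens do not unfold `U`.

Size. Write m for the length of `φ`. There are at most 2^m sets `R`, with at most m + 1 variables
each. Master component and tokens are Boolean functions of the subformulas of `φ`, of which there
are at most 2^(2^m), and the joint state of the slaves depends only on the last m letters and on the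
number of letters read, up to m (`reachable_finite`).

Computation. `PT` is polynomial-time computability uniform in an index; it is closed under pairing,
case distinction, recursion on lists and loops, so programs never have to be written out. The code
of the automaton is in `PT` of `base φ`, which contains a doubly exponential number in unary;
thereby all enumerations (truth tables, states) are polynomial. Only the production of this number,
two runs of `Runs.exp`, exceeds polynomial time. Boolean functions are coded by truth tables and
token multisets by lists in a canonical order, so that states are equal iff their codes are
(`stateCode_eq_iff`), and a search for new codes finds and numbers the reachable states. -/

theorem Dat.size_pos (d : Dat) : 1 ≤ d.size := by
  cases d <;> simp only [Dat.size] <;> omega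

theorem Dat.size_hd_le (d : Dat) : d.hd.size ≤ d.size := by
  cases d <;> simp only [Dat.size, Dat.hd] <;> omega

theorem Dat.size_tl_le (d : Dat) : d.tl.size ≤ d.size := by
  cases d <;> simp only [Dat.size, Dat.tl] <;> omega

/-- One program, placed at an arbitrary variable `k`, transforms `a i` into `b i` within time `T i`
for all `i`; the variables below `k` are preserved. -/
def Runs {ι : Type} (a b : ι → Dat) (T : ι → ℕ) : Prop :=
  ∃ c : ℕ → Prog, ∀ (i : ι) (k : ℕ) (σ : Store), σ k = a i →
    ∃ t σ', Exec (c k) σ t σ' ∧ σ' k = b i ∧ (∀ j < k, σ' j = σ j) ∧ t ≤ T i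

/-- `f` is bounded by a polynomial in the size of `a`. -/
def PB {ι : Type} (a : ι → Dat) (f : ι → ℕ) : Prop :=
  ∃ d : ℕ, ∀ i, f i ≤ ((a i).size + 1) ^ d

/-- The family `b` is computable from the family `a` in polynomial time, uniformly in the index. -/
def PT {ι : Type} (a b : ι → Dat) : Prop :=
  ∃ T, Runs a b T ∧ PB a T ∧ PB a (fun i => (b i).size)

namespace PB

variable {ι : Type} {a : ι → Dat} {f g : ι → ℕ}

theorem mono (h : PB a f) (hg : ∀ i, g i ≤ f i) : PB a g :=
  let ⟨d, hd⟩ := h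
  ⟨d, fun i => (hg i).trans (hd i)⟩

theorem add (hf : PB a f) (hg : PB a g) : PB a (fun i => f i + g i) := by
  obtain ⟨d, hd⟩ := hf
  obtain ⟨e, he⟩ := hg
  refine ⟨d + e + 1, fun i => ?_⟩
  -- A tree has at least one node, so the base of the power is at least 2 and one extra factor
  -- absorbs the sum of two equal powers.
  have h2 : 2 ≤ (a i).size + 1 := by have := (a i).size_pos; omega
  have h1 : 1 ≤ (a i).size + 1 := by omega
  calc f i + g i ≤ ((a i).size + 1) ^ (d + e) + ((a i).size + 1) ^ (d + e) :=
        Nat.add_le_add ((hd i).trans (Nat.pow_le_pow_right h1 (by omega)))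
          ((he i).trans (Nat.pow_le_pow_right h1 (by omega)))
    _ = ((a i).size + 1) ^ (d + e) * 2 := by ring
    _ ≤ ((a i).size + 1) ^ (d + e) * ((a i).size + 1) := Nat.mul_le_mul_left _ h2
    _ = _ := by ring

theorem mul (hf : PB a f) (hg : PB a g) : PB a (fun i => f i * g i) := by
  obtain ⟨d, hd⟩ := hf
  obtain ⟨e, he⟩ := hg
  exact ⟨d + e, fun i => by rw [pow_add]; exact Nat.mul_le_mul (hd i) (he i)⟩

theorem const (n : ℕ) : PB a (fun _ => n) := by
  refine ⟨n, fun i => ?_⟩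
  have h2 : 2 ≤ (a i).size + 1 := by have := (a i).size_pos; omega
  exact Nat.lt_two_pow_self.le.trans (Nat.pow_le_pow_left h2 n)

theorem self : PB a (fun i => (a i).size) := ⟨1, fun i => by simp⟩

theorem pow (hf : PB a f) (n : ℕ) : PB a (fun i => f i ^ n) := by
  obtain ⟨d, hd⟩ := hf
  exact ⟨d * n, fun i => by rw [pow_mul]; exact Nat.pow_le_pow_left (hd i) n⟩

theorem of_size {b : ι → Dat} (hb : PB a (fun i => (b i).size)) (hf : PB b f) : PB a f := by
  obtain ⟨d, hd⟩ := hf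
  exact ((hb.add (const 1)).pow d).mono hd

theorem precomp {κ : Type} (h : PB a f) (r : κ → ι) : PB (a ∘ r) (f ∘ r) :=
  let ⟨d, hd⟩ := h
  ⟨d, fun i => hd (r i)⟩

end PB

namespace Runs

variable {ι : Type} {a b c : ι → Dat} {S T : ι → ℕ}

theorem mono (h : Runs a b T) (hS : ∀ i, T i ≤ S i) : Runs a b S := by
  obtain ⟨c, hc⟩ := h
  refine ⟨c, fun i k σ hσ => ?_⟩
  obtain ⟨t, σ', h1, h2, h3, h4⟩ := hc i k σ hσ
  exact ⟨t, σ', h1, h2, h3, h4.trans (hS i)⟩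

theorem comp (hb : Runs a b T) (hc : Runs b c S) : Runs a c (fun i => 1 + T i + S i) := by
  obtain ⟨p, hp⟩ := hb
  obtain ⟨q, hq⟩ := hc
  refine ⟨fun k => .seq (p k) (q k), fun i k σ hσ => ?_⟩
  obtain ⟨t, σ', h1, h2, h3, h4⟩ := hp i k σ hσ
  obtain ⟨t', σ'', k1, k2, k3, k4⟩ := hq i k σ' h2
  exact ⟨_, σ'', .seq h1 k1, k2, fun j hj => (k3 j hj).trans (h3 j hj), by dsimp only; omega⟩

/-- Evaluation of an expression in a single variable. -/
theorem assign (e : ℕ → Exp) (he : ∀ i k (σ : Store), σ k = a i → (e k).eval σ = b i)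
    (hc : ∀ i k (σ : Store), σ k = a i → 1 + (e k).cost σ ≤ T i) : Runs a b T :=
  ⟨fun k => .assign k (e k), fun i k σ hσ => ⟨_, _, .assign k (e k) σ,
    by simp [he i k σ hσ], fun j hj => by simp [hj.ne], hc i k σ hσ⟩⟩

/-- The first program works at `k + 1` on a copy of the input, which preserves variable `k`; the
second works at `k + 2` on another copy, which preserves the first result. This is what the
arbitrary placement and the preservation clause of `Runs` are for. -/
theorem cons (hb : Runs a b T) (hc : Runs a c S) :
    Runs a (fun i => .cons (b i) (c i))
      (fun i => T i + S i + 2 * (a i).size + (b i).size + (c i).size + 8) := by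
  obtain ⟨p, hp⟩ := hb
  obtain ⟨q, hq⟩ := hc
  refine ⟨fun k => .seq (.assign (k + 1) (.var k)) (.seq (p (k + 1)) (.seq (.assign (k + 2) (.var k))
    (.seq (q (k + 2)) (.assign k (.cons (.var (k + 1)) (.var (k + 2))))))), fun i k σ hσ => ?_⟩
  obtain ⟨t, σ₁, h1, h2, h3, h4⟩ := hp i (k + 1) (Function.update σ (k + 1) (σ k)) (by simp [hσ])
  have hk : σ₁ k = a i := by rw [h3 k (by omega)]; simp [hσ]
  obtain ⟨t', σ₂, k1, k2, k3, k4⟩ := hq i (k + 2) (Function.update σ₁ (k + 2) (σ₁ k)) (by simp [hk])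
  have hk1 : σ₂ (k + 1) = b i := by rw [k3 _ (by omega)]; simp [h2]
  refine ⟨_, _, .seq (.assign _ _ _) (.seq h1 (.seq (.assign _ _ _) (.seq k1 (.assign _ _ _)))),
    ?_, ?_, ?_⟩
  · simp [Exp.eval, k2, hk1]
  · intro j hj
    rw [Function.update_of_ne hj.ne, k3 j (by omega), Function.update_of_ne (by omega),
      h3 j (by omega), Function.update_of_ne (by omega)]
  · simp only [Exp.cost, k2, hk1, hσ, hk]
    omega

/-- Case distinction: the index set is split according to a test. -/
theorem cases {t : ι → Dat} (ht : Runs a t T)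
    (hb : Runs (fun i : {i // t i ≠ .nil} => a i) (fun i => b i) (fun i => S i))
    (hc : Runs (fun i : {i // t i = .nil} => a i) (fun i => b i) (fun i => S i)) :
    Runs a b (fun i => T i + S i + (a i).size + (t i).size + 4) := by
  obtain ⟨p, hp⟩ := ht
  obtain ⟨q, hq⟩ := hb
  obtain ⟨r, hr⟩ := hc
  refine ⟨fun k => .seq (.assign (k + 1) (.var k)) (.seq (p (k + 1))
    (.ite (.var (k + 1)) (q k) (r k))), fun i k σ hσ => ?_⟩
  obtain ⟨t', σ₁, h1, h2, h3, h4⟩ := hp i (k + 1) (Function.update σ (k + 1) (σ k)) (by simp [hσ])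
  have hk : σ₁ k = a i := by rw [h3 k (by omega)]; simp [hσ]
  have hpres : ∀ j < k, σ₁ j = σ j := fun j hj => by
    rw [h3 j (by omega), Function.update_of_ne (by omega)]
  by_cases hn : t i = .nil
  · obtain ⟨t'', σ₂, k1, k2, k3, k4⟩ := hr ⟨i, hn⟩ k σ₁ hk
    refine ⟨_, _, .seq (.assign _ _ _) (.seq h1 (.ite_false (by simp [Exp.eval, h2, hn]) k1)), k2,
      fun j hj => (k3 j hj).trans (hpres j hj), ?_⟩
    simp only [Exp.cost, hσ, h2] at k4 ⊢
    omega
  · obtain ⟨t'', σ₂, k1, k2, k3, k4⟩ := hq ⟨i, hn⟩ k σ₁ hk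
    refine ⟨_, _, .seq (.assign _ _ _) (.seq h1 (.ite_true (by simp [Exp.eval, h2, hn]) k1)), k2,
      fun j hj => (k3 j hj).trans (hpres j hj), ?_⟩
    simp only [Exp.cost, hσ, h2] at k4 ⊢
    omega

/-- A loop that runs through the states `s i 0, …, s i (m i)`, until the head is `nil`. -/
theorem loop {s : ι → ℕ → Dat} {m z τ : ι → ℕ}
    (hstep : Runs (fun p : (i : ι) × Fin (m i) => s p.1 p.2) (fun p => s p.1 (p.2 + 1))
      (fun p => τ p.1))
    (htest : ∀ i, ∀ j < m i, (s i j).hd ≠ .nil) (hend : ∀ i, (s i (m i)).hd = .nil)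
    (hz : ∀ i, ∀ j ≤ m i, (s i j).size ≤ z i) :
    Runs (fun i => s i 0) (fun i => s i (m i)) (fun i => (m i + 1) * (2 + z i + τ i)) := by
  obtain ⟨c, hc⟩ := hstep
  refine ⟨fun k => .while (.hd (.var k)) (c k), fun i k σ hσ => ?_⟩
  -- Induction on the number `r` of rounds still to come.
  suffices H : ∀ r j, j + r = m i → ∀ σ : Store, σ k = s i j →
      ∃ t σ', Exec (.while (.hd (.var k)) (c k)) σ t σ' ∧ σ' k = s i (m i) ∧
        (∀ j < k, σ' j = σ j) ∧ t ≤ (r + 1) * (2 + z i + τ i) from H (m i) 0 (by omega) σ hσ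
  intro r
  induction r with
  | zero =>
    intro j hj σ hσ
    have hj : j = m i := by omega
    subst hj
    refine ⟨_, σ, .while_false (by simp [Exp.eval, hσ, hend]), hσ, fun _ _ => rfl, ?_⟩
    simp only [Exp.cost, hσ]
    have := hz i (m i) le_rfl
    omega
  | succ r ih =>
    intro j hj σ hσ
    have hj' : j < m i := by omega
    obtain ⟨t, σ₁, h1, h2, h3, h4⟩ := hc ⟨i, j, hj'⟩ k σ hσ
    obtain ⟨t', σ₂, k1, k2, k3, k4⟩ := ih (j + 1) (by omega) σ₁ h2
    refine ⟨_, σ₂, .while_true (by simpa [Exp.eval, hσ] using htest i j hj') h1 k1, k2,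
      fun l hl => (k3 l hl).trans (h3 l hl), ?_⟩
    simp only [Exp.cost, hσ] at h4 ⊢
    have := hz i j hj'.le
    have : (r + 1 + 1) * (2 + z i + τ i) = (r + 1) * (2 + z i + τ i) + (2 + z i + τ i) := by ring
    omega

theorem precomp {κ : Type} (h : Runs a b T) (r : κ → ι) :
    Runs (fun i => a (r i)) (fun i => b (r i)) (fun i => T (r i)) :=
  let ⟨c, hc⟩ := h
  ⟨c, fun i => hc (r i)⟩

end Runs

namespace PT

variable {ι κ : Type} {a b c : ι → Dat}

theorem size (h : PT a b) : PB a (fun i => (b i).size) := let ⟨_, _, _, h⟩ := h; h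

theorem bound (h : PT a b) {f : ι → ℕ} (hf : PB b f) : PB a f := .of_size h.size hf

/-- The second program is polynomial in the intermediate result only; the size bound contained in
`PT` converts this into a polynomial in `a`. -/
theorem comp (hb : PT a b) (hc : PT b c) : PT a c := by
  have hs := hb.bound hc.size
  obtain ⟨T, h1, h2, h3⟩ := hb
  obtain ⟨S, k1, k2, k3⟩ := hc
  exact ⟨_, h1.comp k1, ((PB.const 1).add h2).add (.of_size h3 k2), hs⟩

theorem precomp (h : PT a b) (r : κ → ι) : PT (fun i => a (r i)) (fun i => b (r i)) :=
  let ⟨_, h1, h2, h3⟩ := h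
  ⟨_, h1.precomp r, h2.precomp r, h3.precomp r⟩

theorem congr {b' : ι → Dat} (h : PT a b) (hb : ∀ i, b i = b' i) : PT a b' :=
  (funext hb : b = b') ▸ h

theorem congr_left {a' : ι → Dat} (h : PT a b) (ha : ∀ i, a i = a' i) : PT a' b :=
  (funext ha : a = a') ▸ h

theorem refl : PT a a :=
  ⟨fun i => 1 + (a i).size, .assign (fun k => .var k) (fun _ _ _ h => h)
    (fun i k σ h => by simp [Exp.cost, h]), (PB.const 1).add .self, .self⟩

theorem nil : PT a (fun _ => .nil) :=
  ⟨fun _ => 2, .assign (fun _ => .nil) (fun _ _ _ _ => rfl) (fun i k σ h => by simp [Exp.cost]),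
    .const 2, .const 1⟩

theorem cons (hb : PT a b) (hc : PT a c) : PT a (fun i => .cons (b i) (c i)) := by
  obtain ⟨T, h1, h2, h3⟩ := hb
  obtain ⟨S, k1, k2, k3⟩ := hc
  exact ⟨_, h1.cons k1, ((((h2.add k2).add ((PB.const 2).mul .self)).add h3).add k3).add (.const 8),
    ((PB.const 1).add h3).add k3⟩

theorem const (d : Dat) : PT a (fun _ => d) := by
  induction d with
  | nil => exact nil
  | cons l r hl hr => exact hl.cons hr

theorem hd (h : PT a b) : PT a (fun i => (b i).hd) :=
  h.comp ⟨fun i => 2 + (b i).size, .assign (fun k => .hd (.var k)) (fun i k σ h => by simp [Exp.eval, h])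
    (fun i k σ h => by simp only [Exp.cost, h]; omega), (PB.const 2).add .self,
    PB.self.mono fun i => Dat.size_hd_le _⟩

theorem tl (h : PT a b) : PT a (fun i => (b i).tl) :=
  h.comp ⟨fun i => 2 + (b i).size, .assign (fun k => .tl (.var k)) (fun i k σ h => by simp [Exp.eval, h])
    (fun i k σ h => by simp only [Exp.cost, h]; omega), (PB.const 2).add .self,
    PB.self.mono fun i => Dat.size_tl_le _⟩

theorem left {b c : ι → Dat} : PT (fun i => .cons (b i) (c i)) b := (refl (a := fun i => .cons (b i) (c i))).hd

theorem right {b c : ι → Dat} : PT (fun i => .cons (b i) (c i)) c := (refl (a := fun i => .cons (b i) (c i))).tl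

/-- Case distinction: the index set is split according to a test. -/
theorem cases {t : ι → Dat} (ht : PT a t)
    (hb : PT (fun i : {i // t i ≠ .nil} => a i) (fun i => b i))
    (hc : PT (fun i : {i // t i = .nil} => a i) (fun i => b i)) : PT a b := by
  obtain ⟨T, h1, h2, h3⟩ := ht
  obtain ⟨S, k1, ⟨d, k2⟩, e, k3⟩ := hb
  obtain ⟨S', l1, ⟨d', l2⟩, e', l3⟩ := hc
  have hle : ∀ i x y, ((a i).size + 1) ^ x ≤ ((a i).size + 1) ^ (x + y) := fun i x y =>
    Nat.pow_le_pow_right (by omega) (by omega)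
  have hle' : ∀ i x y, ((a i).size + 1) ^ y ≤ ((a i).size + 1) ^ (x + y) := fun i x y =>
    Nat.pow_le_pow_right (by omega) (by omega)
  refine ⟨_, h1.cases (S := fun i => ((a i).size + 1) ^ (d + d'))
    (k1.mono fun i => (k2 i).trans (hle i d d')) (l1.mono fun i => (l2 i).trans (hle' i d d')),
    (((h2.add ⟨d + d', fun _ => le_rfl⟩).add .self).add h3).add (.const 4), e + e', fun i => ?_⟩
  by_cases hi : t i = .nil
  · exact (l3 ⟨i, hi⟩).trans (hle' i _ _)
  · exact (k3 ⟨i, hi⟩).trans (hle i _ _)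

/-- A round is polynomial in the current state rather than in the input, so iterating it could blow
up; the bound `z` on all intermediate states excludes this. -/
theorem loop {s : ι → ℕ → Dat} {m z : ι → ℕ} (h0 : PT a (fun i => s i 0))
    (hstep : PT (fun p : (i : ι) × Fin (m i) => s p.1 p.2) (fun p => s p.1 (p.2 + 1)))
    (htest : ∀ i, ∀ j < m i, (s i j).hd ≠ .nil) (hend : ∀ i, (s i (m i)).hd = .nil)
    (hm : PB a m) (hz : PB a z) (hsz : ∀ i, ∀ j ≤ m i, (s i j).size ≤ z i) :
    PT a (fun i => s i (m i)) := by
  obtain ⟨T, h1, h2, h3⟩ := h0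
  obtain ⟨S, k1, ⟨d, k2⟩, k3⟩ := hstep
  refine ⟨_, h1.comp (Runs.loop (τ := fun i => (z i + 1) ^ d) (k1.mono fun p => (k2 p).trans ?_)
    htest hend hsz), ((PB.const 1).add h2).add ((hm.add (.const 1)).mul
      (((PB.const 2).add hz).add ((hz.add (.const 1)).pow d))), hz.mono fun i => hsz i _ le_rfl⟩
  exact Nat.pow_le_pow_left (Nat.add_le_add_right (hsz _ _ p.2.2.le) 1) d

end PT

/-! ## Lists -/

open Enc (list)

theorem size_list_cons (x : Dat) (l : List Dat) : (list (x :: l)).size = 1 + x.size + (list l).size := rfl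

theorem size_list (l : List Dat) : (list l).size = (l.map (fun x => x.size + 1)).sum + 1 := by
  induction l with
  | nil => rfl
  | cons x l ih => rw [size_list_cons, ih, List.map_cons, List.sum_cons]; omega

theorem length_lt_size_list (l : List Dat) : l.length < (list l).size := by
  induction l with
  | nil => exact Nat.one_pos
  | cons x l ih => rw [size_list_cons, List.length_cons]; omega

theorem size_le_of_mem {x : Dat} {l : List Dat} (h : x ∈ l) : x.size ≤ (list l).size := by
  induction l with
  | nil => cases h
  | cons y l ih =>
    rw [size_list_cons]
    rcases List.mem_cons.1 h with rfl | h
    · omega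
    · have := ih h; omega

theorem size_list_le {l : List Dat} {z : ℕ} (h : ∀ x ∈ l, x.size ≤ z) :
    (list l).size ≤ l.length * (z + 1) + 1 := by
  rw [size_list]
  have := List.sum_le_card_nsmul (l.map (fun x => x.size + 1)) (z + 1) (by
    intro y hy
    obtain ⟨x, hx, rfl⟩ := List.mem_map.1 hy
    exact Nat.add_le_add_right (h x hx) 1)
  rw [List.length_map, smul_eq_mul] at this
  omega

theorem size_list_append (l m : List Dat) : (list (l ++ m)).size + 1 = (list l).size + (list m).size := by
  simp only [size_list, List.map_append, List.sum_append]; omega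

theorem size_list_sublist {l m : List Dat} (h : l.Sublist m) : (list l).size ≤ (list m).size := by
  rw [size_list, size_list]
  exact Nat.add_le_add_right ((h.map _).sum_le_sum (fun _ _ => Nat.zero_le _)) 1

theorem size_list_reverse (l : List Dat) : (list l.reverse).size = (list l).size := by
  simp [size_list]

theorem list_injective : Function.Injective list := by
  intro l
  induction l with
  | nil => intro m h; cases m with
    | nil => rfl
    | cons => cases h
  | cons x l ih => intro m h; cases m with
    | nil => cases h
    | cons y m => injection h with h1 h2; rw [h1, ih h2]

namespace PT

variable {ι κ : Type} {a b c : ι → Dat}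

theorem reverse {l : ι → List Dat} (h : PT a (fun i => list (l i))) :
    PT a (fun i => list (l i).reverse) := by
  have key : PT a (fun i => (Dat.cons (list ((l i).drop (l i).length))
      (list ((l i).take (l i).length).reverse))) := by
    -- After `j` rounds the state holds the remaining list and the reversal of the part already
    -- taken off.
    refine loop (s := fun i j => .cons (list ((l i).drop j)) (list ((l i).take j).reverse))
      (m := fun i => (l i).length) (z := fun i => 1 + 2 * (list (l i)).size) ?_ ?_ ?_ ?_
      (h.size.mono fun i => (length_lt_size_list _).le)
      ((PB.const 1).add ((PB.const 2).mul h.size)) ?_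
    · exact (h.cons nil)
    · refine ((PT.left.tl).cons ((PT.left.hd).cons PT.right)).congr fun p => ?_
      obtain ⟨i, j, hj⟩ := p
      simp only [List.drop_eq_getElem_cons hj, list, Dat.hd, Dat.tl]
      rw [List.take_succ_eq_append_getElem hj, List.reverse_append]
      rfl
    · intro i j hj
      simp only [List.drop_eq_getElem_cons hj, list, Dat.hd]
      exact Dat.noConfusion
    · intro i
      simp [list, Dat.hd]
    · intro i j hj
      simp only [Dat.size, size_list_reverse]
      have h1 := size_list_sublist (List.drop_sublist j (l i))
      have h2 := size_list_sublist (List.take_sublist j (l i))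
      omega
  exact key.tl.congr fun i => by simp [Dat.tl]

/-- Structural recursion on a list; the size of the results has to be bounded. -/
theorem listRec {α : ι → Type} {l : ∀ i, List (α i)} {f : ∀ i, α i → Dat}
    (hl : PT a (fun i => list ((l i).map (f i)))) (v : ∀ i, List (α i) → Dat) {z : ι → ℕ}
    (hz : PB a z) (hsz : ∀ i t, t <:+ l i → (v i t).size ≤ z i)
    (h0 : PT a (fun i => v i []))
    (hstep : PT (fun p : (i : ι) × {q : α i × List (α i) // q.1 :: q.2 <:+ l i} =>
      .cons (f p.1 p.2.1.1) (.cons (v p.1 p.2.1.2) (a p.1))) (fun p => v p.1 (p.2.1.1 :: p.2.1.2))) :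
    PT a (fun i => v i (l i)) := by
  -- Structural recursion starts at the end of the list whereas a loop takes elements off the front,
  -- so the loop runs over the reversal. The input `a i` travels along in the state, so that each
  -- step may consult it.
  set r : ∀ i, List Dat := fun i => ((l i).map (f i)).reverse with hr
  have hlen : ∀ i, (r i).length = (l i).length := by simp [hr]
  have key : PT a (fun i => .cons (list ((r i).drop (l i).length))
      (.cons (v i ((l i).drop ((l i).length - (l i).length))) (a i))) := by
    refine loop (s := fun i j => .cons (list ((r i).drop j))
        (.cons (v i ((l i).drop ((l i).length - j))) (a i)))
      (m := fun i => (l i).length) (z := fun i => 2 + (list ((l i).map (f i))).size + z i + (a i).size)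
      ?_ ?_ ?_ ?_ (hl.size.mono fun i => ?_)
      ((((PB.const 2).add hl.size).add hz).add .self) ?_
    · refine ((hl.reverse).cons (h0.cons .refl)).congr fun i => by simp [hr]
    · have hst := hstep.precomp (κ := (i : ι) × Fin (l i).length)
        (fun p => ⟨p.1, ⟨((l p.1)[(l p.1).length - (p.2 + 1)]'(by have := p.2.2; omega),
          (l p.1).drop ((l p.1).length - p.2)), by
            have := p.2.2
            have e : (l p.1).length - p.2 = (l p.1).length - (p.2 + 1) + 1 := by omega
            rw [e, ← List.drop_eq_getElem_cons]
            exact List.drop_suffix _ _⟩⟩)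
      refine (left.tl.cons (((left.hd.cons right).congr ?_).comp hst |>.cons right.tl)).congr ?_
      · intro p
        obtain ⟨i, j, hj⟩ := p
        have hj' : j < (r i).length := by rw [hlen]; exact hj
        simp only [List.drop_eq_getElem_cons hj', list, Dat.hd]
        congr 1
        simp [hr, Nat.sub_sub, Nat.add_comm]
      · intro p
        obtain ⟨i, j, hj⟩ := p
        have hj' : j < (r i).length := by rw [hlen]; exact hj
        simp only [List.drop_eq_getElem_cons hj', list, Dat.tl]
        congr 3
        have e : (l i).length - j = (l i).length - (j + 1) + 1 := by omega
        rw [e, ← List.drop_eq_getElem_cons]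
    · intro i j hj
      have hj' : j < (r i).length := by rw [hlen]; exact hj
      simp only [List.drop_eq_getElem_cons hj', list, Dat.hd]
      exact Dat.noConfusion
    · intro i
      simp [List.drop_eq_nil_of_le (hlen i).le, list, Dat.hd]
    · have := length_lt_size_list ((l i).map (f i))
      simp at this; omega
    · intro i j hj
      have h1 := size_list_sublist (List.drop_sublist j (r i))
      have h2 := hsz i _ (List.drop_suffix ((l i).length - j) (l i))
      have h3 := size_list_reverse ((l i).map (f i))
      simp only [Dat.size]
      simp only [hr] at h1 ⊢
      omega
  exact key.tl.hd.congr fun i => by simp [Dat.tl, Dat.hd]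

end PT

end FLTL

/-! ### Truth values, operations on lists and general loops in polynomial time. -/

namespace FLTL

open Enc (list)

open Classical in
/-- The truth value of a proposition. -/
noncomputable def bit (P : Prop) : Dat := Enc.bool (decide P)

theorem bit_true {P : Prop} (h : P) : bit P = .cons .nil .nil := by simp [bit, h, Enc.bool]

theorem bit_false {P : Prop} (h : ¬ P) : bit P = .nil := by simp [bit, h, Enc.bool]

theorem bit_ne_nil {P : Prop} : bit P ≠ .nil ↔ P := by
  by_cases h : P
  · rw [bit_true h]; simp [h]
  · rw [bit_false h]; simp [h]

theorem bit_eq_nil {P : Prop} : bit P = .nil ↔ ¬ P := not_iff_not.1 (by rw [not_not]; exact bit_ne_nil)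

theorem size_bit_le (P : Prop) : (bit P).size ≤ 3 := by
  by_cases h : P
  · simp [bit_true h, Dat.size]
  · simp [bit_false h, Dat.size]

/-- The elements of the lists of a family. -/
abbrev Members {ι : Type} {α : ι → Type} (l : ∀ i, List (α i)) : Type :=
  (i : ι) × {y // y ∈ l i}

/-- The nonempty suffixes of the lists of a family. -/
abbrev Suffixes {ι : Type} {α : ι → Type} (l : ∀ i, List (α i)) : Type :=
  (i : ι) × {q : α i × List (α i) // q.1 :: q.2 <:+ l i}

abbrev Suffixes.toMember {ι : Type} {α : ι → Type} {l : ∀ i, List (α i)} (p : Suffixes l) : Members l :=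
  ⟨p.1, p.2.1.1, p.2.2.subset (by simp)⟩

namespace PT

variable {ι κ : Type} {a b c : ι → Dat} {P Q : ι → Prop}

/-- Steps of list recursions receive the current element paired with the old input; whatever is
computable from the input stays computable in that context. -/
theorem lift (h : PT a b) (r : κ → ι) {x : κ → Dat} :
    PT (fun p => .cons (x p) (a (r p))) (fun p => b (r p)) :=
  right.comp (h.precomp r)

theorem lift₂ (h : PT a b) (r : κ → ι) {x y : κ → Dat} :
    PT (fun p => .cons (x p) (.cons (y p) (a (r p)))) (fun p => b (r p)) :=
  right.comp (h.lift r)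

/-- Each branch is a family over the indices where `P` has the respective value, so its
justification may use `P` or its negation. -/
theorem bitCases (h : PT a (fun i => bit (P i)))
    (hb : PT (fun i : {i // P i} => a i) (fun i => b i))
    (hc : PT (fun i : {i // ¬ P i} => a i) (fun i => b i)) : PT a b :=
  h.cases (hb.precomp fun i : {i // bit (P i) ≠ .nil} => ⟨i.1, bit_ne_nil.1 i.2⟩)
    (hc.precomp fun i : {i // bit (P i) = .nil} => ⟨i.1, bit_eq_nil.1 i.2⟩)

theorem bitCongr (h : PT a (fun i => bit (P i))) (hQ : ∀ i, P i ↔ Q i) : PT a (fun i => bit (Q i)) :=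
  h.congr fun i => by rw [propext (hQ i)]

theorem bitConst (p : Prop) : PT a (fun _ => bit p) := const _

theorem bitOf (h : ∀ i, P i) : PT a (fun i => bit (P i)) :=
  (bitConst True).bitCongr fun i => by simp [h i]

theorem bitOfNot (h : ∀ i, ¬ P i) : PT a (fun i => bit (P i)) :=
  (bitConst False).bitCongr fun i => by simp [h i]

theorem neNil (h : PT a b) : PT a (fun i => bit (b i ≠ .nil)) :=
  h.cases (bitOf fun i => i.2) (bitOfNot fun i => by simp [i.2])

theorem bitNot (h : PT a (fun i => bit (P i))) : PT a (fun i => bit (¬ P i)) :=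
  h.bitCases (bitOfNot fun i => by simp [i.2]) (bitOf fun i => i.2)

theorem bitAnd (h : PT a (fun i => bit (P i))) (k : PT a (fun i => bit (Q i))) :
    PT a (fun i => bit (P i ∧ Q i)) :=
  h.bitCases ((k.precomp Subtype.val).bitCongr fun i => by simp [i.2]) (bitOfNot fun i => by simp [i.2])

theorem bitOr (h : PT a (fun i => bit (P i))) (k : PT a (fun i => bit (Q i))) :
    PT a (fun i => bit (P i ∨ Q i)) :=
  (h.bitNot.bitAnd k.bitNot).bitNot.bitCongr fun i => by tauto

theorem bitImp (h : PT a (fun i => bit (P i))) (k : PT a (fun i => bit (Q i))) :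
    PT a (fun i => bit (P i → Q i)) :=
  (h.bitNot.bitOr k).bitCongr fun i => by tauto

section Lists

variable {α : ι → Type} {l : ∀ i, List (α i)} {f : ∀ i, α i → Dat}

theorem listCons {x : ι → Dat} {m : ι → List Dat} (hx : PT a x) (hm : PT a (fun i => list (m i))) :
    PT a (fun i => list (x i :: m i)) := hx.cons hm

theorem append {l m : ι → List Dat} (hl : PT a (fun i => list (l i))) (hm : PT a (fun i => list (m i))) :
    PT a (fun i => list (l i ++ m i)) := by
  refine listRec (α := fun _ => Dat) (f := fun _ x => x) (by simpa using hl)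
    (fun i t => list (t ++ m i)) (hl.size.add hm.size) (fun i t ht => ?_) hm (left.cons right.hd)
  have h1 := size_list_append t (m i)
  have h2 := size_list_sublist ht.sublist
  omega

/-- Elements of a computable list are no larger than its code, so a polynomial bound at each element
gives one polynomial bound for all elements together. -/
theorem bound_mem (hl : PT a (fun i => list ((l i).map (f i)))) {g : (i : ι) → α i → ℕ}
    (hg : PB (fun p : Members l => .cons (f p.1 p.2) (a p.1)) (fun p => g p.1 p.2)) :
    ∃ w : ι → ℕ, PB a w ∧ ∀ i, ∀ y ∈ l i, g i y ≤ w i := by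
  obtain ⟨d, hd⟩ := hg
  refine ⟨_, ((((PB.const 1).add hl.size).add .self).add (.const 1)).pow d, fun i y hy => ?_⟩
  refine (hd ⟨i, y, hy⟩).trans (Nat.pow_le_pow_left ?_ d)
  have := size_le_of_mem (List.mem_map_of_mem (f := f i) hy)
  simp only [Dat.size]
  omega

theorem flatMap {g : ∀ i, α i → List Dat} (hl : PT a (fun i => list ((l i).map (f i))))
    (hg : PT (fun p : Members l => .cons (f p.1 p.2) (a p.1))
      (fun p => list (g p.1 p.2))) :
    PT a (fun i => list ((l i).flatMap (g i))) := by
  obtain ⟨w, hw, hle⟩ := bound_mem (g := fun i y => (list (g i y)).size) hl hg.size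
  -- The bound on partial results is the number of elements times the common bound `w` on the
  -- pieces.
  refine listRec hl (fun i t => list (t.flatMap (g i))) (z := fun i => (list ((l i).map (f i))).size * w i + 1)
    ((hl.size.mul hw).add (.const 1)) ?_ nil ?_
  · intro i t ht
    have hlen : t.length ≤ (list ((l i).map (f i))).size := by
      have h1 := length_lt_size_list ((l i).map (f i))
      have h2 := ht.length_le
      simp at h1; omega
    refine le_trans ?_ (Nat.add_le_add_right (Nat.mul_le_mul_right _ hlen) 1)
    have hsub := ht.subset
    clear hlen ht
    induction t with
    | nil => simp [list, Dat.size]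
    | cons x t ih =>
      rw [List.flatMap_cons]
      have h1 := size_list_append (g i x) (t.flatMap (g i))
      have h2 := hle i x (hsub (by simp))
      have h3 := ih (fun y hy => hsub (by simp [hy]))
      rw [List.length_cons, Nat.add_mul]
      omega
  · refine ((append (((left.cons right.tl).comp (hg.precomp Suffixes.toMember))) right.hd)).congr fun p => ?_
    rw [List.flatMap_cons]

theorem map {g : ∀ i, α i → Dat} (hl : PT a (fun i => list ((l i).map (f i))))
    (hg : PT (fun p : Members l => .cons (f p.1 p.2) (a p.1)) (fun p => g p.1 p.2)) :
    PT a (fun i => list ((l i).map (g i))) :=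
  (flatMap (g := fun i y => [g i y]) hl (hg.cons nil)).congr fun i => by
    rw [← List.map_eq_flatMap]

open Classical in
/-- Filtering a list where the test may use the result for the tail. -/
theorem scanFilter {Q : ∀ i, α i → Prop} (hl : PT a (fun i => list ((l i).map (f i))))
    (hQ : PT (fun p : Suffixes l =>
      .cons (f p.1 p.2.1.1) (.cons (list ((p.2.1.2.filter (fun y => decide (Q p.1 y))).map (f p.1)))
        (a p.1))) (fun p => bit (Q p.1 p.2.1.1))) :
    PT a (fun i => list (((l i).filter (fun y => decide (Q i y))).map (f i))) := by
  refine listRec hl (fun i t => list ((t.filter (fun y => decide (Q i y))).map (f i))) hl.size ?_ nil ?_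
  · intro i t ht
    exact size_list_sublist ((List.filter_sublist.trans ht.sublist).map _)
  · refine hQ.bitCases ((left.cons right.hd).congr fun p => ?_) (right.hd.congr fun p => ?_)
    · rw [List.filter_cons_of_pos (by simpa using p.2)]; rfl
    · rw [List.filter_cons_of_neg (by simpa using p.2)]; rfl

open Classical in
theorem filter {Q : ∀ i, α i → Prop} (hl : PT a (fun i => list ((l i).map (f i))))
    (hQ : PT (fun p : Members l => .cons (f p.1 p.2) (a p.1))
      (fun p => bit (Q p.1 p.2))) :
    PT a (fun i => list (((l i).filter (fun y => decide (Q i y))).map (f i))) :=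
  scanFilter hl ((left.cons right.tl).comp (hQ.precomp Suffixes.toMember))

theorem bitAll {Q : ∀ i, α i → Prop} (hl : PT a (fun i => list ((l i).map (f i))))
    (hQ : PT (fun p : Members l => .cons (f p.1 p.2) (a p.1))
      (fun p => bit (Q p.1 p.2))) :
    PT a (fun i => bit (∀ y ∈ l i, Q i y)) := by
  refine listRec hl (fun i t => bit (∀ y ∈ t, Q i y)) (.const 3) (fun i t _ => size_bit_le _)
    (bitOf fun i => by simp) ?_
  refine (bitAnd ((left.cons right.tl).comp (hQ.precomp Suffixes.toMember)) right.hd).bitCongr fun p => ?_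
  simp

theorem bitEx {Q : ∀ i, α i → Prop} (hl : PT a (fun i => list ((l i).map (f i))))
    (hQ : PT (fun p : Members l => .cons (f p.1 p.2) (a p.1))
      (fun p => bit (Q p.1 p.2))) :
    PT a (fun i => bit (∃ y ∈ l i, Q i y)) :=
  (bitAll (Q := fun i y => ¬ Q i y) hl hQ.bitNot).bitNot.bitCongr fun i => by push Not; rfl

end Lists

/-- A loop given by a function on an arbitrary type of states, with a termination measure. -/
theorem whileLoop {S : Type} {e : S → Dat} {F : S → S} {μ : S → ℕ}
    (hF : PT (fun s : {s // (e s).hd ≠ .nil} => e s) (fun s => e (F s)))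
    (hμ : ∀ s, (e s).hd ≠ .nil → μ (F s) < μ s) {s : ι → S} (h0 : PT a (fun i => e (s i)))
    {z : ι → ℕ} (hz : PB a z) (hsz : ∀ i j, (e (F^[j] (s i))).size ≤ z i)
    (hb : PB a (fun i => μ (s i))) :
    ∃ m : ι → ℕ, (∀ i, (e (F^[m i] (s i))).hd = .nil) ∧
      (∀ i, ∀ j < m i, (e (F^[j] (s i))).hd ≠ .nil) ∧ PT a (fun i => e (F^[m i] (s i))) := by
  -- The number of rounds is extracted from the measure and bounded by its initial value.
  have key : ∀ (n : ℕ) (s : S), μ s ≤ n → ∃ m ≤ n, (e (F^[m] s)).hd = .nil ∧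
      ∀ j < m, (e (F^[j] s)).hd ≠ .nil := by
    intro n
    induction n with
    | zero =>
      intro s hs
      refine ⟨0, le_rfl, ?_, by simp⟩
      by_contra h
      have := hμ s h
      omega
    | succ n ih =>
      intro s hs
      by_cases h : (e s).hd = .nil
      · exact ⟨0, by omega, h, by simp⟩
      · obtain ⟨m, hm, h1, h2⟩ := ih (F s) (by have := hμ s h; omega)
        refine ⟨m + 1, by omega, by simpa using h1, fun j hj => ?_⟩
        cases j with
        | zero => exact h
        | succ j => simpa using h2 j (by omega)
  choose m hm h1 h2 using fun i => key _ (s i) le_rfl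
  refine ⟨m, h1, h2, loop (s := fun i j => e (F^[j] (s i))) h0 ?_ h2 h1 (hb.mono hm) hz
    (fun i j _ => hsz i j)⟩
  refine (hF.precomp fun p : (i : ι) × Fin (m i) => ⟨F^[p.2] (s p.1), h2 _ _ p.2.2⟩).congr fun p => ?_
  rw [Function.iterate_succ_apply']

end PT

/-! ### Equality of trees -/

/-- One step of the comparison of pairs of trees; `none` stands for a difference. -/
def eqStep : Option (List (Dat × Dat)) → Option (List (Dat × Dat))
  | some ((.nil, .nil) :: L) => some L
  | some ((.cons x x', .cons y y') :: L) => some ((x, y) :: (x', y') :: L)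
  | some [] => some []
  | _ => none

/-- The head controls the loop: it is `nil` both when all pairs have been compared and when a
difference has been found. The tail then tells these two outcomes apart. -/
def eqCode : Option (List (Dat × Dat)) → Dat
  | some L => .cons (list (L.map fun p => .cons p.1 p.2)) .nil
  | none => .cons .nil (.cons .nil .nil)

def eqMeasure : Option (List (Dat × Dat)) → ℕ
  | some L => (L.map fun p => p.1.size).sum
  | none => 0

def EqHolds : Option (List (Dat × Dat)) → Prop
  | some L => ∀ p ∈ L, p.1 = p.2
  | none => False

theorem eqHolds_eqStep (s : Option (List (Dat × Dat))) : EqHolds (eqStep s) ↔ EqHolds s := by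
  rcases s with _ | _ | ⟨⟨_ | ⟨x, x'⟩, _ | ⟨y, y'⟩⟩, L⟩ <;>
    simp [eqStep, EqHolds, and_assoc]

/-- Splitting a pair of inner nodes into its two pairs of children leaves the size of the code
unchanged; 5 is the size of the code of `none`. -/
theorem size_eqStep (s : Option (List (Dat × Dat))) :
    (eqCode (eqStep s)).size ≤ max (eqCode s).size 5 := by
  rcases s with _ | _ | ⟨⟨_ | ⟨x, x'⟩, _ | ⟨y, y'⟩⟩, L⟩ <;>
    simp [eqStep, eqCode, list, Dat.size] <;> omega

theorem PT.eqStep : PT (fun s : {s // (eqCode s).hd ≠ .nil} => eqCode s)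
    (fun s => eqCode (eqStep s)) := by
  have h : PT (fun p : Dat × Dat × List (Dat × Dat) => eqCode (some ((p.1, p.2.1) :: p.2.2)))
      (fun p => eqCode (FLTL.eqStep (some ((p.1, p.2.1) :: p.2.2)))) := by
    have hx : PT (fun p : Dat × Dat × List (Dat × Dat) => eqCode (some ((p.1, p.2.1) :: p.2.2)))
      (fun p => p.1) := PT.refl.hd.hd.hd
    have hy : PT (fun p : Dat × Dat × List (Dat × Dat) => eqCode (some ((p.1, p.2.1) :: p.2.2)))
      (fun p => p.2.1) := PT.refl.hd.hd.tl
    have hL : PT (fun p : Dat × Dat × List (Dat × Dat) => eqCode (some ((p.1, p.2.1) :: p.2.2)))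
      (fun p => list (p.2.2.map fun p => .cons p.1 p.2)) := PT.refl.hd.tl
    refine hx.cases ((hy.precomp Subtype.val).cases ?_ ?_) ((hy.precomp Subtype.val).cases ?_ ?_)
    · refine ((((hx.hd.cons hy.hd).cons ((hx.tl.cons hy.tl).cons hL)).cons PT.nil).precomp
        Subtype.val).precomp Subtype.val |>.congr ?_
      rintro ⟨⟨⟨_ | ⟨x, x'⟩, _ | ⟨y, y'⟩, L⟩, h1⟩, h2⟩
      exacts [absurd rfl h1, absurd rfl h1, absurd rfl h2, rfl]
    · refine (PT.const (eqCode none)).congr ?_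
      rintro ⟨⟨⟨_ | ⟨x, x'⟩, _ | ⟨y, y'⟩, L⟩, h1⟩, h2⟩
      exacts [absurd rfl h1, absurd rfl h1, rfl, Dat.noConfusion h2]
    · refine (PT.const (eqCode none)).congr ?_
      rintro ⟨⟨⟨_ | ⟨x, x'⟩, _ | ⟨y, y'⟩, L⟩, h1⟩, h2⟩
      exacts [absurd rfl h2, rfl, Dat.noConfusion h1, Dat.noConfusion h1]
    · refine ((hL.cons PT.nil).precomp Subtype.val).precomp Subtype.val |>.congr ?_
      rintro ⟨⟨⟨_ | ⟨x, x'⟩, _ | ⟨y, y'⟩, L⟩, h1⟩, h2⟩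
      exacts [rfl, Dat.noConfusion h2, Dat.noConfusion h1, Dat.noConfusion h1]
  have hs : ∀ s : {s // (eqCode s).hd ≠ .nil}, ∃ p : Dat × Dat × List (Dat × Dat),
      s.1 = some ((p.1, p.2.1) :: p.2.2) := by
    rintro ⟨_ | _ | ⟨⟨x, y⟩, L⟩, h⟩
    exacts [absurd rfl h, absurd rfl h, ⟨(x, y, L), rfl⟩]
  choose r hr using hs
  exact ((h.precomp r).congr_left fun s => by rw [← hr]).congr fun s => by rw [← hr]

namespace PT

variable {ι κ : Type} {a b c : ι → Dat} {P Q : ι → Prop}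

/-- Whether all pending pairs consist of equal trees is invariant under `eqStep`, and every step
that starts from a pending pair decreases the total size of the pending first components. -/
theorem bitEq (hb : PT a b) (hc : PT a c) : PT a (fun i => bit (b i = c i)) := by
  have hμ : ∀ s, (eqCode s).hd ≠ .nil → eqMeasure (FLTL.eqStep s) < eqMeasure s := by
    rintro (_ | _ | ⟨⟨_ | ⟨x, x'⟩, _ | ⟨y, y'⟩⟩, L⟩) h
    all_goals first
      | exact absurd rfl h
      | simp [FLTL.eqStep, eqMeasure, Dat.size]
    all_goals omega
  have hsz : ∀ i j, (eqCode (FLTL.eqStep^[j] (some [(b i, c i)]))).size ≤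
      5 + (b i).size + (c i).size := by
    intro i j
    have : ∀ n s, 5 ≤ (eqCode s).size → (eqCode (FLTL.eqStep^[n] s)).size ≤ (eqCode s).size := by
      intro n
      induction n with
      | zero => simp
      | succ n ih =>
        intro s hs
        rw [Function.iterate_succ_apply']
        exact (size_eqStep _).trans (max_le (ih s hs) hs)
    have hp := (b i).size_pos
    have hq := (c i).size_pos
    refine (this j _ ?_).trans ?_ <;> simp [eqCode, list, Dat.size] <;> omega
  obtain ⟨m, h1, h2, h3⟩ := whileLoop (a := a) PT.eqStep hμ
    (s := fun i => some [(b i, c i)]) (((hb.cons hc).cons nil).cons nil)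
    (((PB.const 5).add hb.size).add hc.size) hsz (by simpa [eqMeasure] using hb.size)
  refine h3.tl.neNil.bitNot.bitCongr fun i => ?_
  have key : EqHolds (FLTL.eqStep^[m i] (some [(b i, c i)])) ↔ b i = c i := by
    have : ∀ n s, EqHolds (FLTL.eqStep^[n] s) ↔ EqHolds s := by
      intro n
      induction n with
      | zero => simp
      | succ n ih => intro s; rw [Function.iterate_succ_apply, ih, eqHolds_eqStep]
    rw [this]; simp [EqHolds]
  rw [← key]
  have := h1 i
  revert this
  generalize FLTL.eqStep^[m i] (some [(b i, c i)]) = s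
  intro this
  rcases s with _ | _ | ⟨p, L⟩
  · simp [eqCode, EqHolds, Dat.tl]
  · simp [eqCode, EqHolds, Dat.tl]
  · simp [eqCode, list, Dat.hd] at this

theorem bitMem {x : ι → Dat} {l : ι → List Dat} (hx : PT a x) (hl : PT a (fun i => list (l i))) :
    PT a (fun i => bit (x i ∈ l i)) := by
  have hl' : PT a (fun i => list ((l i).map id)) := by simpa using hl
  exact (bitEx (Q := fun i y => y = x i) hl' (left.bitEq (hx.lift Sigma.fst))).bitCongr
    fun i => by simp

/-- Membership of typed data, given an injective encoding. -/
theorem bitMemMap {α : ι → Type} {f : ∀ i, α i → Dat} (hf : ∀ i, Function.Injective (f i))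
    {x : ∀ i, α i} {l : ∀ i, List (α i)} (hx : PT a (fun i => f i (x i)))
    (hl : PT a (fun i => list ((l i).map (f i)))) : PT a (fun i => bit (x i ∈ l i)) :=
  (bitMem hx hl).bitCongr fun i => (List.mem_map_of_injective (hf i))

end PT

end FLTL

/-! ### Numbers in unary and binary, enumeration of sublists, exponentiation. -/

namespace FLTL

open Enc (list unary)

theorem unary_eq (k : ℕ) : unary k = list (List.replicate k .nil) := by
  induction k with
  | zero => rfl
  | succ k ih => rw [unary, ih, List.replicate_succ]; rfl

theorem size_unary (k : ℕ) : (unary k).size = 2 * k + 1 := by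
  induction k with
  | zero => rfl
  | succ k ih => rw [unary, Dat.size, ih]; simp [Dat.size]; omega

theorem unary_injective : Function.Injective unary := fun j k h => by
  have := congrArg Dat.size h
  rw [size_unary, size_unary] at this
  omega

/-- Increment of a number in binary, least significant digit first. -/
def incBits : List Bool → List Bool
  | [] => [true]
  | false :: l => true :: l
  | true :: l => false :: incBits l

theorem incBits_bits (k : ℕ) : incBits k.bits = (k + 1).bits := by
  induction k using Nat.strong_induction_on with
  | _ k ih =>
    obtain ⟨m, rfl | rfl⟩ := k.even_or_odd'
    · rcases Nat.eq_zero_or_pos m with rfl | hm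
      · simp [incBits]
      · rw [Nat.bit0_bits _ hm.ne', Nat.bit1_bits]; rfl
    · rw [Nat.bit1_bits, incBits, ih m (by omega), show 2 * m + 1 + 1 = 2 * (m + 1) by ring,
        Nat.bit0_bits _ (by omega)]

theorem length_incBits (l : List Bool) : (incBits l).length ≤ l.length + 1 := by
  induction l with
  | nil => simp [incBits]
  | cons b l ih => cases b <;> simp [incBits]; omega

theorem size_bool_le (b : Bool) : (Enc.bool b).size ≤ 3 := by
  cases b <;> simp [Enc.bool, Dat.size]

theorem size_boolList_le (l : List Bool) : (list (l.map Enc.bool)).size ≤ l.length * 4 + 1 := by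
  have := size_list_le (l := l.map Enc.bool) (z := 3) (by
    intro x hx
    obtain ⟨b, _, rfl⟩ := List.mem_map.1 hx
    exact size_bool_le b)
  simpa using this

theorem size_binary_le (k : ℕ) : (Enc.binary k).size ≤ k.size * 4 + 1 := by
  have := size_boolList_le k.bits
  rwa [Nat.size_eq_bits_len] at this

/-- One step of a traversal of a list of trees that counts the nodes. -/
def sizeStep : List Dat × ℕ → List Dat × ℕ
  | (.nil :: L, k) => (L, k + 1)
  | (.cons x y :: L, k) => (x :: y :: L, k + 1)
  | ([], k) => ([], k)

def sizeCode (s : List Dat × ℕ) : Dat := .cons (list s.1) (unary s.2)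

theorem PT.sizeStep : PT (fun s : {s // (sizeCode s).hd ≠ .nil} => sizeCode s)
    (fun s => sizeCode (sizeStep s)) := by
  have h : PT (fun p : Dat × List Dat × ℕ => sizeCode (p.1 :: p.2.1, p.2.2))
      (fun p => sizeCode (FLTL.sizeStep (p.1 :: p.2.1, p.2.2))) := by
    have hx : PT (fun p : Dat × List Dat × ℕ => sizeCode (p.1 :: p.2.1, p.2.2)) (fun p => p.1) :=
      PT.refl.hd.hd
    have hL : PT (fun p : Dat × List Dat × ℕ => sizeCode (p.1 :: p.2.1, p.2.2))
      (fun p => list p.2.1) := PT.refl.hd.tl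
    have hk : PT (fun p : Dat × List Dat × ℕ => sizeCode (p.1 :: p.2.1, p.2.2))
      (fun p => unary p.2.2) := PT.refl.tl
    refine hx.cases ?_ ?_
    · refine (((hx.hd.cons (hx.tl.cons hL)).cons (PT.nil.cons hk)).precomp Subtype.val).congr ?_
      rintro ⟨⟨_ | ⟨x, y⟩, L, k⟩, h⟩
      exacts [absurd rfl h, rfl]
    · refine ((hL.cons (PT.nil.cons hk)).precomp Subtype.val).congr ?_
      rintro ⟨⟨_ | ⟨x, y⟩, L, k⟩, h⟩
      exacts [rfl, Dat.noConfusion h]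
  have hs : ∀ s : {s // (sizeCode s).hd ≠ .nil}, ∃ p : Dat × List Dat × ℕ,
      s.1 = (p.1 :: p.2.1, p.2.2) := by
    rintro ⟨⟨_ | ⟨x, L⟩, k⟩, h⟩
    exacts [absurd rfl h, ⟨(x, L, k), rfl⟩]
  choose r hr using hs
  exact ((h.precomp r).congr_left fun s => by rw [← hr]).congr fun s => by rw [← hr]

theorem sum_sizeStep (s : List Dat × ℕ) :
    ((sizeStep s).1.map Dat.size).sum + (sizeStep s).2 = (s.1.map Dat.size).sum + s.2 := by
  obtain ⟨_ | ⟨_ | ⟨x, y⟩, L⟩, k⟩ := s <;> simp [sizeStep, Dat.size] <;> omega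

namespace PT

variable {ι κ : Type} {a b c : ι → Dat} {P Q : ι → Prop}

theorem treeSize (hb : PT a b) : PT a (fun i => unary (b i).size) := by
  -- The sizes of the pending trees and the counter have a constant sum, which is the size sought.
  have hinv : ∀ n s, (((FLTL.sizeStep^[n] s).1).map Dat.size).sum + (FLTL.sizeStep^[n] s).2 =
      (s.1.map Dat.size).sum + s.2 := by
    intro n
    induction n with
    | zero => simp
    | succ n ih => intro s; rw [Function.iterate_succ_apply', sum_sizeStep, ih]
  have hμ : ∀ s, (sizeCode s).hd ≠ .nil →
      ((FLTL.sizeStep s).1.map Dat.size).sum < (s.1.map Dat.size).sum := by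
    rintro ⟨_ | ⟨_ | ⟨x, y⟩, L⟩, k⟩ h
    · exact absurd rfl h
    all_goals simp [FLTL.sizeStep, Dat.size]
    omega
  have hsz : ∀ i j, (sizeCode (FLTL.sizeStep^[j] ([b i], 0))).size ≤ 3 + 2 * (b i).size := by
    intro i j
    have h1 := hinv j ([b i], 0)
    have h2 : ∀ L : List Dat, (list L).size ≤ 2 * (L.map Dat.size).sum + 1 := by
      intro L
      induction L with
      | nil => simp [list, Dat.size]
      | cons x L ih =>
        rw [size_list_cons, List.map_cons, List.sum_cons]
        have := x.size_pos
        omega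
    have h3 := h2 (FLTL.sizeStep^[j] ([b i], 0)).1
    simp only [sizeCode, Dat.size, size_unary]
    simp at h1
    omega
  obtain ⟨m, h1, h2, h3⟩ := whileLoop (a := a) (μ := fun s => (s.1.map Dat.size).sum) PT.sizeStep hμ
    (s := fun i => ([b i], 0)) ((hb.cons nil).cons nil)
    ((PB.const 3).add ((PB.const 2).mul hb.size)) hsz (by simpa using hb.size)
  refine h3.tl.congr fun i => ?_
  have h5 := h1 i
  have h4 := hinv (m i) ([b i], 0)
  revert h4 h5
  generalize FLTL.sizeStep^[m i] ([b i], 0) = s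
  obtain ⟨_ | ⟨x, L⟩, k⟩ := s
  · intro _ h4
    simp at h4
    simp [sizeCode, Dat.tl, h4]
  · intro h
    simp [sizeCode, list, Dat.hd] at h

/-- Iteration along the length of a list. -/
theorem iterate {l : ι → List Dat} (hl : PT a (fun i => list (l i))) {s : ι → ℕ → Dat} {z : ι → ℕ}
    (h0 : PT a (fun i => s i 0)) (hz : PB a z) (hsz : ∀ i j, (s i j).size ≤ z i)
    (hs : PT (fun p : ι × ℕ => .cons (s p.1 p.2) (a p.1)) (fun p => s p.1 (p.2 + 1))) :
    PT a (fun i => s i (l i).length) :=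
  listRec (α := fun _ => Dat) (f := fun _ x => x) (by simpa using hl) (fun i t => s i t.length) hz
    (fun i t _ => hsz i _) h0 (right.comp (hs.precomp fun p : Suffixes l => (p.1, p.2.1.2.length)))

open Classical in
theorem idxOf {x : ι → Dat} {l : ι → List Dat} (hx : PT a x) (hl : PT a (fun i => list (l i))) :
    PT a (fun i => unary ((l i).idxOf (x i))) := by
  refine listRec (α := fun _ => Dat) (f := fun _ x => x) (by simpa using hl)
    (fun i t => unary (t.idxOf (x i))) (z := fun i => 2 * (list (l i)).size + 1)
    (((PB.const 2).mul hl.size).add (.const 1)) ?_ nil ?_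
  · intro i t ht
    have h1 := List.idxOf_le_length (a := x i) (l := t)
    have h2 := ht.length_le
    have h3 := length_lt_size_list (l i)
    rw [size_unary]
    omega
  · refine (left.bitEq (hx.lift₂ Sigma.fst)).bitCases (nil.congr fun p => ?_)
      ((nil.cons right.hd).congr fun p => ?_)
    · rw [p.2, List.idxOf_cons_self]; rfl
    · rw [List.idxOf_cons_ne _ p.2]; rfl

theorem incBits {l : ι → List Bool} (hl : PT a (fun i => list ((l i).map Enc.bool))) :
    PT a (fun i => list ((FLTL.incBits (l i)).map Enc.bool)) := by
  -- When the first bit is 0 the rest is kept unchanged, so the recursion carries the original tail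
  -- next to the incremented one.
  have key : PT a (fun i => .cons (list ((FLTL.incBits (l i)).map Enc.bool))
      (list ((l i).map Enc.bool))) := by
    refine listRec (α := fun _ => Bool) (f := fun _ b => Enc.bool b) hl
      (fun i t => .cons (list ((FLTL.incBits t).map Enc.bool)) (list (t.map Enc.bool)))
      (z := fun i => 1 + (((list ((l i).map Enc.bool)).size + 1) * 4 + 1) +
        (list ((l i).map Enc.bool)).size)
      (((PB.const 1).add (((hl.size.add (.const 1)).mul (.const 4)).add (.const 1))).add hl.size) ?_
      ((const _).cons nil) ?_
    · intro i t ht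
      have h1 := size_boolList_le (FLTL.incBits t)
      have h2 := length_incBits t
      have h3 := size_list_sublist (ht.sublist.map Enc.bool)
      have h4 := length_lt_size_list (t.map Enc.bool)
      rw [List.length_map] at h4
      simp only [Dat.size]
      omega
    · refine left.cases ?_ ?_
      · refine ((nil.cons right.hd.hd).cons (left.cons right.hd.tl)).congr ?_
        rintro ⟨⟨i, ⟨b, t⟩, h⟩, hb⟩
        cases b
        · exact absurd rfl hb
        · rfl
      · refine (((const (Enc.bool true)).cons right.hd.tl).cons (left.cons right.hd.tl)).congr ?_
        rintro ⟨⟨i, ⟨b, t⟩, h⟩, hb⟩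
        cases b
        · rfl
        · exact Dat.noConfusion hb
  exact key.hd

theorem binaryLength {l : ι → List Dat} (hl : PT a (fun i => list (l i))) :
    PT a (fun i => Enc.binary (l i).length) := by
  refine listRec (α := fun _ => Dat) (f := fun _ x => x) (by simpa using hl)
    (fun i t => Enc.binary t.length) (z := fun i => (list (l i)).size * 4 + 1)
    ((hl.size.mul (.const 4)).add (.const 1)) (fun i t ht => ?_) (const _) ?_
  · have h1 := size_binary_le t.length
    have h2 : t.length.size ≤ t.length := Nat.size_le.2 Nat.lt_two_pow_self
    have h3 := ht.length_le
    have h4 := length_lt_size_list (l i)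
    omega
  · refine (incBits (l := fun p => p.2.1.2.length.bits) right.hd).congr fun p => ?_
    rw [incBits_bits]; rfl

/-- There are exponentially many sublists; `hb` demands that the input is already large enough for
them. -/
theorem sublists {α : ι → Type} {l : ∀ i, List (α i)} {f : ∀ i, α i → Dat}
    (hl : PT a (fun i => list ((l i).map (f i)))) (hb : PB a (fun i => 2 ^ (l i).length)) :
    PT a (fun i => list ((l i).sublists'.map fun t => list (t.map (f i)))) := by
  refine listRec hl (fun i t => list (t.sublists'.map fun t => list (t.map (f i))))
    (z := fun i => 2 ^ (l i).length * ((list ((l i).map (f i))).size + 1) + 1)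
    ((hb.mul (hl.size.add (.const 1))).add (.const 1)) ?_
    ((const (list [list []])).congr fun i => rfl) ?_
  · intro i t ht
    refine (size_list_le (z := (list ((l i).map (f i))).size) ?_).trans ?_
    · intro x hx
      obtain ⟨s, hs, rfl⟩ := List.mem_map.1 hx
      exact size_list_sublist (((List.mem_sublists'.1 hs).trans ht.sublist).map _)
    · rw [List.length_map, List.length_sublists']
      have := Nat.pow_le_pow_right (n := 2) (by omega) ht.length_le
      gcongr
  · have h1 : PT (fun p : Suffixes l => .cons (f p.1 p.2.1.1) (.cons (list (p.2.1.2.sublists'.map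
        fun t => list (t.map (f p.1)))) (a p.1))) (fun p => list (p.2.1.2.sublists'.map
          fun t => list ((p.2.1.1 :: t).map (f p.1)))) :=
      map (l := fun p : Suffixes l => p.2.1.2.sublists')
        (f := fun p t => list (t.map (f p.1))) right.hd
        ((right.hd.cons left).congr fun _ => rfl)
    refine (right.hd.append h1).congr fun p => ?_
    rw [List.sublists'_cons, List.map_append, List.map_map]; rfl

open Classical in
theorem dedup {α : ι → Type} {l : ∀ i, List (α i)} {f : ∀ i, α i → Dat}
    (hf : ∀ i, Function.Injective (f i)) (hl : PT a (fun i => list ((l i).map (f i)))) :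
    PT a (fun i => list ((l i).dedup.map (f i))) := by
  refine listRec hl (fun i t => list (t.dedup.map (f i))) hl.size
    (fun i t ht => size_list_sublist (((List.dedup_sublist t).trans ht.sublist).map _)) nil ?_
  refine (bitMemMap (α := fun p : Suffixes l => α p.1) (f := fun p => f p.1) (fun p => hf p.1)
    (x := fun p => p.2.1.1) (l := fun p => p.2.1.2.dedup) left right.hd).bitCases
    (right.hd.congr fun p => ?_) ((left.cons right.hd).congr fun p => ?_)
  · rw [List.dedup_cons_of_mem (List.mem_dedup.1 p.2)]; rfl
  · rw [List.dedup_cons_of_notMem (fun h => p.2 (List.mem_dedup.2 h))]; rfl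

open Classical in
theorem union {l m : ι → List Dat} (hl : PT a (fun i => list (l i))) (hm : PT a (fun i => list (m i))) :
    PT a (fun i => list (l i ∪ m i)) := by
  refine listRec (α := fun _ => Dat) (f := fun _ x => x) (by simpa using hl)
    (fun i t => list (t ∪ m i)) (hl.size.add hm.size) (fun i t ht => ?_)
    (hm.congr fun i => by simp) ?_
  · have h2 := size_list_sublist ht.sublist
    have h3 : (list (t ∪ m i)).size + 1 ≤ (list t).size + (list (m i)).size := by
      clear ht h2
      induction t with
      | nil => simp [list, Dat.size, Nat.add_comm]
      | cons x t ih =>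
        rw [List.cons_union, size_list_cons]
        by_cases hx : x ∈ t ∪ m i
        · rw [List.insert_of_mem hx]; omega
        · rw [List.insert_of_not_mem hx, size_list_cons]; omega
    omega
  · refine (bitMem left right.hd).bitCases (right.hd.congr fun p => ?_)
      ((left.cons right.hd).congr fun p => ?_)
    · rw [List.cons_union, List.insert_of_mem p.2]; rfl
    · rw [List.cons_union, List.insert_of_not_mem p.2]; rfl

end PT

/-- Exponentiation in unary, in time polynomial in the result. -/
theorem Runs.exp {ι : Type} (k : ι → ℕ) :
    ∃ T, Runs (fun i => unary (k i)) (fun i => unary (2 ^ k i)) T ∧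
      PB (fun i => unary (2 ^ k i)) T := by
  set F : ι → Dat := fun i => unary (2 ^ k i) with hF
  have hlin : PB F (fun i => k i) :=
    PB.self.mono fun i => by
      rw [hF, size_unary]
      have := (k i).lt_two_pow_self
      omega
  have hz : PB F (fun i => 6 + 2 * k i + (F i).size) :=
    ((PB.const 6).add ((PB.const 2).mul hlin)).add .self
  -- The state is a countdown together with a unary power of two, which is doubled by appending it
  -- to itself.
  obtain ⟨S, k1, ⟨d, k2⟩, k3⟩ : PT (fun p : (i : ι) × Fin (k i) =>
      .cons (unary (k p.1 - p.2)) (unary (2 ^ (p.2 : ℕ))))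
      (fun p => .cons (unary (k p.1 - (p.2 + 1))) (unary (2 ^ (p.2 + 1 : ℕ)))) := by
    refine (PT.left.tl.cons ((PT.right.congr fun p => unary_eq _).append
      (PT.right.congr fun p => unary_eq _))).congr fun p => ?_
    have := p.2.2
    rw [show k p.1 - p.2 = k p.1 - (p.2 + 1) + 1 by omega, List.replicate_append_replicate, ← unary_eq,
      pow_succ, mul_two]
    rfl
  have hsz : ∀ i, ∀ j ≤ k i, (Dat.cons (unary (k i - j)) (unary (2 ^ j))).size ≤
      6 + 2 * k i + (F i).size := by
    intro i j hj
    have := Nat.pow_le_pow_right (n := 2) (by omega) hj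
    simp only [hF, Dat.size, size_unary]
    omega
  have hloop := Runs.loop (s := fun i j => .cons (unary (k i - j)) (unary (2 ^ j)))
    (τ := fun i => (6 + 2 * k i + (F i).size + 1) ^ d)
    (z := fun i => 6 + 2 * k i + (F i).size) (m := k)
    (k1.mono fun p => (k2 p).trans
      (Nat.pow_le_pow_left (Nat.add_le_add_right (hsz _ _ p.2.2.le) 1) d))
    (fun i j hj => by
      obtain ⟨r, hr⟩ : ∃ r, k i - j = r + 1 := ⟨k i - j - 1, by omega⟩
      simp [hr, unary, Dat.hd])
    (fun i => by simp [unary, Dat.hd]) hsz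
  obtain ⟨T₀, h1, h2, -⟩ : PT (fun i => unary (k i)) (fun i => Dat.cons (unary (k i)) (unary 1)) :=
    PT.refl.cons (PT.const _)
  obtain ⟨T₁, l1, l2, -⟩ : PT (fun i => Dat.cons (unary (k i - k i)) (F i)) F := PT.right
  have hk : PB F (fun i => (unary (k i)).size) := by
    simp only [size_unary]
    exact ((PB.const 2).mul hlin).add (.const 1)
  refine ⟨_, (h1.comp hloop).comp l1, ((PB.const 1).add (((PB.const 1).add (.of_size hk h2)).add
    ((hlin.add (.const 1)).mul (((PB.const 2).add hz).add ((hz.add (.const 1)).pow d))))).add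
      (.of_size ?_ l2)⟩
  exact hz.mono fun i => hsz i _ le_rfl

end FLTL

namespace FLTL

/-! ## Boolean functions -/

section Boolean

variable {Ap : Type u}

namespace Formula

theorem PSat.mono {V V' : Formula Ap → Prop} (h : ∀ χ, V χ → V' χ) {φ : Formula Ap}
    (hφ : PSat V φ) : PSat V' φ := by
  induction φ with
  | tt => trivial
  | ff => exact hφ
  | and φ ψ ih₁ ih₂ => exact ⟨ih₁ hφ.1, ih₂ hφ.2⟩
  | or φ ψ ih₁ ih₂ => exact hφ.imp ih₁ ih₂
  | _ => exact h _ hφ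

theorem psat_of_isRec {V : Formula Ap → Prop} {χ : Formula Ap} (h : χ.isRec = true) :
    PSat V χ ↔ V χ := by
  cases χ <;> first | exact Iff.rfl | cases h

end Formula

open Formula

namespace BFun

theorem ext {β γ : BFun Ap} (h : ∀ V, Holds V β ↔ Holds V γ) : β = γ := by
  induction β using Quotient.inductionOn
  induction γ using Quotient.inductionOn
  exact Quotient.sound h

theorem holds_mk (V : Formula Ap → Prop) (φ : Formula Ap) : Holds V (mk φ) ↔ PSat V φ := Iff.rfl

theorem Holds.mono {V V' : Formula Ap → Prop} (h : ∀ χ, V χ → V' χ) {β : BFun Ap}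
    (hβ : Holds V β) : Holds V' β := by
  induction β using Quotient.inductionOn
  exact PSat.mono h hβ

theorem holds_next (V : Formula Ap → Prop) (ν : Set Ap) (β : BFun Ap) :
    Holds V (β.next ν) ↔ Holds (fun χ => PSat V (χ.next ν)) β := by
  induction β using Quotient.inductionOn
  exact psat_of_distrib (Formula.next ν) rfl rfl (fun _ _ => rfl) (fun _ _ => rfl) V _

theorem holds_unfNext (V : Formula Ap → Prop) (ν : Set Ap) (β : BFun Ap) :
    Holds V (β.unfNext ν) ↔ Holds (fun χ => PSat V (χ.unf.next ν)) β := by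
  induction β using Quotient.inductionOn
  exact psat_of_distrib (fun φ => Formula.next ν (Formula.unf φ)) rfl rfl (fun _ _ => rfl)
    (fun _ _ => rfl) V _

theorem holds_substFF (V : Formula Ap → Prop) (Y : Set (Formula Ap)) (β : BFun Ap) :
    Holds V (β.substFF Y) ↔ Holds (fun χ => PSat V (χ.substFF Y)) β := by
  induction β using Quotient.inductionOn
  exact psat_of_distrib (Formula.substFF Y) rfl rfl (fun _ _ => rfl) (fun _ _ => rfl) V _

theorem next_mk (ν : Set Ap) (φ : Formula Ap) : (mk φ).next ν = mk (φ.next ν) := rfl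

theorem unfNext_mk (ν : Set Ap) (φ : Formula Ap) : (mk φ).unfNext ν = mk (φ.unf.next ν) := rfl

/-- Formulae are positive, hence monotone in the assignment, and the assignment that makes exactly
`R` true is the least one satisfying `R`. So consequence is evaluation at this single assignment. -/
theorem proves_iff {R : Set (Formula Ap)} (hR : ∀ χ ∈ R, χ.isRec = true) (β : BFun Ap) :
    Proves (mk '' R) β ↔ Holds (· ∈ R) β := by
  constructor
  · intro h
    refine h _ ?_
    rintro _ ⟨χ, hχ, rfl⟩
    exact (psat_of_isRec (hR χ hχ)).2 hχ
  · intro h V hV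
    exact h.mono fun χ hχ => (psat_of_isRec (hR χ hχ)).1 (hV _ ⟨χ, hχ, rfl⟩)

end BFun

theorem mem_recs {φ χ : Formula Ap} : χ ∈ φ.recs ↔ χ ∈ φ.subformulas ∧ χ.isRec = true := by
  simp [Formula.recs]

theorem isRec_of_mem_recs {φ χ : Formula Ap} (h : χ ∈ φ.recs) : χ.isRec = true := (mem_recs.1 h).2

end Boolean

/-! ## Tokens -/

section Tokens

variable {Ap : Type u}

open Formula

/-- The number of steps after which the slave has read all literals. -/
def Formula.depth : Formula Ap → ℕ
  | .atom _ | .natom _ => 1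
  | .X φ => φ.depth + 1
  | .and φ ψ | .or φ ψ => max φ.depth ψ.depth
  | _ => 0

theorem Formula.depth_le_length (φ : Formula Ap) : φ.depth ≤ φ.length := by
  induction φ <;> simp only [Formula.depth, Formula.length] <;> omega

/-- `next` does not enter `F`, `G`, `U` or frequency formulae, which therefore have depth 0; it
strips one layer of `X` and evaluates the exposed literals. -/
theorem Formula.depth_next (ν : Set Ap) (φ : Formula Ap) : (φ.next ν).depth ≤ φ.depth - 1 := by
  induction φ with
  | atom a => simp only [Formula.next]; split <;> simp [Formula.depth]
  | natom a => simp only [Formula.next]; split <;> simp [Formula.depth]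
  | and φ ψ ih₁ ih₂ => simp only [Formula.next, Formula.depth]; omega
  | or φ ψ ih₁ ih₂ => simp only [Formula.next, Formula.depth]; omega
  | X φ ih => simp [Formula.next, Formula.depth]
  | _ => simp [Formula.next, Formula.depth]

theorem Formula.next_of_depth {ν : Set Ap} {φ : Formula Ap} (h : φ.depth = 0) : φ.next ν = φ := by
  induction φ with
  | and φ ψ ih₁ ih₂ =>
    simp only [Formula.depth] at h
    rw [Formula.next, ih₁ (by omega), ih₂ (by omega)]
  | or φ ψ ih₁ ih₂ =>
    simp only [Formula.depth] at h
    rw [Formula.next, ih₁ (by omega), ih₂ (by omega)]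
  | atom a => simp [Formula.depth] at h
  | natom a => simp [Formula.depth] at h
  | X φ ih => simp [Formula.depth] at h
  | _ => rfl

/-- The token born at time `b`, after `d` steps. -/
noncomputable def token (w : Word Ap) (b : ℕ) (ξ : Formula Ap) : ℕ → Formula Ap
  | 0 => ξ
  | d + 1 => (token w b ξ d).next (w (b + d))

/-- The token born at time `b` has not disappeared within `d` steps. -/
def Alive (w : Word Ap) (b : ℕ) (ξ : Formula Ap) (d : ℕ) : Prop :=
  ∀ e < d, ¬ (BFun.mk (token w b ξ e)).IsSink

theorem alive_zero (w : Word Ap) (b : ℕ) (ξ : Formula Ap) : Alive w b ξ 0 := fun _ h => by simp at h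

theorem alive_succ {w : Word Ap} {b : ℕ} {ξ : Formula Ap} {d : ℕ} :
    Alive w b ξ (d + 1) ↔ Alive w b ξ d ∧ ¬ (BFun.mk (token w b ξ d)).IsSink := by
  constructor
  · exact fun h => ⟨fun e he => h e (by omega), h d (by omega)⟩
  · rintro ⟨h, h'⟩ e he
    rcases Nat.lt_succ_iff_lt_or_eq.1 he with he | rfl
    exacts [h e he, h']

theorem depth_token (w : Word Ap) (b : ℕ) (ξ : Formula Ap) (d : ℕ) :
    (token w b ξ d).depth ≤ ξ.depth - d := by
  induction d with
  | zero => simp [token]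
  | succ d ih =>
    have := Formula.depth_next (w (b + d)) (token w b ξ d)
    rw [token]
    omega

theorem isSink_of_depth {φ : Formula Ap} (h : φ.depth = 0) : (BFun.mk φ).IsSink := fun ν => by
  rw [BFun.next_mk, Formula.next_of_depth h]

theorem isSink_token {w : Word Ap} {b : ℕ} {ξ : Formula Ap} {d : ℕ} (h : ξ.depth ≤ d) :
    (BFun.mk (token w b ξ d)).IsSink :=
  isSink_of_depth (by have := depth_token w b ξ d; omega)

theorem Alive.le_depth {w : Word Ap} {b : ℕ} {ξ : Formula Ap} {d : ℕ} (h : Alive w b ξ d) :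
    d ≤ ξ.depth := by
  by_contra hd
  exact h ξ.depth (by omega) (isSink_token le_rfl)

theorem token_congr {w w' : Word Ap} {b b' : ℕ} (ξ : Formula Ap) {d : ℕ}
    (h : ∀ e < d, w (b + e) = w' (b' + e)) : token w b ξ d = token w' b' ξ d := by
  induction d with
  | zero => rfl
  | succ d ih => rw [token, token, ih fun e he => h e (by omega), h d (by omega)]

theorem alive_congr {w w' : Word Ap} {b b' : ℕ} (ξ : Formula Ap) {d : ℕ}
    (h : ∀ e < d, w (b + e) = w' (b' + e)) : Alive w b ξ d ↔ Alive w' b' ξ d := by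
  refine forall_congr' fun e => forall_congr' fun he => ?_
  rw [token_congr ξ fun e' he' => h e' (by omega)]

/-- The tokens present at time `j`. -/
def tokenSet (ξ : Formula Ap) (w : Word Ap) (j : ℕ) : Set (BFun Ap) :=
  {ψ | ∃ b ≤ j, Alive w b ξ (j - b) ∧ ψ = .mk (token w b ξ (j - b))}

open Classical in
/-- The numbers of tokens at time `j`. -/
noncomputable def tokenCount (ξ : Formula Ap) (w : Word Ap) (j : ℕ) : BFun Ap →₀ ℕ :=
  ∑ b ∈ Finset.range (j + 1),
    if Alive w b ξ (j - b) then Finsupp.single (BFun.mk (token w b ξ (j - b))) 1 else 0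

theorem tokenSet_zero (ξ : Formula Ap) (w : Word Ap) : tokenSet ξ w 0 = {.mk ξ} := by
  ext ψ
  simp [tokenSet, token, alive_zero]

theorem tokenCount_zero (ξ : Formula Ap) (w : Word Ap) :
    tokenCount ξ w 0 = Finsupp.single (.mk ξ) 1 := by
  simp [tokenCount, token, alive_zero]

theorem slaveLTS_step_eq_some {ξ : Formula Ap} {ψ ψ' : BFun Ap} {ν : Set Ap} :
    (slaveLTS ξ).step ψ ν = some ψ' ↔ ¬ ψ.IsSink ∧ ψ' = ψ.next ν := by
  simp only [slaveLTS]
  split <;> simp_all [eq_comm]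

theorem tokenSet_succ (ξ : Formula Ap) (w : Word Ap) (j : ℕ) :
    (tokenSetLTS ξ).step (tokenSet ξ w j) (w j) = some (tokenSet ξ w (j + 1)) := by
  simp only [tokenSetLTS, Option.some.injEq]
  ext ψ'
  simp only [slaveLTS_step_eq_some, Set.mem_union, Set.mem_singleton_iff, Set.mem_ofPred_eq, tokenSet]
  constructor
  · rintro (⟨ψ, ⟨b, hb, ha, rfl⟩, hs, rfl⟩ | rfl)
    · refine ⟨b, by omega, ?_, ?_⟩
      · rw [Nat.succ_sub hb, alive_succ]; exact ⟨ha, hs⟩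
      · rw [Nat.succ_sub hb, token, BFun.next_mk, Nat.add_sub_cancel' hb]
    · exact ⟨j + 1, le_rfl, by simp [alive_zero], by simp [token]⟩
  · rintro ⟨b, hb, ha, rfl⟩
    rcases Nat.lt_succ_iff_lt_or_eq.1 (Nat.lt_succ_of_le hb) with hb | rfl
    · have hb : b ≤ j := by omega
      rw [Nat.succ_sub hb, alive_succ] at ha
      refine .inl ⟨_, ⟨b, hb, ha.1, rfl⟩, ha.2, ?_⟩
      rw [Nat.succ_sub hb, token, BFun.next_mk, Nat.add_sub_cancel' hb]
    · right; simp [token]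

theorem tokenCount_succ (ξ : Formula Ap) (w : Word Ap) (j : ℕ) :
    (tokenCountLTS ξ).step (tokenCount ξ w j) (w j) = some (tokenCount ξ w (j + 1)) := by
  simp only [tokenCountLTS, Option.some.injEq]
  -- The contribution of a slave state to the successor is additive in its number of tokens, so the
  -- step can be carried out for each token separately.
  rw [tokenCount, tokenCount, ← Finsupp.sum_finsetSum_index, Finset.sum_range_succ _ (j + 1), add_comm]
  · congr 1
    · refine Finset.sum_congr rfl fun b hb => ?_
      have hb : b ≤ j := by simpa using Nat.lt_succ_iff.1 (Finset.mem_range.1 hb)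
      rw [Nat.succ_sub hb]
      by_cases ha : Alive w b ξ (j - b)
      · rw [if_pos ha, Finsupp.sum_single_index]
        · by_cases hs : (BFun.mk (token w b ξ (j - b))).IsSink
          · rw [if_neg (fun h => (alive_succ.1 h).2 hs)]
            simp [slaveLTS, hs]
          · rw [if_pos (alive_succ.2 ⟨ha, hs⟩)]
            simp [slaveLTS, hs, token, BFun.next_mk, Nat.add_sub_cancel' hb]
        · split <;> simp
      · rw [if_neg ha, if_neg (fun h => ha (alive_succ.1 h).1)]
        simp
    · simp [alive_zero, token]
  · intro ψ
    split <;> simp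
  · intro ψ k k'
    split <;> simp

theorem tokenSet_congr (ξ : Formula Ap) {w w' : Word Ap} {j : ℕ} (h : ∀ i < j, w i = w' i) :
    tokenSet ξ w j = tokenSet ξ w' j := by
  ext ψ
  refine exists_congr fun b => and_congr_right fun hb => ?_
  have : ∀ e < j - b, w (b + e) = w' (b + e) := fun e he => h _ (by omega)
  rw [alive_congr ξ this, token_congr ξ this]

theorem tokenCount_congr (ξ : Formula Ap) {w w' : Word Ap} {j : ℕ} (h : ∀ i < j, w i = w' i) :
    tokenCount ξ w j = tokenCount ξ w' j := by
  refine Finset.sum_congr rfl fun b hb => ?_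
  have : ∀ e < j - b, w (b + e) = w' (b + e) := fun e he => h _ (by omega)
  rw [token_congr ξ this, propext (alive_congr ξ this)]

/-- Only the tokens of the last `D` letters are present. -/
theorem tokenSet_suffix {ξ : Formula Ap} (w : Word Ap) {D j : ℕ} (hD : ξ.depth ≤ D) (hj : D ≤ j) :
    tokenSet ξ w j = tokenSet ξ (suffix w (j - D)) D := by
  ext ψ
  constructor
  · rintro ⟨b, hb, ha, rfl⟩
    have hle := ha.le_depth
    have hc : ∀ e < j - b, w (b + e) = suffix w (j - D) ((b - (j - D)) + e) := fun e he => by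
      rw [suffix]; congr 1; omega
    refine ⟨b - (j - D), by omega, ?_, ?_⟩ <;>
      rw [show D - (b - (j - D)) = j - b by omega]
    · exact (alive_congr ξ hc).1 ha
    · rw [token_congr ξ hc]
  · rintro ⟨b, hb, ha, rfl⟩
    have hc : ∀ e < D - b, w (b + (j - D) + e) = suffix w (j - D) (b + e) := fun e he => by
      rw [suffix]; congr 1; omega
    refine ⟨b + (j - D), by omega, ?_, ?_⟩ <;>
      rw [show j - (b + (j - D)) = D - b by omega]
    · exact (alive_congr ξ hc).2 ha
    · rw [token_congr ξ hc]

/-- A token born before `j - D` would be older than `ξ.depth`, so its summand is 0. -/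
theorem tokenCount_suffix {ξ : Formula Ap} (w : Word Ap) {D j : ℕ} (hD : ξ.depth ≤ D) (hj : D ≤ j) :
    tokenCount ξ w j = tokenCount ξ (suffix w (j - D)) D := by
  rw [tokenCount, tokenCount, show j + 1 = (j - D) + (D + 1) by omega, Finset.sum_range_add,
    Finset.sum_eq_zero, zero_add]
  · refine Finset.sum_congr rfl fun b hb => ?_
    have hc : ∀ e < D - b, w (j - D + b + e) = suffix w (j - D) (b + e) := fun e he => by
      rw [suffix]; congr 1; omega
    rw [show j - (j - D + b) = D - b by omega, token_congr ξ hc, propext (alive_congr ξ hc)]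
  · intro b hb
    rw [Finset.mem_range] at hb
    exact if_neg fun h => by have := h.le_depth; omega

end Tokens

/-! ## Runs of the product -/

section Product

variable {Ap : Type u}

/-- The state of a slave at time `j`. -/
noncomputable def slaveRun (w : Word Ap) (j : ℕ) : (χ : Formula Ap) → SlaveState χ
  | .F ξ => tokenSet ξ w j
  | .G ξ => tokenSet ξ w j
  | .freq _ _ _ ξ => tokenCount ξ w j
  | .tt | .ff | .atom _ | .natom _ | .and _ _ | .or _ _ | .X _ | .U _ _ => PUnit.unit

theorem slaveRun_zero (w : Word Ap) (χ : Formula Ap) : slaveRun w 0 χ = (slave χ).init := by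
  cases χ <;> first | rfl | exact tokenSet_zero _ _ | exact tokenCount_zero _ _

theorem slaveRun_succ (w : Word Ap) (j : ℕ) (χ : Formula Ap) :
    (slave χ).step (slaveRun w j χ) (w j) = some (slaveRun w (j + 1) χ) := by
  cases χ <;> first | rfl | exact tokenSet_succ _ _ _ | exact tokenCount_succ _ _ _

theorem slaveRun_congr {w w' : Word Ap} {j : ℕ} (h : ∀ i < j, w i = w' i) (χ : Formula Ap) :
    slaveRun w j χ = slaveRun w' j χ := by
  cases χ <;> first | rfl | exact tokenSet_congr _ h | exact tokenCount_congr _ h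

/-- The argument of an `F`-, `G`- or frequency formula. -/
def Formula.body : Formula Ap → Formula Ap
  | .F ξ | .G ξ | .freq _ _ _ ξ => ξ
  | φ => φ

theorem slaveRun_suffix {χ : Formula Ap} (w : Word Ap) {D j : ℕ} (hD : χ.body.depth ≤ D)
    (hj : D ≤ j) : slaveRun w j χ = slaveRun (suffix w (j - D)) D χ := by
  cases χ <;> first | rfl | exact tokenSet_suffix w hD hj | exact tokenCount_suffix w hD hj

/-- The iterated unfolding of a formula, `d` steps from time `k` on. -/
noncomputable def after (w : Word Ap) (k : ℕ) (φ : Formula Ap) : ℕ → Formula Ap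
  | 0 => φ
  | d + 1 => (after w k φ d).unf.next (w (k + d))

theorem after_congr {w w' : Word Ap} {k d : ℕ} (h : ∀ i < d, w (k + i) = w' (k + i))
    (φ : Formula Ap) : after w k φ d = after w' k φ d := by
  induction d with
  | zero => rfl
  | succ d ih => rw [after, after, ih fun i hi => h i (by omega), h d (by omega)]

/-- The state of the product at time `j`. -/
noncomputable def prodRun (φ : Formula Ap) (w : Word Ap) (j : ℕ) : ProdState φ :=
  (.mk (after w 0 φ j), fun χ => slaveRun w j χ.1)

theorem prodRun_congr (φ : Formula Ap) {w w' : Word Ap} {j : ℕ} (h : ∀ i < j, w i = w' i) :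
    prodRun φ w j = prodRun φ w' j := by
  rw [prodRun, prodRun, after_congr (fun i hi => by simpa using h i hi)]
  congr 1
  exact funext fun χ => slaveRun_congr h _

theorem prodRun_zero (φ : Formula Ap) (w : Word Ap) :
    prodRun φ w 0 = (productAutomaton φ).init := by
  refine Prod.ext rfl (funext fun χ => ?_)
  exact slaveRun_zero w χ.1

theorem prodRun_succ (φ : Formula Ap) (w : Word Ap) (j : ℕ) :
    (productAutomaton φ).step (prodRun φ w j) (w j) = some (prodRun φ w (j + 1)) := by
  have h : ∀ χ : {χ // χ ∈ φ.recs},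
      (slave χ.1).step ((prodRun φ w j).2 χ) (w j) = some ((prodRun φ w (j + 1)).2 χ) :=
    fun χ => slaveRun_succ w j χ.1
  simp only [productAutomaton, LTS.prod, LTS.pi, master, Option.bind_some]
  rw [dif_pos (fun χ => by rw [h χ]; rfl)]
  simp only [Option.map_some, Option.some.injEq]
  refine Prod.ext ?_ (funext fun χ => ?_)
  · simp [prodRun, after, BFun.unfNext_mk]
  · simp [h χ]

theorem reachable_iff (φ : Formula Ap) (q : ProdState φ) :
    (productAutomaton φ).toLTS.Reachable q ↔ ∃ w j, q = prodRun φ w j := by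
  constructor
  · intro h
    induction h with
    | init => exact ⟨fun _ => ∅, 0, (prodRun_zero φ _).symm⟩
    | @step q a q' _ hs ih =>
      obtain ⟨w, j, rfl⟩ := ih
      -- The state at time `j` depends only on the letters before `j`, so the word may be changed at
      -- `j`.
      refine ⟨Function.update w j a, j + 1, ?_⟩
      have h1 := prodRun_succ φ (Function.update w j a) j
      rw [Function.update_self, prodRun_congr φ (w' := w) (fun i hi => by simp [hi.ne]), hs] at h1
      exact Option.some.inj h1
  · rintro ⟨w, j, rfl⟩
    induction j with
    | zero => rw [prodRun_zero]; exact .init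
    | succ j ih => exact .step ih (prodRun_succ φ w j)

theorem holds_comap {Q Q' : Type v} (f : Q' → Q) (ρ : ℕ → Q') (x : AccVar Q) :
    (x.comap f).Holds ρ ↔ x.Holds (f ∘ ρ) := by
  cases x <;> exact Iff.rfl

/-- The product is deterministic and its step is always defined along `prodRun`, so this is the only
run over `w`. -/
theorem mem_language_iff (φ : Formula Ap) (w : Word Ap) :
    w ∈ (automaton φ).language ↔ ∃ R ⊆ φ.recs, (masterAcc φ R).Holds (prodRun φ w) ∧
      ∀ χ ∈ R, (slaveAcc (BFun.mk '' (R : Set (Formula Ap))) χ).Holds (fun j => slaveRun w j χ) := by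
  have hacc : (productAutomaton φ).acc.Holds (prodRun φ w) ↔ ∃ R ⊆ φ.recs,
      (masterAcc φ R).Holds (prodRun φ w) ∧
      ∀ χ ∈ R, (slaveAcc (BFun.mk '' (R : Set (Formula Ap))) χ).Holds (fun j => slaveRun w j χ) := by
    simp only [GRMAcc.Holds, productAutomaton, List.mem_map, Finset.mem_toList, Finset.mem_powerset,
      exists_exists_and_eq_and, clause, List.mem_cons, forall_eq_or_imp, forall_exists_index, and_imp,
      Finset.mem_filter]
    refine exists_congr fun R => and_congr_right fun hR => and_congr_right fun _ => ?_
    constructor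
    · intro h χ hχ
      exact (holds_comap _ _ _).1 (h _ ⟨χ, hR hχ⟩ (Finset.mem_attach _ _) hχ rfl)
    · rintro h _ χ - hχ rfl
      exact (holds_comap _ _ _).2 (h χ.1 hχ)
  have hreach : ∀ (α : GRMAcc (ProdState φ)) (ρ : ℕ → AutState φ),
      (α.comap Subtype.val).Holds ρ ↔ α.Holds (fun j => (ρ j).1) := by
    intro α ρ
    simp only [GRMAcc.Holds, GRMAcc.comap, List.mem_map, exists_exists_and_eq_and,
      forall_exists_index, and_imp, forall_apply_eq_imp_iff₂, holds_comap]
    rfl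
  rw [← hacc]
  constructor
  · rintro ⟨ρ, hρ, ha⟩
    have hrun : ∀ j, (ρ j).1 = prodRun φ w j := by
      intro j
      induction j with
      | zero => rw [hρ.1, prodRun_zero]; rfl
      | succ j ih =>
        have h1 := hρ.2 j
        have h2 := prodRun_succ φ w j
        rw [← ih] at h2
        simp only [automaton, DGRMA.reach, LTS.reach, Option.pmap_eq_some_iff] at h1
        obtain ⟨q, h, hq, he⟩ := h1
        rw [h2] at hq
        rw [he]
        exact (Option.some.inj hq).symm
    have := (hreach _ ρ).1 ha
    rwa [show (fun j => (ρ j).1) = prodRun φ w from funext hrun] at this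
  · intro ha
    refine ⟨fun j => ⟨prodRun φ w j, (reachable_iff φ _).2 ⟨w, j, rfl⟩⟩, ⟨?_, fun j => ?_⟩,
      (hreach _ _).2 ha⟩
    · exact Subtype.ext (prodRun_zero φ w)
    · simp only [automaton, DGRMA.reach, LTS.reach, Option.pmap_eq_some_iff]
      exact ⟨_, .step ((reachable_iff φ _).2 ⟨w, j, rfl⟩) (prodRun_succ φ w j),
        prodRun_succ φ w j, rfl⟩

end Product

end FLTL

namespace FLTL

open Filter

/-! ## Long-run averages -/

theorem Cmp.holds.mono {c : Cmp} {x y p : ℝ} (h : c.holds x p) (hxy : x ≤ y) : c.holds y p := by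
  cases c
  · exact le_trans (show p ≤ x from h) hxy
  · exact lt_of_lt_of_le (show p < x from h) hxy

theorem average_mem {q : ℕ → ℝ} {K : ℝ} (h0 : ∀ j, 0 ≤ q j) (hK : ∀ j, q j ≤ K) (i : ℕ) :
    0 ≤ (∑ j ∈ Finset.range i, q j) / (i : ℝ) ∧ (∑ j ∈ Finset.range i, q j) / (i : ℝ) ≤ max K 0 := by
  refine ⟨div_nonneg (Finset.sum_nonneg fun j _ => h0 j) (Nat.cast_nonneg i), ?_⟩
  refine div_le_of_le_mul₀ (Nat.cast_nonneg i) (le_max_right _ _) ?_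
  calc ∑ j ∈ Finset.range i, q j ≤ ∑ _j ∈ Finset.range i, max K 0 :=
        Finset.sum_le_sum fun j _ => (hK j).trans (le_max_left _ _)
    _ = max K 0 * i := by simp [mul_comm]

/-- The long-run average is monotone, up to bounded differences of the sums. -/
theorem lr_le_lr {q q' : ℕ → ℝ} {K C : ℝ} (h0 : ∀ j, 0 ≤ q j) (hK : ∀ j, q j ≤ K)
    (h0' : ∀ j, 0 ≤ q' j) (hK' : ∀ j, q' j ≤ K)
    (h : ∀ i, ∑ j ∈ Finset.range i, q j ≤ ∑ j ∈ Finset.range i, q' j + C) (e : Ext) :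
    lr e q ≤ lr e q' := by
  set u : ℕ → ℝ := fun i => (∑ j ∈ Finset.range i, q j) / (i : ℝ) with hu
  set u' : ℕ → ℝ := fun i => (∑ j ∈ Finset.range i, q' j) / (i : ℝ) with hu'
  have hb : IsBoundedUnder (· ≤ ·) atTop u := isBoundedUnder_of ⟨_, fun i => (average_mem h0 hK i).2⟩
  have hb' : IsBoundedUnder (· ≤ ·) atTop u' := isBoundedUnder_of ⟨_, fun i => (average_mem h0' hK' i).2⟩
  have hc : IsBoundedUnder (· ≥ ·) atTop u := isBoundedUnder_of ⟨0, fun i => (average_mem h0 hK i).1⟩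
  have hc' : IsBoundedUnder (· ≥ ·) atTop u' := isBoundedUnder_of ⟨0, fun i => (average_mem h0' hK' i).1⟩
  refine le_of_forall_pos_le_add fun ε hε => ?_
  -- Divided by `i`, the constant `C` drops below `ε` as soon as `i ≥ C / ε`.
  have hev : ∀ᶠ i in atTop, u i ≤ u' i + ε := by
    filter_upwards [eventually_ge_atTop (Nat.ceil (C / ε)), eventually_gt_atTop 0] with i hi hi0
    have hi0' : (0 : ℝ) < i := by exact_mod_cast hi0
    have h1 : C / ε ≤ i := (Nat.le_ceil _).trans (by exact_mod_cast hi)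
    have h2 : C ≤ i * ε := (div_le_iff₀ hε).1 h1
    rw [hu, hu', div_le_iff₀ hi0', add_mul, div_mul_cancel₀ _ hi0'.ne']
    have := h i
    linarith
  have hb'' : IsBoundedUnder (· ≤ ·) atTop (fun i => u' i + ε) :=
    isBoundedUnder_of ⟨max K 0 + ε, fun i => by have := (average_mem h0' hK' i).2; simp only [hu']; linarith⟩
  have hc'' : IsBoundedUnder (· ≥ ·) atTop (fun i => u' i + ε) :=
    isBoundedUnder_of ⟨0, fun i => by
      have := (average_mem h0' hK' i).1; simp only [hu', ge_iff_le]; linarith⟩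
  cases e with
  | inf =>
    calc liminf u atTop ≤ liminf (fun i => u' i + ε) atTop :=
          liminf_le_liminf hev hc hb''.isCoboundedUnder_ge
      _ = liminf u' atTop + ε := liminf_add_const _ _ _ hb'.isCoboundedUnder_ge hc'
  | sup =>
    calc limsup u atTop ≤ limsup (fun i => u' i + ε) atTop :=
          limsup_le_limsup hev hc.isCoboundedUnder_le hb''
      _ = limsup u' atTop + ε := limsup_add_const _ _ _ hb' hc'.isCoboundedUnder_le

open Classical in
/-- The indicator of a predicate. -/
noncomputable def ind (P : ℕ → Prop) (i : ℕ) : ℝ := if P i then 1 else 0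

theorem ind_nonneg (P : ℕ → Prop) (i : ℕ) : 0 ≤ ind P i := by
  unfold ind; split <;> norm_num

theorem ind_le_one (P : ℕ → Prop) (i : ℕ) : ind P i ≤ 1 := by
  unfold ind; split <;> norm_num

theorem ind_le_ind {P Q : ℕ → Prop} {i : ℕ} (h : P i → Q i) : ind P i ≤ ind Q i := by
  unfold ind
  by_cases hP : P i
  · simp [hP, h hP]
  · simp only [hP, if_false]; split <;> norm_num

/-- The implication fails only before some `J`, and these positions contribute at most `J` to the
sums. -/
theorem lr_ind_mono {P Q : ℕ → Prop} (h : ∀ᶠ i in atTop, P i → Q i) (e : Ext) :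
    lr e (ind P) ≤ lr e (ind Q) := by
  obtain ⟨J, hJ⟩ := eventually_atTop.1 h
  refine lr_le_lr (K := 1) (C := J) (ind_nonneg P) (ind_le_one P) (ind_nonneg Q) (ind_le_one Q) ?_ e
  intro i
  by_cases hi : i ≤ J
  · calc ∑ j ∈ Finset.range i, ind P j ≤ ∑ _j ∈ Finset.range i, (1 : ℝ) :=
          Finset.sum_le_sum fun j _ => ind_le_one P j
      _ = i := by simp
      _ ≤ J := by exact_mod_cast hi
      _ ≤ _ := le_add_of_nonneg_left (Finset.sum_nonneg fun j _ => ind_nonneg Q j)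
  · obtain ⟨m, rfl⟩ := Nat.exists_eq_add_of_lt (not_le.1 hi)
    rw [add_assoc, Finset.sum_range_add _ J, Finset.sum_range_add _ J]
    have h1 : ∑ j ∈ Finset.range J, ind P j ≤ J := by
      calc ∑ j ∈ Finset.range J, ind P j ≤ ∑ _j ∈ Finset.range J, (1 : ℝ) :=
            Finset.sum_le_sum fun j _ => ind_le_one P j
        _ = J := by simp
    have h2 : 0 ≤ ∑ j ∈ Finset.range J, ind Q j := Finset.sum_nonneg fun j _ => ind_nonneg Q j
    have h3 : ∑ j ∈ Finset.range (m + 1), ind P (J + j) ≤ ∑ j ∈ Finset.range (m + 1), ind Q (J + j) :=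
      Finset.sum_le_sum fun j _ => ind_le_ind (hJ _ (by omega))
    linarith

/-- The sums over the positions from 0 and from `k` on differ by at most `k`. This makes frequency
formulae independent of finite prefixes. -/
theorem lr_ind_shift (P : ℕ → Prop) (k : ℕ) (e : Ext) :
    lr e (ind fun i => P (k + i)) = lr e (ind P) := by
  have hs : ∀ i, ∑ j ∈ Finset.range k, ind P j + ∑ j ∈ Finset.range i, ind P (k + j) =
      ∑ j ∈ Finset.range i, ind P j + ∑ j ∈ Finset.range k, ind P (i + j) := fun i => by
    rw [← Finset.sum_range_add, ← Finset.sum_range_add, add_comm]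
  have hle : ∀ m, ∑ j ∈ Finset.range k, ind P (m + j) ≤ k := fun m => by
    calc ∑ j ∈ Finset.range k, ind P (m + j) ≤ ∑ _j ∈ Finset.range k, (1 : ℝ) :=
          Finset.sum_le_sum fun j _ => ind_le_one P _
      _ = k := by simp
  have h0 : ∀ m, 0 ≤ ∑ j ∈ Finset.range k, ind P (m + j) := fun m =>
    Finset.sum_nonneg fun j _ => ind_nonneg P _
  have hk := hle 0
  have hk0 := h0 0
  simp only [zero_add] at hk hk0
  have he : ∀ i, ind (fun i => P (k + i)) i = ind P (k + i) := fun i => rfl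
  refine le_antisymm (lr_le_lr (K := 1) (C := k) (ind_nonneg _) (ind_le_one _) (ind_nonneg _)
    (ind_le_one _) (fun i => ?_) e) (lr_le_lr (K := 1) (C := k) (ind_nonneg _) (ind_le_one _)
    (ind_nonneg _) (ind_le_one _) (fun i => ?_) e)
  all_goals
    simp only [he]
    have h1 := hs i
    have h2 := hle i
    have h3 := h0 i
    linarith

/-! ## Semantics -/

section Semantics

variable {Ap : Type u}

theorem suffix_suffix (w : Word Ap) (j k : ℕ) : suffix (suffix w j) k = suffix w (j + k) := by
  funext i; simp [suffix, add_assoc]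

theorem suffix_zero (w : Word Ap) : suffix w 0 = w := by
  funext i; simp [suffix]

theorem suffix_apply_zero (w : Word Ap) (j : ℕ) : suffix w j 0 = w j := by simp [suffix]

theorem sat_freq {w : Word Ap} {e : Ext} {c : Cmp} {p : Set.Icc (0 : ℚ) 1} {φ : Formula Ap} :
    Sat w (.freq e c p φ) ↔ c.holds (lr e (ind fun i => Sat (suffix w i) φ)) ((p : ℚ) : ℝ) := Iff.rfl

theorem sat_freq_suffix {w : Word Ap} {e : Ext} {c : Cmp} {p : Set.Icc (0 : ℚ) 1} {φ : Formula Ap}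
    (k : ℕ) : Sat (suffix w k) (.freq e c p φ) ↔ Sat w (.freq e c p φ) := by
  rw [sat_freq, sat_freq]
  simp only [suffix_suffix]
  rw [lr_ind_shift (fun i => Sat (suffix w i) φ)]

open Formula in
theorem psat_sat (w : Word Ap) (φ : Formula Ap) : PSat (Sat w) φ ↔ Sat w φ := by
  induction φ with
  | and φ ψ ih₁ ih₂ => simp only [PSat, Sat, ih₁, ih₂]
  | or φ ψ ih₁ ih₂ => simp only [PSat, Sat, ih₁, ih₂]
  | _ => simp [PSat, Sat]

/-- These are the expansion laws of the temporal operators; for a frequency formula the law is its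
independence of the first letter. -/
theorem sat_unf_next (w : Word Ap) (φ : Formula Ap) :
    Sat (suffix w 1) (φ.unf.next (w 0)) ↔ Sat w φ := by
  have hex : ∀ P : ℕ → Prop, (∃ k, P k) ↔ P 0 ∨ ∃ k, P (k + 1) := fun P =>
    ⟨fun ⟨k, hk⟩ => by cases k; exacts [.inl hk, .inr ⟨_, hk⟩],
      fun h => h.elim (fun h => ⟨_, h⟩) fun ⟨k, h⟩ => ⟨_, h⟩⟩
  have hall : ∀ P : ℕ → Prop, (∀ k, P k) ↔ P 0 ∧ ∀ k, P (k + 1) := fun P =>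
    ⟨fun h => ⟨h _, fun _ => h _⟩, fun h k => by cases k; exacts [h.1, h.2 _]⟩
  induction φ with
  | tt => simp [Formula.unf, Formula.next, Sat]
  | ff => simp [Formula.unf, Formula.next, Sat]
  | atom a => simp only [Formula.unf, Formula.next]; split <;> simp_all [Sat]
  | natom a => simp only [Formula.unf, Formula.next]; split <;> simp_all [Sat]
  | and φ ψ ih₁ ih₂ => simp only [Formula.unf, Formula.next, Sat, ih₁, ih₂]
  | or φ ψ ih₁ ih₂ => simp only [Formula.unf, Formula.next, Sat, ih₁, ih₂]
  | X φ ih => simp only [Formula.unf, Formula.next, Sat]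
  | F φ ih =>
    simp only [Formula.unf, Formula.next, Sat, ih, suffix_suffix]
    rw [hex (fun k => Sat (suffix w k) φ), suffix_zero]
    simp only [add_comm]
  | G φ ih =>
    simp only [Formula.unf, Formula.next, Sat, ih, suffix_suffix]
    rw [hall (fun k => Sat (suffix w k) φ), suffix_zero]
    simp only [add_comm]
  | U φ ψ ih₁ ih₂ =>
    simp only [Formula.unf, Formula.next, Sat, ih₁, ih₂, suffix_suffix]
    rw [hex (fun k => Sat (suffix w k) ψ ∧ _), suffix_zero]
    refine or_congr (by simp) ?_
    rw [← exists_and_left]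
    refine exists_congr fun k => ?_
    have : (∀ j < k + 1, Sat (suffix w j) φ) ↔ Sat w φ ∧ ∀ j < k, Sat (suffix w (1 + j)) φ := by
      constructor
      · exact fun h => ⟨suffix_zero w ▸ h 0 (by omega), fun j hj => h _ (by omega)⟩
      · rintro ⟨h1, h2⟩ (_ | j) hj
        · rwa [suffix_zero]
        · rw [add_comm]; exact h2 j (by omega)
    rw [this, add_comm 1 k]
    tauto
  | freq e c p φ ih =>
    simp only [Formula.unf, Formula.next, Sat.eq_5, sat_freq_suffix]
    simp [Sat.eq_1]

theorem sat_after (w : Word Ap) (k : ℕ) (φ : Formula Ap) (d : ℕ) :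
    Sat (suffix w (k + d)) (after w k φ d) ↔ Sat (suffix w k) φ := by
  induction d with
  | zero => rfl
  | succ d ih =>
    rw [← ih, after, ← sat_unf_next (suffix w (k + d)), suffix_suffix, suffix_apply_zero]
    rfl

/-- The truth value of a formula at the start of a word when exactly the `F`-, `G`- and frequency
formulae in `R` are taken to be true. -/
def TR (R : Set (Formula Ap)) : Word Ap → Formula Ap → Prop
  | _, .tt => True
  | _, .ff => False
  | w, .atom a => a ∈ w 0
  | w, .natom a => a ∉ w 0
  | w, .and φ ψ => TR R w φ ∧ TR R w ψ
  | w, .or φ ψ => TR R w φ ∨ TR R w ψ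
  | w, .X φ => TR R (suffix w 1) φ
  | _, .F φ => .F φ ∈ R
  | _, .G φ => .G φ ∈ R
  | _, .U _ _ => False
  | _, .freq e c p φ => .freq e c p φ ∈ R

variable {R : Set (Formula Ap)}

theorem TR_of_isRec {χ : Formula Ap} (h : χ.isRec = true) (w : Word Ap) : TR R w χ ↔ χ ∈ R := by
  cases χ <;> first | exact Iff.rfl | cases h

open Formula in
theorem psat_TR (w : Word Ap) (φ : Formula Ap) : PSat (TR R w) φ ↔ TR R w φ := by
  induction φ with
  | and φ ψ ih₁ ih₂ => simp only [PSat, TR, ih₁, ih₂]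
  | or φ ψ ih₁ ih₂ => simp only [PSat, TR, ih₁, ih₂]
  | _ => simp [PSat, TR]

/-- A step replaces literals by the values that `TR` reads off the current letter and strips `X`,
while the variables decided by `R` have the same value at all positions. -/
theorem TR_next (w : Word Ap) (φ : Formula Ap) : TR R (suffix w 1) (φ.next (w 0)) ↔ TR R w φ := by
  induction φ with
  | and φ ψ ih₁ ih₂ => simp only [Formula.next, TR, ih₁, ih₂]
  | or φ ψ ih₁ ih₂ => simp only [Formula.next, TR, ih₁, ih₂]
  | atom a => simp only [Formula.next]; split <;> simp_all [TR]
  | natom a => simp only [Formula.next]; split <;> simp_all [TR]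
  | _ => simp [Formula.next, TR]

theorem TR_token (w : Word Ap) (b : ℕ) (ξ : Formula Ap) (d : ℕ) :
    TR R (suffix w (b + d)) (token w b ξ d) ↔ TR R (suffix w b) ξ := by
  induction d with
  | zero => rfl
  | succ d ih =>
    rw [← ih, token, ← TR_next (suffix w (b + d)), suffix_suffix, suffix_apply_zero]
    rfl

theorem mk_token_of_isSink {w : Word Ap} {b : ℕ} {ξ : Formula Ap} {d e : ℕ} (hde : d ≤ e)
    (h : (BFun.mk (token w b ξ d)).IsSink) : BFun.mk (token w b ξ e) = BFun.mk (token w b ξ d) := by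
  induction e, hde using Nat.le_induction with
  | base => rfl
  | succ e _ ih => rw [token, ← BFun.next_mk, ih]; exact h _

open Formula in
-- A sink equals, as a Boolean function, each of its successors. After `depth` many steps a
-- representative without exposed literals or `X` is reached; on it `TR` consults nothing but `R`,
-- and `U`-formulae are false on both sides since `R` contains none.
theorem holds_sink (hR : ∀ χ ∈ R, χ.isRec = true) {β : BFun Ap} (h : β.IsSink) (w : Word Ap) :
    BFun.Holds (TR R w) β ↔ BFun.Holds (· ∈ R) β := by
  induction β using Quotient.inductionOn with
  | h φ =>
    -- Being a sink is a property of the class, so a new representative of depth 0 is needed before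
    -- the induction.
    have h0 : BFun.mk (token w 0 φ φ.depth) = BFun.mk φ :=
      mk_token_of_isSink (w := w) (b := 0) (ξ := φ) (Nat.zero_le _) h
    have hd : (token w 0 φ φ.depth).depth = 0 := by have := depth_token w 0 φ φ.depth; omega
    change BFun.Holds _ (BFun.mk φ) ↔ BFun.Holds _ (BFun.mk φ)
    rw [← h0, BFun.holds_mk, BFun.holds_mk]
    generalize token w 0 φ φ.depth = ψ at hd
    clear h0 h
    induction ψ with
    | and φ ψ ih₁ ih₂ =>
      simp only [Formula.depth] at hd
      simp only [PSat, ih₁ (by omega), ih₂ (by omega)]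
    | or φ ψ ih₁ ih₂ =>
      simp only [Formula.depth] at hd
      simp only [PSat, ih₁ (by omega), ih₂ (by omega)]
    | atom a => simp [Formula.depth] at hd
    | natom a => simp [Formula.depth] at hd
    | X φ ih => simp [Formula.depth] at hd
    | U φ ψ =>
      simp only [PSat, TR, false_iff]
      intro h
      have := hR _ h
      simp [isRec] at this
    | _ => simp [PSat, TR]

/-- This links automaton and semantics: provability is evaluation under `R`, on a sink that agrees
with `TR`, and `TR` is preserved while the token moves. -/
theorem proves_token_iff (hR : ∀ χ ∈ R, χ.isRec = true) {w : Word Ap} {b : ℕ} {ξ : Formula Ap} {d : ℕ}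
    (h : (BFun.mk (token w b ξ d)).IsSink) :
    BFun.Proves (BFun.mk '' R) (.mk (token w b ξ d)) ↔ TR R (suffix w b) ξ := by
  rw [BFun.proves_iff hR, ← holds_sink hR h (suffix w (b + d)), BFun.holds_mk, psat_TR, TR_token]

theorem exists_sink_time (w : Word Ap) (b : ℕ) (ξ : Formula Ap) :
    ∃ d, Alive w b ξ d ∧ (BFun.mk (token w b ξ d)).IsSink := by
  classical
  have h : ∃ d, (BFun.mk (token w b ξ d)).IsSink := ⟨_, isSink_token le_rfl⟩
  exact ⟨Nat.find h, fun e he => Nat.find_min h he, Nat.find_spec h⟩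

/-- The token born at `b` reaches a sink between the times `b` and `b + ξ.depth`, so the set of such
times is bounded iff the set of births is. -/
theorem finite_sink_times {ξ : Formula Ap} {w : Word Ap} {P : BFun Ap → Prop} {Q : ℕ → Prop}
    (h : ∀ b d, (BFun.mk (token w b ξ d)).IsSink → (P (.mk (token w b ξ d)) ↔ Q b)) :
    {j | ∃ ψ ∈ tokenSet ξ w j, ψ.IsSink ∧ P ψ}.Finite ↔ {b | Q b}.Finite := by
  rw [Set.finite_iff_bddAbove, Set.finite_iff_bddAbove]
  constructor
  · rintro ⟨B, hB⟩
    refine ⟨B, fun b hb => ?_⟩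
    obtain ⟨d, h1, h2⟩ := exists_sink_time w b ξ
    have : b + d ≤ B := hB ⟨_, ⟨b, by omega, by simpa using h1, rfl⟩, by simpa using h2,
      by simpa using (h b d h2).2 hb⟩
    omega
  · rintro ⟨B, hB⟩
    refine ⟨B + ξ.depth, ?_⟩
    rintro j ⟨_, ⟨b, hb, ha, rfl⟩, hs, hP⟩
    have h1 := hB ((h b _ hs).1 hP)
    have h2 := ha.le_depth
    omega

theorem slaveAcc_F_iff (hR : ∀ χ ∈ R, χ.isRec = true) (w : Word Ap) (ξ : Formula Ap) :
    (slaveAcc (BFun.mk '' R) (.F ξ)).Holds (fun j => slaveRun w j (.F ξ)) ↔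
      {b | TR R (suffix w b) ξ}.Infinite :=
  not_congr (finite_sink_times (Q := fun b => TR R (suffix w b) ξ)
    (P := BFun.Proves (BFun.mk '' R)) fun _ _ h => proves_token_iff hR h)

theorem slaveAcc_G_iff (hR : ∀ χ ∈ R, χ.isRec = true) (w : Word Ap) (ξ : Formula Ap) :
    (slaveAcc (BFun.mk '' R) (.G ξ)).Holds (fun j => slaveRun w j (.G ξ)) ↔
      {b | ¬ TR R (suffix w b) ξ}.Finite :=
  finite_sink_times (Q := fun b => ¬ TR R (suffix w b) ξ)
    (P := fun ψ => ¬ BFun.Proves (BFun.mk '' R) ψ) fun _ _ h => not_congr (proves_token_iff hR h)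

end Semantics

end FLTL

/-! ### Correctness of the automaton, beginning with the mean-payoff slaves. -/

namespace FLTL

open Filter

section Correctness

variable {Ap : Type u} {R : Set (Formula Ap)}

open Classical in
-- A token with a good birth position earns reward 1 when it sits in its sink, at most `ξ.depth`
-- steps after birth. The potential `Φ`, the number of living good tokens, accounts for the delay
-- and is bounded, so rewards and truth values have the same long-run average.
theorem slaveAcc_freq_iff (hR : ∀ χ ∈ R, χ.isRec = true) (w : Word Ap) (ξ : Formula Ap)
    (e : Ext) (c : Cmp) (p : Set.Icc (0 : ℚ) 1) :
    (slaveAcc (BFun.mk '' R) (.freq e c p ξ)).Holds (fun j => slaveRun w j (.freq e c p ξ)) ↔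
      c.holds (lr e (ind fun b => TR R (suffix w b) ξ)) ((p : ℚ) : ℝ) := by
  set T : ℕ → ℝ := ind fun b => TR R (suffix w b) ξ with hT
  set rr : ℕ → ℝ := fun j => (((tokenCount ξ w j).sum (fun ψ k =>
    if ψ.IsSink ∧ BFun.Proves (BFun.mk '' R) ψ then (k : ℚ) else 0) : ℚ) : ℝ) with hrr
  set Φ : ℕ → ℝ := fun j => ∑ b ∈ Finset.range (j + 1), if Alive w b ξ (j - b) then T b else 0 with hΦ
  have hr : ∀ j, rr j = ∑ b ∈ Finset.range (j + 1),
      if Alive w b ξ (j - b) ∧ (BFun.mk (token w b ξ (j - b))).IsSink then T b else 0 := by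
    intro j
    simp only [hrr, tokenCount]
    rw [← Finsupp.sum_finsetSum_index (by simp) (by intro ψ k k'; split <;> simp)]
    push_cast
    refine Finset.sum_congr rfl fun b _ => ?_
    by_cases ha : Alive w b ξ (j - b)
    · rw [if_pos ha, Finsupp.sum_single_index (by simp)]
      by_cases hs : (BFun.mk (token w b ξ (j - b))).IsSink
      · simp only [ha, hs, proves_token_iff hR hs, hT, ind, and_self, true_and, if_true, Nat.cast_one]
        split <;> norm_num
      · simp [hs]
    · simp [ha]
  -- From `j` to `j + 1` the tokens in sinks are paid and disappear, the others survive, and one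
  -- token is born.
  have hstep : ∀ j, Φ (j + 1) + rr j = Φ j + T (j + 1) := by
    intro j
    rw [hr, hΦ]
    simp only
    rw [Finset.sum_range_succ _ (j + 1), add_right_comm, ← Finset.sum_add_distrib]
    congr 1
    · refine Finset.sum_congr rfl fun b hb => ?_
      have hb : b ≤ j := by simpa using Nat.lt_succ_iff.1 (Finset.mem_range.1 hb)
      rw [Nat.succ_sub hb, Nat.succ_eq_add_one]
      simp only [alive_succ]
      by_cases ha : Alive w b ξ (j - b) <;>
        by_cases hs : (BFun.mk (token w b ξ (j - b))).IsSink <;> simp [ha, hs]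
    · simp [alive_zero]
  have hsum : ∀ i, ∑ j ∈ Finset.range i, rr j + Φ i = ∑ j ∈ Finset.range i, T j + T i := by
    intro i
    induction i with
    | zero => simp [hΦ, alive_zero]
    | succ i ih =>
      rw [Finset.sum_range_succ, Finset.sum_range_succ]
      have := hstep i
      linarith
  have hT0 := ind_nonneg fun b => TR R (suffix w b) ξ
  have hT1 := ind_le_one fun b => TR R (suffix w b) ξ
  have hΦ0 : ∀ j, 0 ≤ Φ j := fun j => Finset.sum_nonneg fun b _ => by
    split
    exacts [hT0 b, le_rfl]
  -- A token still alive has age at most `ξ.depth`, so at most `ξ.depth + 1` birth positions count.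
  have hΦ1 : ∀ j, Φ j ≤ ξ.depth + 1 := by
    intro j
    calc Φ j ≤ ∑ b ∈ Finset.range (j + 1), if j - b ≤ ξ.depth then (1 : ℝ) else 0 := by
          refine Finset.sum_le_sum fun b _ => ?_
          by_cases ha : Alive w b ξ (j - b)
          · rw [if_pos ha, if_pos ha.le_depth]; exact hT1 b
          · rw [if_neg ha]; split <;> norm_num
      _ = ((Finset.range (j + 1)).filter fun b => j - b ≤ ξ.depth).card := by simp
      _ ≤ (Finset.Icc (j - ξ.depth) j).card := by
          exact_mod_cast Finset.card_le_card fun b hb => by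
            simp only [Finset.mem_filter, Finset.mem_range, Finset.mem_Icc] at hb ⊢
            omega
      _ ≤ ξ.depth + 1 := by
          rw [Nat.card_Icc]
          have : j + 1 - (j - ξ.depth) ≤ ξ.depth + 1 := by omega
          exact_mod_cast this
  have hr0 : ∀ j, 0 ≤ rr j := fun j => by
    rw [hr]
    exact Finset.sum_nonneg fun b _ => by
      split
      exacts [hT0 b, le_rfl]
  have hr1 : ∀ j, rr j ≤ ξ.depth + 1 := fun j => by
    refine le_trans ?_ (hΦ1 j)
    rw [hr]
    refine Finset.sum_le_sum fun b _ => ?_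
    by_cases ha : Alive w b ξ (j - b)
    · simp only [ha, true_and, if_true]
      split
      exacts [le_rfl, hT0 b]
    · simp [ha]
  have hD : (0 : ℝ) ≤ ξ.depth := Nat.cast_nonneg _
  have key : lr e rr = lr e T := by
    refine le_antisymm
      (lr_le_lr (K := ξ.depth + 1) (C := 1) hr0 hr1 hT0 (fun j => (hT1 j).trans (by linarith)) ?_ e)
      (lr_le_lr (K := ξ.depth + 1) (C := ξ.depth + 1) hT0 (fun j => (hT1 j).trans (by linarith))
        hr0 hr1 ?_ e)
    all_goals
      intro i
      have h1 := hsum i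
      have h2 := hΦ0 i
      have h3 := hΦ1 i
      have h4 := hT0 i
      have h5 := hT1 i
      linarith
  rw [← key]
  rfl

/-! ### Soundness -/

/-- `TR` is monotone in the values of the assumptions and sets `U`-formulae to false, so once all
assumptions are true it can only underestimate truth. -/
theorem sat_of_TR {w : Word Ap} {J : ℕ} (hJ : ∀ χ ∈ R, ∀ j ≥ J, Sat (suffix w j) χ)
    (φ : Formula Ap) : ∀ j ≥ J, TR R (suffix w j) φ → Sat (suffix w j) φ := by
  induction φ with
  | and φ ψ ih₁ ih₂ => exact fun j hj h => ⟨ih₁ j hj h.1, ih₂ j hj h.2⟩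
  | or φ ψ ih₁ ih₂ => exact fun j hj h => h.imp (ih₁ j hj) (ih₂ j hj)
  | X φ ih =>
    intro j hj h
    simp only [TR, Sat, suffix_suffix] at h ⊢
    exact ih (j + 1) (by omega) h
  | F φ => exact fun j hj h => hJ _ h j hj
  | G φ => exact fun j hj h => hJ _ h j hj
  | freq e c p φ => exact fun j hj h => hJ _ h j hj
  | U φ ψ => exact fun _ _ h => h.elim
  | _ => exact fun j _ h => h

/-- If the slaves of the elements of `R` accept, then the assumptions in `R` are eventually true. -/
theorem eventually_sat_of_TR (hR : ∀ χ ∈ R, χ.isRec = true) {w : Word Ap}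
    (hacc : ∀ χ ∈ R, (slaveAcc (BFun.mk '' R) χ).Holds (fun j => slaveRun w j χ)) (φ : Formula Ap) :
    ∀ᶠ j in atTop, TR R (suffix w j) φ → Sat (suffix w j) φ := by
  induction φ with
  | and φ ψ ih₁ ih₂ =>
    filter_upwards [ih₁, ih₂] with j h₁ h₂ h
    exact ⟨h₁ h.1, h₂ h.2⟩
  | or φ ψ ih₁ ih₂ =>
    filter_upwards [ih₁, ih₂] with j h₁ h₂ h
    exact h.imp h₁ h₂
  | X φ ih =>
    filter_upwards [(tendsto_add_atTop_nat 1).eventually ih] with j h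
    simpa only [TR, Sat, suffix_suffix] using h
  | F φ ih =>
    by_cases h : Formula.F φ ∈ R
    -- The slave only guarantees `TR` of the body at infinitely many positions; the induction
    -- hypothesis for the body turns this into satisfaction at late ones. So assumptions that
    -- support each other cause no circularity.
    · have h1 := (slaveAcc_F_iff hR w φ).1 (hacc _ h)
      refine Eventually.of_forall fun j _ => ?_
      obtain ⟨J, hJ⟩ := eventually_atTop.1 ih
      obtain ⟨b, hb, hlt⟩ := h1.exists_gt (max j J)
      refine ⟨b - j, ?_⟩
      rw [suffix_suffix, show j + (b - j) = b by omega]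
      exact hJ b (by omega) hb
    · exact Eventually.of_forall fun j hj => absurd hj h
  | G φ ih =>
    by_cases h : Formula.G φ ∈ R
    · have h1 := (slaveAcc_G_iff hR w φ).1 (hacc _ h)
      obtain ⟨B, hB⟩ := h1.bddAbove
      obtain ⟨J, hJ⟩ := eventually_atTop.1 ih
      filter_upwards [eventually_ge_atTop J, eventually_gt_atTop B] with j hj hb _
      intro k
      rw [suffix_suffix]
      refine hJ _ (by omega) ?_
      by_contra hn
      have := hB hn
      omega
    · exact Eventually.of_forall fun j hj => absurd hj h
  | freq e c p φ ih =>
    by_cases h : Formula.freq e c p φ ∈ R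
    · have h1 := (slaveAcc_freq_iff hR w φ e c p).1 (hacc _ h)
      exact Eventually.of_forall fun j _ => (sat_freq_suffix j).2 (sat_freq.2
        (h1.mono (lr_ind_mono ih e)))
    · exact Eventually.of_forall fun j hj => absurd hj h
  | U φ ψ => exact Eventually.of_forall fun _ h => h.elim
  | _ => exact Eventually.of_forall fun j h => h

open Formula Classical in
-- `TR` already treats the elements of `Y` as false, so a formula true under `TR` does not rely on
-- them and survives the substitution.
theorem psat_substFF_of_TR {w : Word Ap} (hw : ∀ φ, TR R w φ → Sat w φ) {Y : Set (Formula Ap)}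
    (hY : ∀ χ ∈ Y, χ.isRec = true ∧ χ ∉ R) (φ : Formula Ap) (h : TR R w φ) :
    PSat (Sat w) (φ.substFF Y) := by
  have hvar : ∀ φ : Formula Ap, TR R w φ → PSat (Sat w) (if φ ∈ Y then .ff else φ) := by
    intro φ h
    split
    · next hφ => exact absurd ((TR_of_isRec (hY φ hφ).1 w).1 h) (hY φ hφ).2
    · exact (psat_sat w φ).2 (hw φ h)
  induction φ with
  | and φ ψ ih₁ ih₂ => exact ⟨ih₁ h.1, ih₂ h.2⟩
  | or φ ψ ih₁ ih₂ => exact h.imp ih₁ ih₂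
  | tt => trivial
  | ff => exact h
  | _ => exact hvar _ h

/-- A time `i` is chosen at which the assumptions are true from then on, the master formula is
provable, and all living tokens of the accepting `G`-slaves are good. The assignment given by the
suffix at `i` satisfies the premises, hence the master formula, and `sat_after` carries this back to
`φ`. -/
theorem sound (φ : Formula Ap) (w : Word Ap) (h : w ∈ (automaton φ).language) : Sat w φ := by
  obtain ⟨R, hRφ, hm, hs⟩ := (mem_language_iff φ w).1 h
  have hR : ∀ χ ∈ (R : Set (Formula Ap)), χ.isRec = true := fun χ hχ => isRec_of_mem_recs (hRφ hχ)
  have hev : ∀ᶠ j in atTop, ∀ χ ∈ R, Sat (suffix w j) χ := by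
    rw [eventually_all_finset]
    intro χ hχ
    filter_upwards [eventually_sat_of_TR hR hs χ] with j hj
    exact hj ((TR_of_isRec (hR χ hχ) _).2 hχ)
  obtain ⟨J, hJ⟩ := eventually_atTop.1 hev
  have hTR := sat_of_TR (R := (R : Set (Formula Ap))) (w := w) (J := J) (fun χ hχ j hj => hJ j hj χ hχ)
  -- The tokens present at time `i` were born at some `b` with `i ≤ b + ξ.depth`, so late enough
  -- they were all born after the last bad position.
  have hG : ∀ᶠ i in atTop, ∀ χ ∈ R, ∀ ξ, χ = .G ξ → ∀ b, i ≤ b + ξ.depth → TR R (suffix w b) ξ := by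
    rw [eventually_all_finset]
    intro χ hχ
    by_cases hξ : ∃ ξ, χ = .G ξ
    · obtain ⟨ξ, rfl⟩ := hξ
      obtain ⟨B, hB⟩ := ((slaveAcc_G_iff hR w ξ).1 (hs _ hχ)).bddAbove
      filter_upwards [eventually_gt_atTop (B + ξ.depth)] with i hi ξ' hξ' b hb
      cases hξ'
      by_contra hn
      have := hB hn
      omega
    · exact Eventually.of_forall fun i ξ hξ' => absurd ⟨ξ, hξ'⟩ hξ
  have hfin : ∀ᶠ i in atTop, BFun.Proves (extendedAssumptions φ R (prodRun φ w i).2)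
      (.mk (after w 0 φ i)) := by
    obtain ⟨B, hB⟩ := (show Set.Finite _ from hm).bddAbove
    filter_upwards [eventually_gt_atTop B] with i hi
    by_contra hn
    have : i ≤ B := hB hn
    omega
  obtain ⟨i, hi, hp, hGi⟩ := ((eventually_ge_atTop J).and (hfin.and hG)).exists
  have hsat := hp (Sat (suffix w i)) ?_
  · rw [BFun.holds_mk, psat_sat] at hsat
    have := sat_after w 0 φ i
    rw [zero_add, suffix_zero] at this
    exact this.1 hsat
  · rintro _ (⟨χ, hχ, rfl⟩ | ⟨χ, hχ, ψ, hψ, rfl⟩)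
    · exact (psat_sat _ _).2 (hJ i hi χ hχ)
    · obtain ⟨χ, hχφ⟩ := χ
      cases χ with
      | G ξ =>
        obtain ⟨b, hb, ha, rfl⟩ := (show ψ ∈ tokenSet ξ w i from hψ)
        have h1 := hGi _ hχ ξ rfl b (by have := ha.le_depth; omega)
        rw [← TR_token w b ξ (i - b), Nat.add_sub_cancel' hb] at h1
        exact psat_substFF_of_TR (fun φ => hTR φ i hi)
          (fun θ hθ => ⟨isRec_of_mem_recs hθ.1, hθ.2⟩) _ h1
      | _ => exact hψ.elim

/-! ### Completeness -/

/-! ### Unfolding along a word. -/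

section After

/-- `after` is defined by its last step; the inductions on formulae need to split off the first one.
-/
theorem after_succ (w : Word Ap) (k : ℕ) (φ : Formula Ap) (d : ℕ) :
    after w k φ (d + 1) = after w (k + 1) (φ.unf.next (w k)) d := by
  induction d with
  | zero => rfl
  | succ d ih => rw [after, ih, after, show k + (d + 1) = k + 1 + d by omega]

theorem token_succ (w : Word Ap) (k : ℕ) (φ : Formula Ap) (d : ℕ) :
    token w k φ (d + 1) = token w (k + 1) (φ.next (w k)) d := by
  induction d with
  | zero => rfl
  | succ d ih => rw [token, ih, token, show k + (d + 1) = k + 1 + d by omega]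

theorem after_tt (w : Word Ap) (k d : ℕ) : after w k .tt d = .tt := by
  induction d with
  | zero => rfl
  | succ d ih => rw [after, ih]; rfl

theorem after_and (w : Word Ap) (k : ℕ) (φ ψ : Formula Ap) (d : ℕ) :
    after w k (.and φ ψ) d = .and (after w k φ d) (after w k ψ d) := by
  induction d with
  | zero => rfl
  | succ d ih => rw [after, ih]; rfl

theorem after_or (w : Word Ap) (k : ℕ) (φ ψ : Formula Ap) (d : ℕ) :
    after w k (.or φ ψ) d = .or (after w k φ d) (after w k ψ d) := by
  induction d with
  | zero => rfl
  | succ d ih => rw [after, ih]; rfl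

theorem token_and (w : Word Ap) (k : ℕ) (φ ψ : Formula Ap) (d : ℕ) :
    token w k (.and φ ψ) d = .and (token w k φ d) (token w k ψ d) := by
  induction d with
  | zero => rfl
  | succ d ih => rw [token, ih]; rfl

theorem token_or (w : Word Ap) (k : ℕ) (φ ψ : Formula Ap) (d : ℕ) :
    token w k (.or φ ψ) d = .or (token w k φ d) (token w k ψ d) := by
  induction d with
  | zero => rfl
  | succ d ih => rw [token, ih]; rfl

theorem token_of_depth (w : Word Ap) (k : ℕ) {φ : Formula Ap} (h : φ.depth = 0) (d : ℕ) :
    token w k φ d = φ := by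
  induction d with
  | zero => rfl
  | succ d ih => rw [token, ih, Formula.next_of_depth h]

/-- Iterated, the unfolding of `F φ` over `d` steps from `k` is the disjunction of the unfoldings of
`φ` from `k`, …, `k + d - 1` and of `F φ` itself. The following equations for `G`, `U` and the
frequency operators are used in the same manner. -/
theorem after_F_succ (w : Word Ap) (k : ℕ) (φ : Formula Ap) (d : ℕ) :
    after w k (.F φ) (d + 1) = .or (after w k φ (d + 1)) (after w (k + 1) (.F φ) d) := by
  rw [after_succ, after_succ, Formula.unf, Formula.next, after_or]; rfl

theorem after_G_succ (w : Word Ap) (k : ℕ) (φ : Formula Ap) (d : ℕ) :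
    after w k (.G φ) (d + 1) = .and (after w k φ (d + 1)) (after w (k + 1) (.G φ) d) := by
  rw [after_succ, after_succ, Formula.unf, Formula.next, after_and]; rfl

theorem after_U_succ (w : Word Ap) (k : ℕ) (φ ψ : Formula Ap) (d : ℕ) :
    after w k (.U φ ψ) (d + 1) =
      .or (after w k ψ (d + 1)) (.and (after w k φ (d + 1)) (after w (k + 1) (.U φ ψ) d)) := by
  rw [after_succ, after_succ, after_succ, Formula.unf, Formula.next, Formula.next, after_or,
    after_and]; rfl

theorem after_freq_succ (w : Word Ap) (k : ℕ) (e : Ext) (c : Cmp) (p : Set.Icc (0 : ℚ) 1)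
    (φ : Formula Ap) (d : ℕ) :
    after w k (.freq e c p φ) (d + 1) = .and .tt (after w (k + 1) (.freq e c p φ) d) := by
  rw [after_succ, Formula.unf, Formula.next, after_and]
  exact congrArg (Formula.and · _) (after_tt w (k + 1) d)

open Formula

variable {V : Formula Ap → Prop} {w : Word Ap}

theorem psat_after_F {φ : Formula Ap} (hV : V (.F φ)) (k d : ℕ) : PSat V (after w k (.F φ) d) := by
  induction d generalizing k with
  | zero => exact hV
  | succ d ih => rw [after_F_succ]; exact .inr (ih _)

theorem psat_after_F_of {φ : Formula Ap} {e d : ℕ} (k : ℕ) (he : e < d)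
    (h : PSat V (after w (k + e) φ (d - e))) : PSat V (after w k (.F φ) d) := by
  induction e generalizing k d with
  | zero =>
    obtain ⟨d, rfl⟩ : ∃ d', d = d' + 1 := ⟨d - 1, by omega⟩
    rw [after_F_succ]; exact .inl h
  | succ e ih =>
    obtain ⟨d, rfl⟩ : ∃ d', d = d' + 1 := ⟨d - 1, by omega⟩
    rw [after_F_succ]
    refine .inr (ih (k + 1) (by omega) ?_)
    rwa [show k + 1 + e = k + (e + 1) by omega, show d - e = d + 1 - (e + 1) by omega]

theorem psat_after_U_of {φ ψ : Formula Ap} {e d : ℕ} (k : ℕ) (he : e < d)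
    (h : PSat V (after w (k + e) ψ (d - e))) (h' : ∀ f < e, PSat V (after w (k + f) φ (d - f))) :
    PSat V (after w k (.U φ ψ) d) := by
  induction e generalizing k d with
  | zero =>
    obtain ⟨d, rfl⟩ : ∃ d', d = d' + 1 := ⟨d - 1, by omega⟩
    rw [after_U_succ]; exact .inl h
  | succ e ih =>
    obtain ⟨d, rfl⟩ : ∃ d', d = d' + 1 := ⟨d - 1, by omega⟩
    rw [after_U_succ]
    refine .inr ⟨by simpa using h' 0 (by omega), ih (k + 1) (by omega) ?_ fun f hf => ?_⟩
    · rwa [show k + 1 + e = k + (e + 1) by omega, show d - e = d + 1 - (e + 1) by omega]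
    · have := h' (f + 1) (by omega)
      rwa [show k + 1 + f = k + (f + 1) by omega, show d - f = d + 1 - (f + 1) by omega]

theorem psat_after_G {φ : Formula Ap} (hV : V (.G φ)) (k d : ℕ)
    (h : ∀ e < d, PSat V (after w (k + e) φ (d - e))) : PSat V (after w k (.G φ) d) := by
  induction d generalizing k with
  | zero => exact hV
  | succ d ih =>
    rw [after_G_succ]
    refine ⟨h 0 (by omega), ih _ fun e he => ?_⟩
    have := h (e + 1) (by omega)
    rwa [show k + 1 + e = k + (e + 1) by omega, show d - e = d + 1 - (e + 1) by omega]

theorem psat_after_freq {e : Ext} {c : Cmp} {p : Set.Icc (0 : ℚ) 1} {φ : Formula Ap}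
    (hV : V (.freq e c p φ)) (k d : ℕ) : PSat V (after w k (.freq e c p φ) d) := by
  induction d generalizing k with
  | zero => exact hV
  | succ d ih => rw [after_freq_succ]; exact ⟨trivial, ih _⟩

end After

open Formula

namespace Formula

theorem self_mem_subformulas (φ : Formula Ap) : φ ∈ φ.subformulas := by
  cases φ <;> simp [subformulas]

theorem subformulas_trans {φ ψ χ : Formula Ap} (h : ψ ∈ φ.subformulas) (h' : χ ∈ ψ.subformulas) :
    χ ∈ φ.subformulas := by
  induction φ with
  | and φ₁ φ₂ ih₁ ih₂ | or φ₁ φ₂ ih₁ ih₂ | U φ₁ φ₂ ih₁ ih₂ =>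
    simp only [subformulas, List.mem_cons, List.mem_append] at h ⊢
    rcases h with rfl | h | h
    · simpa [subformulas] using h'
    · exact .inr (.inl (ih₁ h))
    · exact .inr (.inr (ih₂ h))
  | X φ ih | F φ ih | G φ ih | freq e c p φ ih =>
    simp only [subformulas, List.mem_cons] at h ⊢
    rcases h with rfl | h
    · simpa [subformulas] using h'
    · exact .inr (ih h)
  | _ =>
    simp only [subformulas, List.mem_singleton] at h
    subst h
    exact h'

theorem UFree.noUUnderG {φ : Formula Ap} (h : φ.UFree) : φ.NoUUnderG := by
  induction φ with
  | and φ ψ ih₁ ih₂ | or φ ψ ih₁ ih₂ => exact ⟨ih₁ h.1, ih₂ h.2⟩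
  | U => exact h.elim
  | X φ ih | F φ ih => exact ih h
  | _ => exact h

end Formula

/-- An `F`-formula either holds everywhere, and then belongs to `R`, or is false from some point on.
A `G`-formula that holds once holds from there on, and a frequency formula holds everywhere or
nowhere. So whatever holds late enough holds almost always and is in `R`. -/
theorem eventually_TR_of_sat {φ : Formula Ap} {w : Word Ap}
    (hR : ∀ χ ∈ φ.recs, χ.UFree → (∀ᶠ j in atTop, Sat (suffix w j) χ) → χ ∈ R)
    (ψ : Formula Ap) (hψ : ψ.UFree) (hsub : ψ ∈ φ.subformulas) :
    ∀ᶠ j in atTop, Sat (suffix w j) ψ → TR R (suffix w j) ψ := by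
  induction ψ with
  | and ψ₁ ψ₂ ih₁ ih₂ =>
    filter_upwards [ih₁ hψ.1 (subformulas_trans hsub (by simp [subformulas, self_mem_subformulas])),
      ih₂ hψ.2 (subformulas_trans hsub (by simp [subformulas, self_mem_subformulas]))] with j h₁ h₂ h
    exact ⟨h₁ h.1, h₂ h.2⟩
  | or ψ₁ ψ₂ ih₁ ih₂ =>
    filter_upwards [ih₁ hψ.1 (subformulas_trans hsub (by simp [subformulas, self_mem_subformulas])),
      ih₂ hψ.2 (subformulas_trans hsub (by simp [subformulas, self_mem_subformulas]))] with j h₁ h₂ h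
    exact h.imp h₁ h₂
  | X ψ ih =>
    filter_upwards [(tendsto_add_atTop_nat 1).eventually
      (ih hψ (subformulas_trans hsub (by simp [subformulas, self_mem_subformulas])))] with j h
    simpa only [TR, Sat, suffix_suffix] using h
  | F ψ =>
    by_cases hev : ∀ j, Sat (suffix w j) (.F ψ)
    · exact Eventually.of_forall fun j _ => hR _ (mem_recs.2 ⟨hsub, rfl⟩) hψ (Eventually.of_forall hev)
    · push Not at hev
      obtain ⟨J, hJ⟩ := hev
      filter_upwards [eventually_ge_atTop J] with j hj h
      obtain ⟨k, hk⟩ := h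
      refine absurd ⟨j - J + k, ?_⟩ hJ
      rw [suffix_suffix] at hk ⊢
      rwa [show J + (j - J + k) = j + k by omega]
  | G ψ =>
    refine Eventually.of_forall fun j hj => hR _ (mem_recs.2 ⟨hsub, rfl⟩) hψ ?_
    filter_upwards [eventually_ge_atTop j] with i hi k
    have := hj (i - j + k)
    rw [suffix_suffix] at this ⊢
    rwa [show i + k = j + (i - j + k) by omega]
  | freq e c p ψ =>
    refine Eventually.of_forall fun j hj => hR _ (mem_recs.2 ⟨hsub, rfl⟩) hψ ?_
    exact Eventually.of_forall fun i => (sat_freq_suffix i).2 ((sat_freq_suffix j).1 hj)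
  | U => exact hψ.elim
  | _ => exact Eventually.of_forall fun j h => h

/-! ### Provability of the master formula on words that satisfy the formula. -/

section Master

variable {φ : Formula Ap} {R : Finset (Formula Ap)} {w : Word Ap} {J i : ℕ} {V : Formula Ap → Prop}

theorem assumption_holds (hRφ : R ⊆ φ.recs)
    (hV : ∀ β ∈ extendedAssumptions φ R (prodRun φ w i).2, BFun.Holds V β) {χ : Formula Ap}
    (hχ : χ ∈ R) : V χ :=
  (psat_of_isRec (isRec_of_mem_recs (hRφ hχ))).1 (hV _ (.inl ⟨χ, hχ, rfl⟩))

/-- If the token is still alive at time `i`, it is among the extended assumptions. Otherwise it has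
ended in a sink which `R` proves because `l` is a good birth position, and the substitution leaves
the elements of `R` untouched. -/
theorem token_holds (hRφ : R ⊆ φ.recs)
    (hG : ∀ ξ, .G ξ ∈ R → ∀ b ≥ J, TR (R : Set (Formula Ap)) (suffix w b) ξ)
    (hV : ∀ β ∈ extendedAssumptions φ R (prodRun φ w i).2, BFun.Holds V β) {ψ : Formula Ap}
    (hψ : .G ψ ∈ R) {l : ℕ} (hJ : J ≤ l) (hl : l ≤ i) :
    PSat V ((token w l ψ (i - l)).substFF {θ | θ ∈ φ.recs ∧ θ ∉ R}) := by
  have hR : ∀ χ ∈ (R : Set (Formula Ap)), χ.isRec = true := fun χ hχ => isRec_of_mem_recs (hRφ hχ)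
  by_cases ha : Alive w l ψ (i - l)
  · exact hV _ (.inr ⟨⟨_, hRφ hψ⟩, hψ, _, ⟨l, hl, ha, rfl⟩, rfl⟩)
  · simp only [Alive, not_forall, not_not] at ha
    obtain ⟨e, he, hs⟩ := ha
    have h1 := (proves_token_iff hR hs).2 (hG ψ hψ l hJ)
    rw [← mk_token_of_isSink he.le hs, BFun.proves_iff hR] at h1
    rw [← BFun.holds_mk, show BFun.mk (Formula.substFF _ _) =
      BFun.substFF _ (BFun.mk (token w l ψ (i - l))) from rfl, BFun.holds_substFF]
    refine h1.mono fun χ hχ => ?_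
    have hχV := assumption_holds hRφ hV hχ
    have hmem : χ ∉ ({θ | θ ∈ φ.recs ∧ θ ∉ R} : Set (Formula Ap)) := fun h => h.2 hχ
    have hrec := hR χ hχ
    cases χ <;> first | (simp only [substFF, if_neg hmem]; exact hχV) | cases hrec

/-- Token and unfolding treat literals and `X` alike; they differ in that the token keeps `F`-, `G`-
and frequency formulae frozen. Those surviving the substitution are in `R` and true. For `F` and
frequency formulae this already makes the unfolding true; for `G ψ` the unfoldings of `ψ` from all
later positions are needed, which the tokens of the slave of `G ψ` provide by induction. -/
theorem psat_after_of_token (hRφ : R ⊆ φ.recs)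
    (hG : ∀ ξ, .G ξ ∈ R → ∀ b ≥ J, TR (R : Set (Formula Ap)) (suffix w b) ξ)
    (hV : ∀ β ∈ extendedAssumptions φ R (prodRun φ w i).2, BFun.Holds V β) (ψ : Formula Ap)
    (hψ : ψ.UFree) (hsub : ψ ∈ φ.subformulas) : ∀ l, J ≤ l → l ≤ i →
    PSat V ((token w l ψ (i - l)).substFF {θ | θ ∈ φ.recs ∧ θ ∉ R}) →
    PSat V (after w l ψ (i - l)) := by
  have hrec : ∀ χ ∈ φ.subformulas, χ.isRec = true →
      χ ∉ ({θ | θ ∈ φ.recs ∧ θ ∉ R} : Set (Formula Ap)) → χ ∈ R := fun χ h h' hn => by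
    by_contra hR
    exact hn ⟨mem_recs.2 ⟨h, h'⟩, hR⟩
  have hnrec : ∀ χ : Formula Ap, χ.isRec = false →
      χ ∉ ({θ | θ ∈ φ.recs ∧ θ ∉ R} : Set (Formula Ap)) := fun χ h h' => by
    rw [isRec_of_mem_recs h'.1] at h; cases h
  induction ψ with
  | tt => intro l _ _ _; rw [after_tt]; trivial
  | ff => intro l _ _ h; rw [token_of_depth _ _ rfl] at h; exact h.elim
  | atom a | natom a =>
    intro l _ _ h
    -- If no letter has been read since `l`, token and unfolding are still the literal itself, which
    -- is not affected by the substitution.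
    rcases Nat.eq_zero_or_pos (i - l) with h0 | h0
    · rw [h0] at h ⊢
      simp only [token, substFF] at h
      split at h
      · next hm => exact absurd hm (hnrec _ rfl)
      · exact h
    · obtain ⟨d, hd⟩ : ∃ d, i - l = d + 1 := ⟨i - l - 1, by omega⟩
      rw [hd] at h ⊢
      rw [token_succ] at h
      rw [after_succ]
      simp only [unf, next] at h ⊢
      split at h
      all_goals
        rw [token_of_depth _ _ rfl] at h
        simp only [*, if_true, if_false]
        first | exact h.elim | (rw [after_tt]; trivial)
  | and ψ₁ ψ₂ ih₁ ih₂ =>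
    intro l hJ hl h
    rw [token_and] at h
    rw [after_and]
    exact ⟨ih₁ hψ.1 (subformulas_trans hsub (by simp [subformulas, self_mem_subformulas])) l hJ hl h.1,
      ih₂ hψ.2 (subformulas_trans hsub (by simp [subformulas, self_mem_subformulas])) l hJ hl h.2⟩
  | or ψ₁ ψ₂ ih₁ ih₂ =>
    intro l hJ hl h
    rw [token_or] at h
    rw [after_or]
    exact h.imp
      (ih₁ hψ.1 (subformulas_trans hsub (by simp [subformulas, self_mem_subformulas])) l hJ hl)
      (ih₂ hψ.2 (subformulas_trans hsub (by simp [subformulas, self_mem_subformulas])) l hJ hl)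
  | X ψ ih =>
    intro l hJ hl h
    rcases Nat.eq_zero_or_pos (i - l) with h0 | h0
    · rw [h0] at h ⊢
      simp only [token, substFF] at h
      split at h
      · next hm => exact absurd hm (hnrec _ rfl)
      · exact h
    · have hd : i - l = i - (l + 1) + 1 := by omega
      rw [hd] at h ⊢
      rw [token_succ] at h
      rw [after_succ]
      exact ih hψ (subformulas_trans hsub (by simp [subformulas, self_mem_subformulas])) (l + 1)
        (by omega) (by omega) h
  | F ψ =>
    intro l _ _ h
    rw [token_of_depth _ _ rfl] at h
    simp only [substFF] at h
    split at h
    · exact h.elim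
    · next hn => exact psat_after_F (assumption_holds hRφ hV (hrec _ hsub rfl hn)) _ _
  | G ψ ih =>
    intro l hJ hl h
    rw [token_of_depth _ _ rfl] at h
    simp only [substFF] at h
    split at h
    · exact h.elim
    · next hn =>
      have hR := hrec _ hsub rfl hn
      refine psat_after_G (assumption_holds hRφ hV hR) _ _ fun e he => ?_
      rw [show i - l - e = i - (l + e) by omega]
      exact ih hψ (subformulas_trans hsub (by simp [subformulas, self_mem_subformulas])) _ (by omega)
        (by omega) (token_holds hRφ hG hV hR (by omega) (by omega))
  | freq e c p ψ =>
    intro l _ _ h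
    rw [token_of_depth _ _ rfl] at h
    simp only [substFF] at h
    split at h
    · exact h.elim
    · next hn => exact psat_after_freq (assumption_holds hRφ hV (hrec _ hsub rfl hn)) _ _
  | U => exact hψ.elim

/-- An `F`- or `U`-formula is discharged once the unfoldings up to its witness have become provable.
A true `G`- or frequency formula is in `R`, and for `G ψ` all but finitely many unfoldings of `ψ`
are covered by tokens. -/
theorem eventually_psat_after (hRφ : R ⊆ φ.recs)
    (hG : ∀ ξ, .G ξ ∈ R → ∀ b ≥ J, TR (R : Set (Formula Ap)) (suffix w b) ξ)
    (hR : ∀ χ ∈ φ.recs, χ.UFree → (∀ᶠ j in atTop, Sat (suffix w j) χ) → χ ∈ R)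
    (ψ : Formula Ap) (hψ : ψ.NoUUnderG) (hsub : ψ ∈ φ.subformulas) :
    ∀ k, Sat (suffix w k) ψ → ∀ᶠ i in atTop, ∀ V : Formula Ap → Prop,
      (∀ β ∈ extendedAssumptions φ R (prodRun φ w i).2, BFun.Holds V β) →
        PSat V (after w k ψ (i - k)) := by
  induction ψ with
  | tt => exact fun k _ => Eventually.of_forall fun i V _ => by rw [after_tt]; trivial
  | ff => exact fun k h => h.elim
  | atom a | natom a =>
    intro k h
    filter_upwards [eventually_gt_atTop k] with i hi V _
    simp only [Sat, suffix_apply_zero] at h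
    obtain ⟨d, hd⟩ : ∃ d, i - k = d + 1 := ⟨i - k - 1, by omega⟩
    rw [hd, after_succ]
    simp only [unf, next, h, if_true, if_false]
    rw [after_tt]; trivial
  | and ψ₁ ψ₂ ih₁ ih₂ =>
    intro k h
    filter_upwards [
      ih₁ hψ.1 (subformulas_trans hsub (by simp [subformulas, self_mem_subformulas])) k h.1,
      ih₂ hψ.2 (subformulas_trans hsub (by simp [subformulas, self_mem_subformulas])) k h.2]
      with i h₁ h₂ V hV
    rw [after_and]
    exact ⟨h₁ V hV, h₂ V hV⟩
  | or ψ₁ ψ₂ ih₁ ih₂ =>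
    intro k h
    rcases h with h | h
    · filter_upwards [
        ih₁ hψ.1 (subformulas_trans hsub (by simp [subformulas, self_mem_subformulas])) k h]
        with i h₁ V hV
      rw [after_or]
      exact .inl (h₁ V hV)
    · filter_upwards [
        ih₂ hψ.2 (subformulas_trans hsub (by simp [subformulas, self_mem_subformulas])) k h]
        with i h₂ V hV
      rw [after_or]
      exact .inr (h₂ V hV)
  | X ψ ih =>
    intro k h
    simp only [Sat, suffix_suffix] at h
    filter_upwards [ih hψ (subformulas_trans hsub (by simp [subformulas, self_mem_subformulas])) _ h,
      eventually_gt_atTop k] with i hi hk V hV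
    rw [show i - k = i - (k + 1) + 1 by omega, after_succ]
    exact hi V hV
  | F ψ ih =>
    rintro k ⟨e, he⟩
    rw [suffix_suffix] at he
    filter_upwards [ih hψ (subformulas_trans hsub (by simp [subformulas, self_mem_subformulas])) _ he,
      eventually_gt_atTop (k + e)] with i hi hk V hV
    refine psat_after_F_of k (e := e) (by omega) ?_
    rw [show i - k - e = i - (k + e) by omega]
    exact hi V hV
  | U ψ₁ ψ₂ ih₁ ih₂ =>
    rintro k ⟨e, he, hlt⟩
    rw [suffix_suffix] at he
    have hall : ∀ᶠ i in atTop, ∀ f ∈ Finset.range e, ∀ V : Formula Ap → Prop,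
        (∀ β ∈ extendedAssumptions φ R (prodRun φ w i).2, BFun.Holds V β) →
        PSat V (after w (k + f) ψ₁ (i - (k + f))) := by
      rw [eventually_all_finset]
      intro f hf
      have := hlt f (Finset.mem_range.1 hf)
      rw [suffix_suffix] at this
      exact ih₁ hψ.1 (subformulas_trans hsub (by simp [subformulas, self_mem_subformulas])) _ this
    filter_upwards [hall,
      ih₂ hψ.2 (subformulas_trans hsub (by simp [subformulas, self_mem_subformulas])) _ he,
      eventually_gt_atTop (k + e)] with i h₁ h₂ hk V hV
    refine psat_after_U_of k (e := e) (by omega) ?_ fun f hf => ?_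
    · rw [show i - k - e = i - (k + e) by omega]
      exact h₂ V hV
    · rw [show i - k - f = i - (k + f) by omega]
      exact h₁ f (Finset.mem_range.2 hf) V hV
  | G ψ ih =>
    intro k h
    have hsub' := subformulas_trans hsub (show ψ ∈ (Formula.G ψ).subformulas by
      simp [subformulas, self_mem_subformulas])
    have hmem : Formula.G ψ ∈ R := by
      refine hR _ (mem_recs.2 ⟨hsub, rfl⟩) hψ ?_
      filter_upwards [eventually_ge_atTop k] with i hi l
      have := h (i - k + l)
      rw [suffix_suffix] at this ⊢
      rwa [show i + l = k + (i - k + l) by omega]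
    -- The first `J` unfoldings of `ψ` may start before the tokens are known to be good, so the
    -- induction hypothesis is used for them; from `e = J` on the start `k + e` is at least `J`.
    have hall : ∀ᶠ i in atTop, ∀ e ∈ Finset.range J, ∀ V : Formula Ap → Prop,
        (∀ β ∈ extendedAssumptions φ R (prodRun φ w i).2, BFun.Holds V β) →
        PSat V (after w (k + e) ψ (i - (k + e))) := by
      rw [eventually_all_finset]
      intro e _
      have := h e
      rw [suffix_suffix] at this
      exact ih (UFree.noUUnderG hψ) hsub' _ this
    filter_upwards [hall] with i hi V hV
    refine psat_after_G (assumption_holds hRφ hV hmem) _ _ fun e he => ?_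
    rw [show i - k - e = i - (k + e) by omega]
    by_cases heJ : e < J
    · exact hi e (Finset.mem_range.2 heJ) V hV
    · exact psat_after_of_token hRφ hG hV ψ hψ hsub' _ (by omega) (by omega)
        (token_holds hRφ hG hV hmem (by omega) (by omega))
  | freq e c p ψ =>
    intro k h
    have hmem : Formula.freq e c p ψ ∈ R := hR _ (mem_recs.2 ⟨hsub, rfl⟩) hψ
      (Eventually.of_forall fun i => (sat_freq_suffix i).2 ((sat_freq_suffix k).1 h))
    exact Eventually.of_forall fun i V hV => psat_after_freq (assumption_holds hRφ hV hmem) _ _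

end Master

open Classical in
theorem complete {φ : Formula Ap} (hφ : φ.NoUUnderG) {w : Word Ap} (h : Sat w φ) :
    w ∈ (automaton φ).language := by
  -- In the fragment `F`-formulae may contain `U`. Their slaves do not unfold `U` and may reject
  -- even if the formula always holds, so such formulae are left out of `R`.
  set R : Finset (Formula Ap) :=
    φ.recs.filter (fun χ => χ.UFree ∧ ∀ᶠ j in atTop, Sat (suffix w j) χ) with hRdef
  have hRφ : R ⊆ φ.recs := Finset.filter_subset _ _
  have hR : ∀ χ ∈ (R : Set (Formula Ap)), χ.isRec = true := fun χ hχ => isRec_of_mem_recs (hRφ hχ)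
  have hmem : ∀ χ ∈ φ.recs, χ.UFree → (∀ᶠ j in atTop, Sat (suffix w j) χ) → χ ∈ R :=
    fun χ h1 h2 h3 => Finset.mem_filter.2 ⟨h1, h2, h3⟩
  have hTR := eventually_TR_of_sat (R := (R : Set (Formula Ap))) hmem
  have hbody : ∀ χ ∈ R, χ.UFree ∧ χ ∈ φ.subformulas ∧ ∀ᶠ j in atTop, Sat (suffix w j) χ := by
    intro χ hχ
    obtain ⟨h1, h2, h3⟩ := Finset.mem_filter.1 hχ
    exact ⟨h2, (mem_recs.1 h1).1, h3⟩
  have hGev : ∀ χ ∈ R, ∀ᶠ b in atTop, ∀ ξ, χ = .G ξ → TR (R : Set (Formula Ap)) (suffix w b) ξ := by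
    intro χ hχ
    obtain ⟨h1, h2, h3⟩ := hbody χ hχ
    by_cases hξ : ∃ ξ, χ = .G ξ
    · obtain ⟨ξ, rfl⟩ := hξ
      filter_upwards [h3, hTR ξ h1 (subformulas_trans h2 (by simp [subformulas, self_mem_subformulas]))]
        with b hb hb' ξ' hξ'
      cases hξ'
      exact hb' (by simpa [suffix_suffix] using hb 0)
    · exact Eventually.of_forall fun b ξ hξ' => absurd ⟨ξ, hξ'⟩ hξ
  obtain ⟨J, hJ⟩ := eventually_atTop.1 ((eventually_all_finset R).2 hGev)
  refine (mem_language_iff φ w).2 ⟨R, hRφ, ?_, fun χ hχ => ?_⟩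
  · have hev := eventually_psat_after hRφ (J := J) (fun ξ hξ b hb => hJ b hb _ hξ ξ rfl) hmem φ hφ
      (self_mem_subformulas φ) 0 (by rwa [suffix_zero])
    obtain ⟨I, hI⟩ := eventually_atTop.1 hev
    refine (Set.finite_Iio I).subset fun i hi => ?_
    by_contra hn
    exact hi fun V hV => hI i (not_lt.1 hn) V hV
  · obtain ⟨h1, h2, h3⟩ := hbody χ hχ
    have hrec := hR χ hχ
    cases χ with
    | F ξ =>
      refine (slaveAcc_F_iff hR w ξ).2 (Set.infinite_of_forall_exists_gt fun n => ?_)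
      obtain ⟨I, hI⟩ := eventually_atTop.1 (hTR ξ h1
        (subformulas_trans h2 (by simp [subformulas, self_mem_subformulas])))
      obtain ⟨j, hj, hj'⟩ := (h3.and (eventually_gt_atTop (max n I))).exists
      obtain ⟨k, hk⟩ := hj
      rw [suffix_suffix] at hk
      exact ⟨j + k, hI _ (by omega) hk, by omega⟩
    | G ξ =>
      refine (slaveAcc_G_iff hR w ξ).2 ((Set.finite_Iio J).subset fun b hb => ?_)
      by_contra hn
      exact hb (hJ b (not_lt.1 hn) _ hχ ξ rfl)
    | freq e c p ξ =>
      refine (slaveAcc_freq_iff hR w ξ e c p).2 ?_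
      obtain ⟨j, hj⟩ := h3.exists
      exact (sat_freq.1 ((sat_freq_suffix j).1 hj)).mono (lr_ind_mono (hTR ξ h1
        (subformulas_trans h2 (by simp [subformulas, self_mem_subformulas]))) e)
    | _ => cases hrec

end Correctness

end FLTL

namespace FLTL

open Formula

/-! ## Size of the acceptance condition -/

section Size

variable {Ap : Type u}

theorem Formula.length_subformulas_le (φ : Formula Ap) : φ.subformulas.length ≤ φ.length := by
  induction φ <;> simp only [subformulas, Formula.length, List.length_cons, List.length_append,
    List.length_nil] <;> omega

theorem Formula.length_pos (φ : Formula Ap) : 1 ≤ φ.length := by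
  cases φ <;> simp only [Formula.length] <;> omega

open Classical in
theorem card_recs_le (φ : Formula Ap) : φ.recs.card ≤ φ.length :=
  (List.toFinset_card_le _).trans ((List.length_filter_le _ _).trans φ.length_subformulas_le)

theorem acc_size_le (φ : Formula Ap) : (automaton φ).acc.size ≤ 2 ^ (3 * φ.length) := by
  classical
  have h1 : (automaton φ).acc.size = (φ.recs.powerset.toList.map
      (fun R => (clause φ R).length + 1)).sum := by
    change (((φ.recs.powerset.toList.map (clause φ)).map
      (fun C => C.map (AccVar.comap Subtype.val))).map (fun C => C.length + 1)).sum = _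
    simp only [List.map_map, Function.comp_def, List.length_map]
  have h2 : ∀ y ∈ φ.recs.powerset.toList.map (fun R => (clause φ R).length + 1),
      y ≤ φ.length + 2 := by
    intro y hy
    obtain ⟨R, _, rfl⟩ := List.mem_map.1 hy
    have := (Finset.card_filter_le φ.recs.attach (fun χ => χ.1 ∈ R))
    rw [Finset.card_attach] at this
    have h3 := card_recs_le φ
    simp only [clause, List.length_cons, List.length_map, Finset.length_toList]
    refine le_trans (Nat.add_le_add_right (Nat.add_le_add_right (le_trans ?_ this) 1) 1) (by omega)
    exact le_of_eq (by congr)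
  have h3 := List.sum_le_card_nsmul _ _ h2
  rw [List.length_map, Finset.length_toList, Finset.card_powerset, smul_eq_mul] at h3
  rw [h1]
  refine h3.trans ?_
  -- Together with the factor 2^|φ| for the choice of `R` this yields the constant 3.
  have h4 : φ.length + 2 ≤ 2 ^ (2 * φ.length) := by
    have h5 := φ.length_pos
    have h6 : φ.length + 1 < 2 ^ (φ.length + 1) := Nat.lt_two_pow_self
    exact h6.trans_le (Nat.pow_le_pow_right (by omega) (by omega))
  calc 2 ^ φ.recs.card * (φ.length + 2) ≤ 2 ^ φ.length * 2 ^ (2 * φ.length) :=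
        Nat.mul_le_mul (Nat.pow_le_pow_right (by omega) (card_recs_le φ)) h4
    _ = _ := by rw [← pow_add]; congr 1; omega

end Size

/-! ## Boolean functions over the subformulas -/

section Support

variable {Ap : Type u}

/-- The direct subformulas. -/
def Formula.kids : Formula Ap → List (Formula Ap)
  | .and φ ψ | .or φ ψ | .U φ ψ => [φ, ψ]
  | .X φ | .F φ | .G φ | .freq _ _ _ φ => [φ]
  | _ => []

/-- The direct subformulas of each element of the list occur after it. -/
def KidsAfter : List (Formula Ap) → Prop
  | [] => True
  | φ :: l => (∀ ψ ∈ φ.kids, ψ ∈ l) ∧ KidsAfter l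

theorem KidsAfter.append {l m : List (Formula Ap)} (hl : KidsAfter l) (hm : KidsAfter m) :
    KidsAfter (l ++ m) := by
  induction l with
  | nil => exact hm
  | cons φ l ih => exact ⟨fun ψ h => List.mem_append_left _ (hl.1 ψ h), ih hl.2⟩

theorem kidsAfter_subformulas (φ : Formula Ap) : KidsAfter φ.subformulas := by
  induction φ with
  | and φ ψ ih₁ ih₂ | or φ ψ ih₁ ih₂ | U φ ψ ih₁ ih₂ =>
    exact ⟨by simp [kids, self_mem_subformulas], ih₁.append ih₂⟩
  | X φ ih | F φ ih | G φ ih | freq e c p φ ih => exact ⟨by simp [kids, self_mem_subformulas], ih⟩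
  | _ => exact ⟨by simp [kids], trivial⟩

open Classical in
-- `List.dedup` keeps the last occurrence of each element, so direct subformulas remain behind.
theorem KidsAfter.dedup {l : List (Formula Ap)} (hl : KidsAfter l) : KidsAfter l.dedup := by
  induction l with
  | nil => exact hl
  | cons φ l ih =>
    by_cases h : φ ∈ l
    · rw [List.dedup_cons_of_mem h]; exact ih hl.2
    · rw [List.dedup_cons_of_notMem h]
      exact ⟨fun ψ hψ => List.mem_dedup.2 (hl.1 ψ hψ), ih hl.2⟩

theorem KidsAfter.mem_of_suffix {l t : List (Formula Ap)} (hl : KidsAfter l) {φ ψ : Formula Ap}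
    (h : φ :: t <:+ l) (hψ : ψ ∈ φ.kids) : ψ ∈ t := by
  induction l with
  | nil => simp at h
  | cons χ l ih =>
    rcases List.suffix_cons_iff.1 h with h | h
    · injection h with h1 h2
      subst h1 h2
      exact hl.1 ψ hψ
    · exact ih hl.2 h

open Classical in
/-- The distinct subformulas, each before its direct subformulas. -/
noncomputable def subs (φ : Formula Ap) : List (Formula Ap) := φ.subformulas.dedup

open Classical in
theorem mem_subs {φ χ : Formula Ap} : χ ∈ subs φ ↔ χ ∈ φ.subformulas := List.mem_dedup

open Classical in
theorem nodup_subs (φ : Formula Ap) : (subs φ).Nodup := List.nodup_dedup _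

theorem kidsAfter_subs (φ : Formula Ap) : KidsAfter (subs φ) := (kidsAfter_subformulas φ).dedup

open Classical in
theorem length_subs_le (φ : Formula Ap) : (subs φ).length ≤ φ.length :=
  (List.dedup_sublist _).length_le.trans φ.length_subformulas_le

/-- The assignments, as lists of the variables that are true. -/
noncomputable def assigns (φ : Formula Ap) : List (List (Formula Ap)) := (subs φ).sublists'

theorem nodup_assigns (φ : Formula Ap) : (assigns φ).Nodup := List.nodup_sublists'.2 (nodup_subs φ)

theorem filter_mem_assigns (φ : Formula Ap) (p : Formula Ap → Bool) :
    (subs φ).filter p ∈ assigns φ := List.mem_sublists'.2 List.filter_sublist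

/-- The Boolean function depends only on the subformulas of `φ`. -/
def Supp (φ : Formula Ap) (β : BFun Ap) : Prop :=
  ∀ V V' : Formula Ap → Prop, (∀ χ ∈ φ.subformulas, V χ ↔ V' χ) → (β.Holds V ↔ β.Holds V')

theorem psat_congr {V V' : Formula Ap → Prop} {φ : Formula Ap}
    (h : ∀ χ ∈ φ.subformulas, V χ ↔ V' χ) : PSat V φ ↔ PSat V' φ := by
  induction φ with
  | and φ ψ ih₁ ih₂ =>
    exact and_congr (ih₁ fun χ hχ => h χ (by simp [subformulas, hχ]))
      (ih₂ fun χ hχ => h χ (by simp [subformulas, hχ]))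
  | or φ ψ ih₁ ih₂ =>
    exact or_congr (ih₁ fun χ hχ => h χ (by simp [subformulas, hχ]))
      (ih₂ fun χ hχ => h χ (by simp [subformulas, hχ]))
  | tt => exact Iff.rfl
  | ff => exact Iff.rfl
  | _ => exact h _ (self_mem_subformulas _)

theorem psat_next_congr {V V' : Formula Ap → Prop} {φ : Formula Ap} {ν : Set Ap}
    (h : ∀ χ ∈ φ.subformulas, V χ ↔ V' χ) : PSat V (φ.next ν) ↔ PSat V' (φ.next ν) := by
  induction φ with
  | and φ ψ ih₁ ih₂ =>
    exact and_congr (ih₁ fun χ hχ => h χ (by simp [subformulas, hχ]))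
      (ih₂ fun χ hχ => h χ (by simp [subformulas, hχ]))
  | or φ ψ ih₁ ih₂ =>
    exact or_congr (ih₁ fun χ hχ => h χ (by simp [subformulas, hχ]))
      (ih₂ fun χ hχ => h χ (by simp [subformulas, hχ]))
  | tt => exact Iff.rfl
  | ff => exact Iff.rfl
  | atom a => simp only [next]; split <;> exact Iff.rfl
  | natom a => simp only [next]; split <;> exact Iff.rfl
  | X φ => exact psat_congr (φ := φ) fun χ hχ => h χ (by simp [subformulas, hχ])
  | _ => exact h _ (self_mem_subformulas _)

/-- Unfolding creates new formulae only of the shape `X χ` with `χ` a subformula, and `next` strips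
this `X` at once. So the master never leaves the Boolean functions of the subformulas. -/
theorem psat_unf_next_congr {V V' : Formula Ap → Prop} {φ : Formula Ap} {ν : Set Ap}
    (h : ∀ χ ∈ φ.subformulas, V χ ↔ V' χ) : PSat V (φ.unf.next ν) ↔ PSat V' (φ.unf.next ν) := by
  induction φ with
  | and φ ψ ih₁ ih₂ =>
    exact and_congr (ih₁ fun χ hχ => h χ (by simp [subformulas, hχ]))
      (ih₂ fun χ hχ => h χ (by simp [subformulas, hχ]))
  | or φ ψ ih₁ ih₂ =>
    exact or_congr (ih₁ fun χ hχ => h χ (by simp [subformulas, hχ]))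
      (ih₂ fun χ hχ => h χ (by simp [subformulas, hχ]))
  | F φ ih =>
    exact or_congr (ih fun χ hχ => h χ (by simp [subformulas, hχ])) (h _ (self_mem_subformulas _))
  | G φ ih =>
    exact and_congr (ih fun χ hχ => h χ (by simp [subformulas, hχ])) (h _ (self_mem_subformulas _))
  | U φ ψ ih₁ ih₂ =>
    exact or_congr (ih₂ fun χ hχ => h χ (by simp [subformulas, hχ]))
      (and_congr (ih₁ fun χ hχ => h χ (by simp [subformulas, hχ])) (h _ (self_mem_subformulas _)))
  | freq e c p φ => exact and_congr Iff.rfl (h _ (self_mem_subformulas _))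
  | _ => exact psat_next_congr h

variable {φ : Formula Ap}

theorem Supp.mk {χ : Formula Ap} (h : χ ∈ φ.subformulas) : Supp φ (.mk χ) :=
  fun _ _ hV => psat_congr fun θ hθ => hV θ (subformulas_trans h hθ)

theorem Supp.next {β : BFun Ap} (h : Supp φ β) (ν : Set Ap) : Supp φ (β.next ν) := fun V V' hV => by
  rw [BFun.holds_next, BFun.holds_next]
  exact h _ _ fun χ hχ => psat_next_congr fun θ hθ => hV θ (subformulas_trans hχ hθ)

theorem Supp.unfNext {β : BFun Ap} (h : Supp φ β) (ν : Set Ap) : Supp φ (β.unfNext ν) :=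
  fun V V' hV => by
  rw [BFun.holds_unfNext, BFun.holds_unfNext]
  exact h _ _ fun χ hχ => psat_unf_next_congr fun θ hθ => hV θ (subformulas_trans hχ hθ)

theorem supp_token {ξ : Formula Ap} (h : ξ ∈ φ.subformulas) (w : Word Ap) (b d : ℕ) :
    Supp φ (.mk (token w b ξ d)) := by
  induction d with
  | zero => exact .mk h
  | succ d ih => exact ih.next _

theorem supp_after (φ : Formula Ap) (w : Word Ap) (k d : ℕ) : Supp φ (.mk (after w k φ d)) := by
  induction d with
  | zero => exact .mk (self_mem_subformulas φ)
  | succ d ih => exact ih.unfNext _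

open Classical in
theorem Supp.holds_filter {β : BFun Ap} (h : Supp φ β) (V : Formula Ap → Prop) :
    β.Holds (· ∈ (subs φ).filter (fun χ => decide (V χ))) ↔ β.Holds V :=
  h _ _ fun χ hχ => by simp [mem_subs.2 hχ]

open Classical in
/-- A Boolean function, given by the assignments under which it is true. -/
noncomputable def table (φ : Formula Ap) (β : BFun Ap) : List (List (Formula Ap)) :=
  (assigns φ).filter (fun A => decide (β.Holds (· ∈ A)))

theorem mem_table {β : BFun Ap} {A : List (Formula Ap)} :
    A ∈ table φ β ↔ A ∈ assigns φ ∧ β.Holds (· ∈ A) := by simp [table]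

open Classical in
theorem filter_mem_table {β : BFun Ap} (h : Supp φ β) (V : Formula Ap → Prop) :
    (subs φ).filter (fun χ => decide (V χ)) ∈ table φ β ↔ β.Holds V := by
  rw [mem_table, h.holds_filter]
  simp [filter_mem_assigns]

theorem table_inj {β γ : BFun Ap} (hβ : Supp φ β) (hγ : Supp φ γ) :
    table φ β = table φ γ ↔ β = γ := by
  refine ⟨fun h => BFun.ext fun V => ?_, fun h => h ▸ rfl⟩
  classical
  rw [← filter_mem_table hβ, h, filter_mem_table hγ]

theorem table_mem (φ : Formula Ap) (β : BFun Ap) : table φ β ∈ (assigns φ).sublists' :=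
  List.mem_sublists'.2 List.filter_sublist

/-! ## The number of states -/

theorem Formula.length_le_of_mem {φ χ : Formula Ap} (h : χ ∈ φ.subformulas) : χ.length ≤ φ.length := by
  induction φ with
  | and φ ψ ih₁ ih₂ | or φ ψ ih₁ ih₂ | U φ ψ ih₁ ih₂ =>
    simp only [subformulas, List.mem_cons, List.mem_append] at h
    rcases h with rfl | h | h
    · exact le_rfl
    · have := ih₁ h; simp only [Formula.length]; omega
    · have := ih₂ h; simp only [Formula.length]; omega
  | X φ ih | F φ ih | G φ ih | freq e c p φ ih =>
    simp only [subformulas, List.mem_cons] at h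
    rcases h with rfl | h
    · exact le_rfl
    · have := ih h; simp only [Formula.length]; omega
  | _ =>
    simp only [subformulas, List.mem_singleton] at h
    rw [h]

theorem Formula.body_mem_subformulas (χ : Formula Ap) : χ.body ∈ χ.subformulas := by
  cases χ <;> simp [body, subformulas, self_mem_subformulas]

theorem body_depth_le {φ χ : Formula Ap} (h : χ ∈ φ.subformulas) : χ.body.depth ≤ φ.length :=
  χ.body.depth_le_length.trans ((length_le_of_mem χ.body_mem_subformulas).trans (length_le_of_mem h))

/-- Tables are subsets of the set of assignments, and assignments are subsets of the at most |φ|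
subformulas. -/
theorem suppSet_finite (φ : Formula Ap) :
    {β | Supp φ β}.Finite ∧ {β | Supp φ β}.ncard ≤ 2 ^ 2 ^ φ.length := by
  classical
  set t := (assigns φ).sublists'.toFinset with ht
  have hmaps : Set.MapsTo (table φ) {β | Supp φ β} (t : Set (List (List (Formula Ap)))) :=
    fun β _ => List.mem_toFinset.2 (table_mem φ β)
  have hinj : Set.InjOn (table φ) {β | Supp φ β} := fun β hβ γ hγ h => (table_inj hβ hγ).1 h
  have hfin : {β | Supp φ β}.Finite := Set.Finite.of_injOn hmaps hinj t.finite_toSet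
  refine ⟨hfin, ?_⟩
  have h1 := Set.ncard_le_ncard_of_injOn _ hmaps hinj t.finite_toSet
  rw [Set.ncard_coe_finset] at h1
  refine h1.trans ((List.toFinset_card_le _).trans ?_)
  rw [List.length_sublists', assigns, List.length_sublists']
  exact Nat.pow_le_pow_right (by omega) (Nat.pow_le_pow_right (by omega) (length_subs_le φ))

/-- The first factor counts master components. The slaves jointly are a function of at most |φ| last
letters and of how many letters have been read, up to |φ|, because older tokens have disappeared. -/
theorem reachable_finite (φ : Formula Ap) [Finite Ap] :
    {q | (productAutomaton φ).toLTS.Reachable q}.Finite ∧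
    {q | (productAutomaton φ).toLTS.Reachable q}.ncard ≤
      2 ^ 2 ^ φ.length * ((φ.length + 1) * 2 ^ (Nat.card Ap * φ.length)) := by
  classical
  set D := φ.length with hD
  -- A block of `D` letters is padded with `∅`; the letters after the block do not matter.
  let ex : (Fin D → Set Ap) → Word Ap := fun u i => if h : i < D then u ⟨i, h⟩ else ∅
  let g : Fin (D + 1) × (Fin D → Set Ap) → (∀ χ : {χ // χ ∈ φ.recs}, SlaveState χ.1) :=
    fun p χ => slaveRun (ex p.2) p.1 χ.1
  have hex : ∀ (w : Word Ap) (j : ℕ), j ≤ D → ∀ χ, slaveRun w j χ = slaveRun (ex fun i => w i) j χ :=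
    fun w j hj χ => slaveRun_congr (fun i hi => by simp [ex, show i < D by omega]) χ
  have hsub : {q | (productAutomaton φ).toLTS.Reachable q} ⊆ {β | Supp φ β} ×ˢ Set.range g := by
    intro q hq
    obtain ⟨w, j, rfl⟩ := (reachable_iff φ q).1 hq
    refine ⟨supp_after φ w 0 j, ?_⟩
    by_cases hj : j ≤ D
    · exact ⟨(⟨j, by omega⟩, fun i => w i), funext fun χ => (hex w j hj _).symm⟩
    · refine ⟨(⟨D, by omega⟩, fun i => suffix w (j - D) i), funext fun χ => ?_⟩
      exact ((slaveRun_suffix w (body_depth_le (mem_recs.1 χ.2).1) (not_le.1 hj).le).trans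
        (hex _ D le_rfl _)).symm
  obtain ⟨hf, hc⟩ := suppSet_finite φ
  have hprod := hf.prod (Set.finite_range g)
  refine ⟨hprod.subset hsub, (Set.ncard_le_ncard hsub hprod).trans ?_⟩
  rw [Set.ncard_prod]
  refine Nat.mul_le_mul hc ?_
  rw [← Set.image_univ]
  refine (Set.ncard_image_le Set.finite_univ).trans ?_
  rw [Set.ncard_univ, Nat.card_prod, Nat.card_fun, Nat.card_eq_fintype_card, Fintype.card_fin,
    Nat.card_eq_fintype_card (α := Fin D), Fintype.card_fin]
  have := Fintype.ofFinite Ap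
  rw [Nat.card_eq_fintype_card (α := Set Ap), Fintype.card_set, Nat.card_eq_fintype_card, ← pow_mul]

theorem finite_autState (φ : Formula Ap) [Finite Ap] : Finite (AutState φ) :=
  (reachable_finite φ).1.to_subtype

end Support

end FLTL

namespace FLTL

open Formula

/-! ## States after finite histories -/

section History

variable {Ap : Type u}

/-- A word that starts with the given history, a list of letters whose last element was read first. -/
def hist (u : List (Set Ap)) : Word Ap := fun i => u.reverse.getD i ∅

theorem hist_cons_of_lt (ν : Set Ap) {u : List (Set Ap)} {i : ℕ} (h : i < u.length) :
    hist (ν :: u) i = hist u i := by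
  simp only [hist, List.reverse_cons]
  exact List.getD_append _ _ _ _ (by simpa using h)

theorem hist_cons_length (ν : Set Ap) (u : List (Set Ap)) : hist (ν :: u) u.length = ν := by
  simp only [hist, List.reverse_cons]
  rw [List.getD_append_right _ _ _ _ (by simp)]
  simp

theorem exists_hist (w : Word Ap) (j : ℕ) : ∃ u : List (Set Ap), u.length = j ∧ ∀ i < j, hist u i = w i := by
  induction j with
  | zero => exact ⟨[], rfl, by simp⟩
  | succ j ih =>
    obtain ⟨u, hu, h⟩ := ih
    refine ⟨w j :: u, by simp [hu], fun i hi => ?_⟩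
    rcases Nat.lt_succ_iff_lt_or_eq.1 hi with hi | rfl
    · rw [hist_cons_of_lt _ (hu ▸ hi), h i hi]
    · rw [← hu, hist_cons_length]

/-- The state of the product after a history. -/
noncomputable def stateAt (φ : Formula Ap) (u : List (Set Ap)) : ProdState φ :=
  prodRun φ (hist u) u.length

/-- The state of a slave after a history. -/
noncomputable def slaveAt (u : List (Set Ap)) (χ : Formula Ap) : SlaveState χ :=
  slaveRun (hist u) u.length χ

theorem stateAt_nil (φ : Formula Ap) : stateAt φ [] = (productAutomaton φ).init := prodRun_zero φ _

theorem step_stateAt (φ : Formula Ap) (u : List (Set Ap)) (ν : Set Ap) :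
    (productAutomaton φ).step (stateAt φ u) ν = some (stateAt φ (ν :: u)) := by
  have h := prodRun_succ φ (hist (ν :: u)) u.length
  rwa [hist_cons_length, prodRun_congr φ (fun i hi => hist_cons_of_lt ν hi)] at h

theorem reachable_iff_stateAt (φ : Formula Ap) (q : ProdState φ) :
    (productAutomaton φ).toLTS.Reachable q ↔ ∃ u, q = stateAt φ u := by
  rw [reachable_iff]
  constructor
  · rintro ⟨w, j, rfl⟩
    obtain ⟨u, rfl, h⟩ := exists_hist w j
    exact ⟨u, (prodRun_congr φ h).symm⟩
  · rintro ⟨u, rfl⟩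
    exact ⟨_, _, rfl⟩

/-- The master component after a history. -/
noncomputable def masterAt (φ : Formula Ap) (u : List (Set Ap)) : BFun Ap := (stateAt φ u).1

theorem masterAt_cons (φ : Formula Ap) (ν : Set Ap) (u : List (Set Ap)) :
    masterAt φ (ν :: u) = (masterAt φ u).unfNext ν := by
  change BFun.mk (after (hist (ν :: u)) 0 φ (u.length + 1)) = .mk ((after (hist u) 0 φ u.length).unf.next ν)
  rw [after, zero_add, hist_cons_length]
  congr 2
  rw [after_congr fun i hi => ?_]
  rw [zero_add, hist_cons_of_lt ν hi]

theorem supp_masterAt (φ : Formula Ap) (u : List (Set Ap)) : Supp φ (masterAt φ u) := supp_after _ _ _ _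

/-- Whether the outermost operator is a frequency operator. -/
def Formula.isFreq : Formula Ap → Bool
  | .freq _ _ _ _ => true
  | _ => false

open Classical in
/-- The movement of the tokens of the slave of `χ`. -/
noncomputable def moveTokens (χ : Formula Ap) (ν : Set Ap) (m : List (BFun Ap)) : List (BFun Ap) :=
  .mk χ.body :: (m.filter (fun ψ => decide (¬ ψ.IsSink))).map (BFun.next ν)

open Classical in
/-- The tokens of the slave of `χ` after a history. -/
noncomputable def tokensAt (χ : Formula Ap) : List (Set Ap) → List (BFun Ap)
  | [] => [.mk χ.body]
  | ν :: u => if χ.isFreq then moveTokens χ ν (tokensAt χ u) else (moveTokens χ ν (tokensAt χ u)).dedup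

open Classical in
theorem mem_tokensAt (χ : Formula Ap) (u : List (Set Ap)) (ψ : BFun Ap) :
    ψ ∈ tokensAt χ u ↔ ψ ∈ tokenSet χ.body (hist u) u.length := by
  induction u generalizing ψ with
  | nil => simp [tokensAt, tokenSet_zero]
  | cons ν u ih =>
    have h := tokenSet_succ χ.body (hist (ν :: u)) u.length
    rw [hist_cons_length, tokenSet_congr _ (fun i hi => hist_cons_of_lt ν hi)] at h
    rw [List.length_cons, ← Option.some.inj h]
    simp only [tokensAt]
    rw [show (ψ ∈ if χ.isFreq = true then moveTokens χ ν (tokensAt χ u) else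
      (moveTokens χ ν (tokensAt χ u)).dedup) ↔ ψ ∈ moveTokens χ ν (tokensAt χ u) by split <;> simp]
    simp only [moveTokens, List.mem_cons, List.mem_map, List.mem_filter, ih, Set.mem_union,
      Set.mem_ofPred_eq, slaveLTS_step_eq_some, Set.mem_singleton_iff, decide_eq_true_eq]
    constructor
    · rintro (rfl | ⟨ψ, ⟨h1, h2⟩, rfl⟩)
      exacts [.inr rfl, .inl ⟨ψ, h1, h2, rfl⟩]
    · rintro (⟨ψ, h1, h2, rfl⟩ | rfl)
      exacts [.inr ⟨ψ, ⟨h1, h2⟩, rfl⟩, .inl rfl]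

open Classical in
theorem nodup_tokensAt {χ : Formula Ap} (h : χ.isFreq = false) (u : List (Set Ap)) :
    (tokensAt χ u).Nodup := by
  cases u with
  | nil => simp [tokensAt]
  | cons ν u => simp only [tokensAt, h]; exact List.nodup_dedup _

/-- The list as a multiset, given by multiplicities. -/
noncomputable def tally {α : Type v} (l : List α) : α →₀ ℕ := (l.map (Finsupp.single · 1)).sum

open Classical in
theorem tally_apply {α : Type v} (l : List α) (x : α) : tally l x = l.count x := by
  induction l with
  | nil => simp [tally]
  | cons y l ih =>
    rw [tally] at ih ⊢
    rw [List.map_cons, List.sum_cons, Finsupp.add_apply, ih, List.count_cons, add_comm, Finsupp.single_apply]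
    by_cases h : y = x <;> simp [h]

theorem tally_cons {α : Type v} (x : α) (l : List α) : tally (x :: l) = Finsupp.single x 1 + tally l := rfl

theorem tally_eq_iff {α : Type v} {l m : List α} : tally l = tally m ↔ l.Perm m := by
  classical
  rw [List.perm_iff_count, Finsupp.ext_iff]
  simp only [tally_apply]

theorem sum_tally {α M : Type*} [AddCommMonoid M] (l : List α) (g : α → ℕ → M) (h0 : ∀ x, g x 0 = 0)
    (ha : ∀ x i j, g x (i + j) = g x i + g x j) : (tally l).sum g = (l.map fun x => g x 1).sum := by
  induction l with
  | nil => simp [tally]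
  | cons x l ih =>
    rw [tally_cons, Finsupp.sum_add_index' h0 ha, Finsupp.sum_single_index (h0 x), ih, List.map_cons,
      List.sum_cons]

theorem tally_tokensAt {χ : Formula Ap} (h : χ.isFreq = true) (u : List (Set Ap)) :
    tally (tokensAt χ u) = tokenCount χ.body (hist u) u.length := by
  classical
  induction u with
  | nil => simp [tokensAt, tokenCount_zero, tally]
  | cons ν u ih =>
    have h1 := tokenCount_succ χ.body (hist (ν :: u)) u.length
    rw [hist_cons_length, tokenCount_congr _ (fun i hi => hist_cons_of_lt ν hi), ← ih] at h1
    rw [List.length_cons, ← Option.some.inj h1, sum_tally]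
    · simp only [tokensAt, h, if_true, moveTokens, tally_cons]
      congr 1
      generalize tokensAt χ u = m
      induction m with
      | nil => simp [tally]
      | cons ψ m ih =>
        rw [List.map_cons, List.sum_cons, ← ih]
        by_cases hs : ψ.IsSink
        · simp [slaveLTS, hs]
        · simp [slaveLTS, hs, tally_cons]
    · intro ψ; split <;> simp
    · intro ψ i j; split <;> simp

/-- For `F` and `G` the lists have no duplicates, so permutation is equality of sets; for frequency
formulae it is equality of multiplicities. -/
theorem tokensAt_perm_iff {χ : Formula Ap} (hχ : χ.isRec = true) (u u' : List (Set Ap)) :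
    (tokensAt χ u).Perm (tokensAt χ u') ↔ slaveAt u χ = slaveAt u' χ := by
  have key : χ.isFreq = false → ((tokensAt χ u).Perm (tokensAt χ u') ↔
      tokenSet χ.body (hist u) u.length = tokenSet χ.body (hist u') u'.length) := fun h => by
    rw [List.perm_ext_iff_of_nodup (nodup_tokensAt h u) (nodup_tokensAt h u'), Set.ext_iff]
    simp only [mem_tokensAt]
  cases χ with
  | F ξ => exact key rfl
  | G ξ => exact key rfl
  | freq e c p ξ => rw [← tally_eq_iff, tally_tokensAt rfl, tally_tokensAt rfl]; rfl
  | _ => cases hχ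

theorem supp_of_mem_tokensAt {φ χ : Formula Ap} (h : χ ∈ φ.subformulas) {u : List (Set Ap)} {ψ : BFun Ap}
    (hψ : ψ ∈ tokensAt χ u) : Supp φ ψ := by
  obtain ⟨b, _, _, rfl⟩ := (mem_tokensAt χ u ψ).1 hψ
  exact supp_token (subformulas_trans h χ.body_mem_subformulas) _ _ _

theorem length_tokensAt_le_succ (χ : Formula Ap) (u : List (Set Ap)) :
    (tokensAt χ u).length ≤ u.length + 1 := by
  classical
  induction u with
  | nil => simp [tokensAt]
  | cons ν u ih =>
    have h : (moveTokens χ ν (tokensAt χ u)).length ≤ u.length + 1 + 1 := by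
      simp only [moveTokens, List.length_cons, List.length_map]
      exact Nat.add_le_add_right ((List.length_filter_le _ _).trans ih) 1
    simp only [tokensAt, List.length_cons]
    split
    · exact h
    · exact (List.dedup_sublist _).length_le.trans h

/-- One token is born per letter, and a long history leaves the same tokens as its last |φ| letters.
-/
theorem length_tokensAt_le {φ χ : Formula Ap} (h : χ ∈ φ.subformulas) (hχ : χ.isRec = true)
    (u : List (Set Ap)) : (tokensAt χ u).length ≤ φ.length + 1 := by
  by_cases hu : u.length ≤ φ.length
  · exact (length_tokensAt_le_succ χ u).trans (by omega)
  · have hD := body_depth_le h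
    obtain ⟨v, hl, hv⟩ := exists_hist (suffix (hist u) (u.length - φ.length)) φ.length
    have : slaveAt u χ = slaveAt v χ := by
      rw [slaveAt, slaveRun_suffix _ hD (not_le.1 hu).le, slaveAt, hl]
      exact slaveRun_congr (fun i hi => (hv i hi).symm) χ
    rw [((tokensAt_perm_iff hχ _ _).2 this).length_eq, ← hl]
    exact length_tokensAt_le_succ χ v

/-! ## Canonical token lists -/

variable (φ : Formula Ap)

open Classical in
/-- A Boolean function with the given table. -/
noncomputable def ofTable (t : List (List (Formula Ap))) : BFun Ap :=
  if h : ∃ β, Supp φ β ∧ table φ β = t then h.choose else .mk φ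

open Classical in
/-- All Boolean functions over the subformulas. -/
noncomputable def allFuns : List (BFun Ap) :=
  ((assigns φ).sublists'.filter (fun t => decide (∃ β, Supp φ β ∧ table φ β = t))).map (ofTable φ)

variable {φ}

theorem table_ofTable {t : List (List (Formula Ap))} (h : ∃ β, Supp φ β ∧ table φ β = t) :
    table φ (ofTable φ t) = t := by
  rw [ofTable, dif_pos h]; exact h.choose_spec.2

theorem ofTable_table {β : BFun Ap} (h : Supp φ β) : ofTable φ (table φ β) = β := by
  have h' : ∃ γ, Supp φ γ ∧ table φ γ = table φ β := ⟨β, h, rfl⟩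
  rw [ofTable, dif_pos h']
  exact (table_inj h'.choose_spec.1 h).1 h'.choose_spec.2

open Classical in
theorem map_table_allFuns : (allFuns φ).map (table φ) =
    (assigns φ).sublists'.filter (fun t => decide (∃ β, Supp φ β ∧ table φ β = t)) := by
  rw [allFuns, List.map_map]
  refine (List.map_congr_left fun t ht => ?_).trans (List.map_id _)
  exact table_ofTable (by simpa using (List.mem_filter.1 ht).2)

open Classical in
theorem mem_allFuns {β : BFun Ap} (h : Supp φ β) : β ∈ allFuns φ := by
  refine List.mem_map.2 ⟨table φ β, List.mem_filter.2 ⟨table_mem φ β, ?_⟩, ofTable_table h⟩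
  exact decide_eq_true ⟨β, h, rfl⟩

open Classical in
theorem supp_of_mem_allFuns {β : BFun Ap} (h : β ∈ allFuns φ) : Supp φ β := by
  obtain ⟨t, ht, rfl⟩ := List.mem_map.1 h
  obtain ⟨β, hβ, rfl⟩ := of_decide_eq_true (List.mem_filter.1 ht).2
  rwa [ofTable_table hβ]

theorem nodup_allFuns : (allFuns φ).Nodup := by
  refine List.Nodup.of_map (table φ) ?_
  rw [map_table_allFuns]
  exact (List.nodup_sublists'.2 (nodup_assigns φ)).filter _

open Classical in
variable (φ) in
/-- The list, rearranged in a fixed order. -/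
noncomputable def canon (m : List (BFun Ap)) : List (BFun Ap) :=
  (allFuns φ).flatMap (fun β => m.filter (fun ψ => decide (ψ = β)))

theorem canon_perm {m : List (BFun Ap)} (hm : ∀ β ∈ m, Supp φ β) : (canon φ m).Perm m := by
  classical
  rw [List.perm_iff_count]
  intro β
  rw [canon, List.count_flatMap]
  have h1 : ∀ γ ∈ allFuns φ, (List.count β ∘ fun β => m.filter (fun ψ => decide (ψ = β))) γ =
      if γ = β then m.count β else 0 := by
    intro γ _
    simp only [Function.comp_apply]
    by_cases h : γ = β
    · subst h; simp [List.count_filter]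
    · rw [if_neg h, List.count_eq_zero]
      simp only [List.mem_filter, decide_eq_true_eq, not_and]
      exact fun _ h' => h h'.symm
  rw [List.map_congr_left h1]
  have h2 : ∀ l : List (BFun Ap), (l.map (fun γ => if γ = β then m.count β else 0)).sum =
      l.count β * m.count β := by
    intro l
    induction l with
    | nil => simp
    | cons γ l ih => by_cases h : γ = β <;> simp [h, ih, add_mul, add_comm]
  rw [h2]
  by_cases hβ : β ∈ m
  · rw [List.count_eq_one_of_mem nodup_allFuns (mem_allFuns (hm β hβ)), one_mul]
  · rw [List.count_eq_zero_of_not_mem hβ, mul_zero]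

/-- `canon` groups the copies of each function in the fixed order of `allFuns`, so its value depends
on multiplicities only. -/
theorem canon_eq_iff {m m' : List (BFun Ap)} (hm : ∀ β ∈ m, Supp φ β) (hm' : ∀ β ∈ m', Supp φ β) :
    canon φ m = canon φ m' ↔ m.Perm m' := by
  classical
  refine ⟨fun h => (canon_perm hm).symm.trans (h ▸ canon_perm hm'), fun h => ?_⟩
  unfold canon
  congr 1
  funext β
  have : ∀ l : List (BFun Ap), l.filter (fun ψ => decide (ψ = β)) = List.replicate (l.count β) β :=
    fun l => List.filter_eq β
  rw [this, this, h.count_eq]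

open Classical in
-- The canonical order becomes computable: one may run through all lists of assignments, because
-- those that are the table of no function over the subformulas match nothing in `m`.
theorem map_table_canon {m : List (BFun Ap)} (hm : ∀ β ∈ m, Supp φ β) :
    (canon φ m).map (table φ) =
      (assigns φ).sublists'.flatMap (fun t => (m.map (table φ)).filter (fun s => decide (s = t))) := by
  have h1 : ∀ l : List (List (List (Formula Ap))),
      l.flatMap (fun t => (m.map (table φ)).filter (fun s => decide (s = t))) =
      (l.filter (fun t => decide (∃ β, Supp φ β ∧ table φ β = t))).flatMap
        (fun t => (m.map (table φ)).filter (fun s => decide (s = t))) := by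
    intro l
    induction l with
    | nil => rfl
    | cons t l ih =>
      by_cases h : ∃ β, Supp φ β ∧ table φ β = t
      · rw [List.filter_cons_of_pos (by simpa using h), List.flatMap_cons, List.flatMap_cons, ih]
      · rw [List.filter_cons_of_neg (by simpa using h), List.flatMap_cons, ih,
          List.filter_eq_nil_iff.2, List.nil_append]
        intro s hs
        obtain ⟨β, hβ, rfl⟩ := List.mem_map.1 hs
        simp only [decide_eq_true_eq]
        exact fun e => h ⟨β, hm β hβ, e⟩
  rw [h1, ← map_table_allFuns, canon, List.map_flatMap, List.flatMap_map]
  refine List.flatMap_congr fun β hβ => ?_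
  rw [List.filter_map]
  congr 1
  refine List.filter_congr fun γ hγ => ?_
  simp [table_inj (hm γ hγ) (supp_of_mem_allFuns hβ)]

end History

end FLTL

namespace FLTL

open Formula Enc

/-! ## Codes -/

theorem bool_injective : Function.Injective Enc.bool := by
  intro b c h; cases b <;> cases c <;> first | rfl | cases h

theorem binary_injective : Function.Injective Enc.binary := fun j k h => by
  have h1 : j.bits = k.bits := bool_injective.list_map (list_injective h)
  have := Nat.digits_two_eq_bits j
  rw [h1, ← Nat.digits_two_eq_bits] at this
  exact Nat.digits.injective 2 this

theorem rat_injOn {p q : ℚ} (hp : 0 ≤ p) (hq : 0 ≤ q) (h : Enc.rat p = Enc.rat q) : p = q := by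
  have h1 := list_injective h
  simp only [List.cons.injEq, binary_injective.eq_iff] at h1
  obtain ⟨-, h2, h3, -⟩ := h1
  refine Rat.ext ?_ h3
  have h4 := Rat.num_nonneg.2 hp
  have h5 := Rat.num_nonneg.2 hq
  omega

theorem ext_injective : Function.Injective Enc.ext := by
  intro b c h; cases b <;> cases c <;> first | rfl | cases h

theorem cmp_injective : Function.Injective Enc.cmp := by
  intro b c h; cases b <;> cases c <;> first | rfl | cases h

theorem list_eq_list {l m : List Dat} : list l = list m ↔ l = m := list_injective.eq_iff

theorem unary_eq_unary {j k : ℕ} : unary j = unary k ↔ j = k := unary_injective.eq_iff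

theorem formula_injective (n : ℕ) : Function.Injective (formula (n := n)) := by
  intro φ
  induction φ with
  | and φ ψ ih₁ ih₂ | or φ ψ ih₁ ih₂ | U φ ψ ih₁ ih₂ =>
    intro χ h
    cases χ <;> simp only [formula, list_eq_list, List.cons.injEq, unary_eq_unary] at h <;> try omega
    rw [ih₁ h.2.1, ih₂ h.2.2.1]
  | X φ ih | F φ ih | G φ ih =>
    intro χ h
    cases χ <;> simp only [formula, list_eq_list, List.cons.injEq, unary_eq_unary] at h <;> try omega
    rw [ih h.2.1]
  | freq e c p φ ih =>
    intro χ h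
    cases χ <;> simp only [formula, list_eq_list, List.cons.injEq, unary_eq_unary] at h <;> try omega
    rename_i _ _ q _
    rw [ext_injective h.2.1, cmp_injective h.2.2.1, ih h.2.2.2.2.1,
      Subtype.ext (rat_injOn p.2.1 q.2.1 h.2.2.2.1)]
  | atom a | natom a =>
    intro χ h
    cases χ <;> simp only [formula, list_eq_list, List.cons.injEq, unary_eq_unary] at h <;> try omega
    rw [Fin.ext h.2.1]
  | tt | ff =>
    intro χ h
    cases χ <;> simp only [formula, list_eq_list, List.cons.injEq, unary_eq_unary] at h <;>
      first | rfl | omega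

section Codes

variable {n : ℕ}

/-- The code of an assignment. -/
def assignCode (A : List (Formula (Fin n))) : Dat := list (A.map formula)

/-- The code of a table. -/
def tableCode (t : List (List (Formula (Fin n)))) : Dat := list (t.map assignCode)

/-- The code of a Boolean function over the subformulas of `φ`. -/
noncomputable def funCode (φ : Formula (Fin n)) (β : BFun (Fin n)) : Dat := tableCode (table φ β)

theorem assignCode_injective : Function.Injective (assignCode (n := n)) :=
  list_injective.comp (formula_injective n).list_map

theorem tableCode_injective : Function.Injective (tableCode (n := n)) :=
  list_injective.comp assignCode_injective.list_map

theorem funCode_inj {φ : Formula (Fin n)} {β γ : BFun (Fin n)} (hβ : Supp φ β) (hγ : Supp φ γ) :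
    funCode φ β = funCode φ γ ↔ β = γ := by
  rw [funCode, funCode, tableCode_injective.eq_iff, table_inj hβ hγ]

/-- The `F`-, `G`- and frequency subformulas, in a fixed order. -/
noncomputable def recList (φ : Formula (Fin n)) : List (Formula (Fin n)) := (subs φ).filter isRec

theorem mem_recList {φ χ : Formula (Fin n)} : χ ∈ recList φ ↔ χ ∈ φ.recs := by
  rw [recList, List.mem_filter, mem_subs, mem_recs]

theorem nodup_recList (φ : Formula (Fin n)) : (recList φ).Nodup := (nodup_subs φ).filter _

/-- The code of the tokens of the slave of `χ` after a history. -/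
noncomputable def tokensCode (φ χ : Formula (Fin n)) (u : List (Set (Fin n))) : Dat :=
  list ((canon φ (tokensAt χ u)).map (funCode φ))

/-- The code of the state after a history. -/
noncomputable def stateCode (φ : Formula (Fin n)) (u : List (Set (Fin n))) : Dat :=
  .cons (funCode φ (masterAt φ u)) (list ((recList φ).map fun χ => .cons (formula χ) (tokensCode φ χ u)))

/-- The canonical order makes token lists that are permutations of each other equal, and tables
determine functions over the subformulas; thus codes can be compared instead of states. -/
theorem tokensCode_eq_iff {φ χ : Formula (Fin n)} (h : χ ∈ φ.recs) (u u' : List (Set (Fin n))) :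
    tokensCode φ χ u = tokensCode φ χ u' ↔ slaveAt u χ = slaveAt u' χ := by
  obtain ⟨h1, h2⟩ := mem_recs.1 h
  have hs : ∀ u, ∀ β ∈ tokensAt χ u, Supp φ β := fun u β hβ => supp_of_mem_tokensAt h1 hβ
  have hc : ∀ u, ∀ β ∈ canon φ (tokensAt χ u), Supp φ β := fun u β hβ =>
    hs u β ((canon_perm (hs u)).mem_iff.1 hβ)
  rw [← tokensAt_perm_iff h2, ← canon_eq_iff (hs u) (hs u'), tokensCode, tokensCode, list_eq_list]
  refine ⟨fun h => ?_, fun h => by rw [h]⟩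
  have hd : ∀ u, ((canon φ (tokensAt χ u)).map (table φ)).map (ofTable φ) = canon φ (tokensAt χ u) :=
    fun u => by
      rw [List.map_map]
      exact (List.map_congr_left fun β hβ => ofTable_table (hc u β hβ)).trans (List.map_id _)
  have h' : ((canon φ (tokensAt χ u)).map (table φ)).map tableCode =
      ((canon φ (tokensAt χ u')).map (table φ)).map tableCode := by
    rw [List.map_map, List.map_map]; exact h
  rw [← hd, tableCode_injective.list_map h', hd]

theorem stateCode_eq_iff {φ : Formula (Fin n)} {u u' : List (Set (Fin n))} :
    stateCode φ u = stateCode φ u' ↔ stateAt φ u = stateAt φ u' := by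
  rw [stateCode, stateCode, Dat.cons.injEq, funCode_inj (supp_masterAt φ u) (supp_masterAt φ u'),
    list_eq_list, List.map_inj_left, Prod.ext_iff]
  refine and_congr Iff.rfl ⟨fun h => funext fun χ => ?_, fun h χ hχ => ?_⟩
  · exact (tokensCode_eq_iff χ.2 u u').1 (Dat.cons.inj (h χ.1 (mem_recList.2 χ.2))).2
  · rw [(tokensCode_eq_iff (mem_recList.1 hχ) u u').2 (congrFun h ⟨χ, mem_recList.1 hχ⟩)]

/-! ### Letters -/

variable (n) in
/-- The letters, as lists of numbers. -/
def letters : List (List ℕ) := (List.range n).reverse.sublists'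

variable (n) in
/-- The letter given by a list of numbers. -/
def letterSet (l : List ℕ) : Set (Fin n) := {i | (i : ℕ) ∈ l}

theorem length_letters : (letters n).length = 2 ^ n := by simp [letters]

/-- With the range reversed, `sublists'` lists all sets without `n` before those with `n`, each half
in the same order. Indices from 2^n on are thus those whose bit `n` is set: sets appear in the order
of binary counting that `Enc.automaton` prescribes. -/
theorem mem_getElem_letters (n k i : ℕ) (hk : k < (letters n).length) :
    i ∈ (letters n)[k] ↔ i < n ∧ k.testBit i = true := by
  induction n generalizing k with
  | zero =>
    have : k = 0 := by simpa [letters] using hk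
    subst this
    simp [letters]
  | succ n ih =>
    have e : letters (n + 1) = letters n ++ (letters n).map (List.cons n) := by
      simp [letters, List.range_succ, List.sublists'_cons]
    have hn := length_letters (n := n)
    have hk2 : k < 2 ^ (n + 1) := by rwa [length_letters] at hk
    by_cases h : k < (letters n).length
    · have : (letters (n + 1))[k] = (letters n)[k] := by simp only [e]; exact List.getElem_append_left h
      rw [this, ih k h]
      refine ⟨fun h => ⟨by omega, h.2⟩, fun ⟨h1, h2⟩ => ⟨?_, h2⟩⟩
      by_contra hi
      have : i = n := by omega
      subst this
      rw [Nat.testBit_lt_two_pow (hn ▸ h)] at h2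
      cases h2
    · have hge : 2 ^ n ≤ k := by omega
      have hlt : k - 2 ^ n < 2 ^ n := by rw [pow_succ] at hk2; omega
      have : (letters (n + 1))[k] = n :: (letters n)[k - 2 ^ n]'(by omega) := by
        simp only [e]
        rw [List.getElem_append_right (by omega)]
        simp [hn]
      rw [this, List.mem_cons, ih]
      have hb : ∀ i, k.testBit i = (2 ^ n + (k - 2 ^ n)).testBit i := fun i => by
        rw [Nat.add_sub_cancel' hge]
      constructor
      · rintro (rfl | ⟨h1, h2⟩)
        · refine ⟨by omega, ?_⟩
          rw [hb, Nat.testBit_two_pow_add_eq, Nat.testBit_lt_two_pow hlt]; rfl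
        · refine ⟨by omega, ?_⟩
          rw [hb, Nat.testBit_two_pow_add_gt h1, h2]
      · rintro ⟨h1, h2⟩
        by_cases hi : i = n
        · exact .inl hi
        · have hi : i < n := by omega
          rw [hb, Nat.testBit_two_pow_add_gt hi] at h2
          exact .inr ⟨hi, h2⟩

theorem map_letterSet_letters {α : Type*} (g : Set (Fin n) → α) :
    (letters n).map (fun l => g (letterSet n l)) = List.ofFn (fun k : Fin (2 ^ n) => g (letter n k)) := by
  refine List.ext_getElem (by simp [length_letters]) fun k h1 h2 => ?_
  rw [List.getElem_map, List.getElem_ofFn]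
  congr 1
  ext i
  simp only [letterSet, letter, Set.mem_ofPred_eq]
  rw [mem_getElem_letters]
  simp

theorem exists_letter (ν : Set (Fin n)) : ∃ l ∈ letters n, letterSet n l = ν := by
  classical
  refine ⟨(List.range n).reverse.filter (fun i => decide (∃ j ∈ ν, (j : ℕ) = i)),
    List.mem_sublists'.2 List.filter_sublist, ?_⟩
  ext i
  simp only [letterSet, Set.mem_ofPred_eq, List.mem_filter, List.mem_reverse, List.mem_range,
    decide_eq_true_eq]
  constructor
  · rintro ⟨-, j, hj, h⟩; rwa [← Fin.ext h]
  · exact fun h => ⟨i.2, i, h, rfl⟩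

end Codes

end FLTL

namespace FLTL

open Formula Enc

/-! ## Computations on formulae -/

/-- The number of the outermost operator. -/
def Formula.tag {Ap : Type u} : Formula Ap → ℕ
  | .tt => 0
  | .ff => 1
  | .atom _ => 2
  | .natom _ => 3
  | .and _ _ => 4
  | .or _ _ => 5
  | .X _ => 6
  | .F _ => 7
  | .G _ => 8
  | .U _ _ => 9
  | .freq _ _ _ _ => 10

theorem Formula.psat_next_atom {Ap : Type u} {V : Formula Ap → Prop} {ν : Set Ap} {p : Ap} :
    PSat V ((Formula.atom p).next ν) ↔ p ∈ ν := by
  rw [Formula.next]; split <;> simp_all [PSat]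

theorem Formula.psat_next_natom {Ap : Type u} {V : Formula Ap → Prop} {ν : Set Ap} {p : Ap} :
    PSat V ((Formula.natom p).next ν) ↔ p ∉ ν := by
  rw [Formula.next]; split <;> simp_all [PSat]

namespace PT

/-- The number `m` of cases does not depend on the index, so the test is a fixed nesting of `m`
comparisons. -/
theorem natCases {m : ℕ} {ι : Type} {a b : ι → Dat} {t : ι → ℕ} (ht : PT a (fun i => unary (t i)))
    (hm : ∀ i, t i < m) (h : ∀ j < m, PT (fun i : {i // t i = j} => a i) (fun i => b i)) : PT a b := by
  induction m generalizing ι with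
  | zero => exact nil.congr fun i => absurd (hm i) (by omega)
  | succ m ih =>
    refine ((ht.bitEq (const (unary m))).bitCongr fun i => unary_eq_unary).bitCases (h m (by omega)) ?_
    refine ih (ht.precomp Subtype.val) (fun i => ?_) fun j hj => ?_
    · have := hm i.1
      have := i.2
      omega
    · exact (h j (by omega)).precomp fun i : {i : {i // ¬ t i = m} // t i.1 = j} => ⟨i.1.1, i.2⟩

variable {ι : Type} {a b : ι → Dat} {n : ι → ℕ} {χ : ∀ i, Formula (Fin (n i))}

theorem tag (h : PT a (fun i => formula (χ i))) : PT a (fun i => unary (χ i).tag) :=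
  h.hd.congr fun i => by cases χ i <;> rfl

/-- Case distinction by the outermost operator. -/
theorem formulaCases (h : PT a (fun i => formula (χ i)))
    (htt : PT (fun i : {i // χ i = .tt} => a i) (fun i => b i))
    (hff : PT (fun i : {i // χ i = .ff} => a i) (fun i => b i))
    (hatom : ∀ (κ : Type) (r : κ → ι) (p : ∀ k, Fin (n (r k))), (∀ k, χ (r k) = .atom (p k)) →
      PT (fun k => a (r k)) (fun k => unary (p k)) → PT (fun k => a (r k)) (fun k => b (r k)))
    (hnatom : ∀ (κ : Type) (r : κ → ι) (p : ∀ k, Fin (n (r k))), (∀ k, χ (r k) = .natom (p k)) →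
      PT (fun k => a (r k)) (fun k => unary (p k)) → PT (fun k => a (r k)) (fun k => b (r k)))
    (hand : ∀ (κ : Type) (r : κ → ι) (φ ψ : ∀ k, Formula (Fin (n (r k)))),
      (∀ k, χ (r k) = .and (φ k) (ψ k)) → PT (fun k => a (r k)) (fun k => formula (φ k)) →
      PT (fun k => a (r k)) (fun k => formula (ψ k)) → PT (fun k => a (r k)) (fun k => b (r k)))
    (hor : ∀ (κ : Type) (r : κ → ι) (φ ψ : ∀ k, Formula (Fin (n (r k)))),
      (∀ k, χ (r k) = .or (φ k) (ψ k)) → PT (fun k => a (r k)) (fun k => formula (φ k)) →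
      PT (fun k => a (r k)) (fun k => formula (ψ k)) → PT (fun k => a (r k)) (fun k => b (r k)))
    (hX : ∀ (κ : Type) (r : κ → ι) (φ : ∀ k, Formula (Fin (n (r k)))), (∀ k, χ (r k) = .X (φ k)) →
      PT (fun k => a (r k)) (fun k => formula (φ k)) → PT (fun k => a (r k)) (fun k => b (r k)))
    (hF : ∀ (κ : Type) (r : κ → ι) (φ : ∀ k, Formula (Fin (n (r k)))), (∀ k, χ (r k) = .F (φ k)) →
      PT (fun k => a (r k)) (fun k => formula (φ k)) → PT (fun k => a (r k)) (fun k => b (r k)))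
    (hG : ∀ (κ : Type) (r : κ → ι) (φ : ∀ k, Formula (Fin (n (r k)))), (∀ k, χ (r k) = .G (φ k)) →
      PT (fun k => a (r k)) (fun k => formula (φ k)) → PT (fun k => a (r k)) (fun k => b (r k)))
    (hU : ∀ (κ : Type) (r : κ → ι) (φ ψ : ∀ k, Formula (Fin (n (r k)))),
      (∀ k, χ (r k) = .U (φ k) (ψ k)) → PT (fun k => a (r k)) (fun k => formula (φ k)) →
      PT (fun k => a (r k)) (fun k => formula (ψ k)) → PT (fun k => a (r k)) (fun k => b (r k)))
    (hfreq : ∀ (κ : Type) (r : κ → ι) (e : κ → Ext) (c : κ → Cmp) (p : κ → Set.Icc (0 : ℚ) 1)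
      (φ : ∀ k, Formula (Fin (n (r k)))), (∀ k, χ (r k) = .freq (e k) (c k) (p k) (φ k)) →
      PT (fun k => a (r k)) (fun k => Enc.ext (e k)) → PT (fun k => a (r k)) (fun k => Enc.cmp (c k)) →
      PT (fun k => a (r k)) (fun k => Enc.rat (p k)) →
      PT (fun k => a (r k)) (fun k => formula (φ k)) → PT (fun k => a (r k)) (fun k => b (r k))) :
    PT a b := by
  refine natCases (m := 11) h.tag (fun i => by cases χ i <;> simp [Formula.tag]) fun j hj => ?_
  have hr : PT (fun i : {i // (χ i).tag = j} => a i) (fun i => formula (χ i)) := h.precomp Subtype.val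
  have arg₁ := hr.tl.hd
  have arg₂ := hr.tl.tl.hd
  have arg₃ := hr.tl.tl.tl.hd
  have arg₄ := hr.tl.tl.tl.tl.hd
  interval_cases j
  · exact htt.precomp fun i : {i // (χ i).tag = 0} => ⟨i.1, by
      have := i.2; revert this; cases χ i.1 <;> simp [Formula.tag]⟩
  · exact hff.precomp fun i : {i // (χ i).tag = 1} => ⟨i.1, by
      have := i.2; revert this; cases χ i.1 <;> simp [Formula.tag]⟩
  · have : ∀ i : {i // (χ i).tag = 2}, ∃ p, χ i = .atom p := fun i => by
      have := i.2; revert this; cases χ i.1 <;> simp [Formula.tag]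
    choose p hp using this
    exact hatom _ Subtype.val p hp (arg₁.congr fun i => by rw [hp]; rfl)
  · have : ∀ i : {i // (χ i).tag = 3}, ∃ p, χ i = .natom p := fun i => by
      have := i.2; revert this; cases χ i.1 <;> simp [Formula.tag]
    choose p hp using this
    exact hnatom _ Subtype.val p hp (arg₁.congr fun i => by rw [hp]; rfl)
  · have : ∀ i : {i // (χ i).tag = 4}, ∃ φ ψ, χ i = .and φ ψ := fun i => by
      have := i.2; revert this; cases χ i.1 <;> simp [Formula.tag]
    choose φ ψ hp using this
    exact hand _ Subtype.val φ ψ hp (arg₁.congr fun i => by rw [hp]; rfl)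
      (arg₂.congr fun i => by rw [hp]; rfl)
  · have : ∀ i : {i // (χ i).tag = 5}, ∃ φ ψ, χ i = .or φ ψ := fun i => by
      have := i.2; revert this; cases χ i.1 <;> simp [Formula.tag]
    choose φ ψ hp using this
    exact hor _ Subtype.val φ ψ hp (arg₁.congr fun i => by rw [hp]; rfl)
      (arg₂.congr fun i => by rw [hp]; rfl)
  · have : ∀ i : {i // (χ i).tag = 6}, ∃ φ, χ i = .X φ := fun i => by
      have := i.2; revert this; cases χ i.1 <;> simp [Formula.tag]
    choose φ hp using this
    exact hX _ Subtype.val φ hp (arg₁.congr fun i => by rw [hp]; rfl)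
  · have : ∀ i : {i // (χ i).tag = 7}, ∃ φ, χ i = .F φ := fun i => by
      have := i.2; revert this; cases χ i.1 <;> simp [Formula.tag]
    choose φ hp using this
    exact hF _ Subtype.val φ hp (arg₁.congr fun i => by rw [hp]; rfl)
  · have : ∀ i : {i // (χ i).tag = 8}, ∃ φ, χ i = .G φ := fun i => by
      have := i.2; revert this; cases χ i.1 <;> simp [Formula.tag]
    choose φ hp using this
    exact hG _ Subtype.val φ hp (arg₁.congr fun i => by rw [hp]; rfl)
  · have : ∀ i : {i // (χ i).tag = 9}, ∃ φ ψ, χ i = .U φ ψ := fun i => by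
      have := i.2; revert this; cases χ i.1 <;> simp [Formula.tag]
    choose φ ψ hp using this
    exact hU _ Subtype.val φ ψ hp (arg₁.congr fun i => by rw [hp]; rfl)
      (arg₂.congr fun i => by rw [hp]; rfl)
  · have : ∀ i : {i // (χ i).tag = 10}, ∃ e c p φ, χ i = .freq e c p φ := fun i => by
      have := i.2; revert this; cases χ i.1 with
      | freq e c p φ => exact fun _ => ⟨e, c, p, φ, rfl⟩
      | _ => simp [Formula.tag]
    choose e c p φ hp using this
    exact hfreq _ Subtype.val e c p φ hp (arg₁.congr fun i => by rw [hp]; rfl)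
      (arg₂.congr fun i => by rw [hp]; rfl) (arg₃.congr fun i => by rw [hp]; rfl)
      (arg₄.congr fun i => by rw [hp]; rfl)

theorem bitIsRec (h : PT a (fun i => formula (χ i))) : PT a (fun i => bit ((χ i).isRec = true)) := by
  have h' := h.tag
  refine (((h'.bitEq (const (unary 7))).bitOr (h'.bitEq (const (unary 8)))).bitOr
    (h'.bitEq (const (unary 10)))).bitCongr fun i => ?_
  simp only [unary_eq_unary]
  cases χ i <;> simp [Formula.tag, isRec]

theorem bitIsFreq (h : PT a (fun i => formula (χ i))) : PT a (fun i => bit ((χ i).isFreq = true)) := by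
  refine (h.tag.bitEq (const (unary 10))).bitCongr fun i => ?_
  rw [unary_eq_unary]
  cases χ i <;> simp [Formula.tag, isFreq]

/-- The codes of the direct subformulas. -/
theorem kids (h : PT a (fun i => formula (χ i))) :
    PT a (fun i => list ((χ i).kids.map formula)) := by
  refine h.formulaCases (nil.congr fun i => ?_) (nil.congr fun i => ?_) ?_ ?_ ?_ ?_ ?_ ?_ ?_ ?_ ?_
  · rw [i.2]; rfl
  · rw [i.2]; rfl
  · exact fun κ r p e _ => nil.congr fun i => by rw [e]; rfl
  · exact fun κ r p e _ => nil.congr fun i => by rw [e]; rfl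
  · exact fun κ r φ ψ e h1 h2 => (h1.cons (h2.cons nil)).congr fun i => by rw [e]; rfl
  · exact fun κ r φ ψ e h1 h2 => (h1.cons (h2.cons nil)).congr fun i => by rw [e]; rfl
  · exact fun κ r φ e h1 => (h1.cons nil).congr fun i => by rw [e]; rfl
  · exact fun κ r φ e h1 => (h1.cons nil).congr fun i => by rw [e]; rfl
  · exact fun κ r φ e h1 => (h1.cons nil).congr fun i => by rw [e]; rfl
  · exact fun κ r φ ψ e h1 h2 => (h1.cons (h2.cons nil)).congr fun i => by rw [e]; rfl
  · exact fun κ r _ _ _ φ e _ _ _ h1 => (h1.cons nil).congr fun i => by rw [e]; rfl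

theorem body (h : PT a (fun i => formula (χ i))) (hr : ∀ i, (χ i).isRec = true) :
    PT a (fun i => formula (χ i).body) := by
  refine h.kids.hd.congr fun i => ?_
  have := hr i
  revert this
  cases χ i <;> simp [isRec, Formula.body, Formula.kids, list, Dat.hd]

end PT

/-! ## Computations with a fixed formula -/

/-- What is computed from a formula before its automaton. -/
noncomputable def base {n : ℕ} (φ : Formula (Fin n)) : Dat :=
  list [unary (2 ^ 2 ^ (input n φ).size), list ((subs φ).map formula),
    list ((assigns φ).map assignCode), list ((assigns φ).sublists'.map tableCode),
    list ((letters n).map fun l => list (l.map unary)), list ((recList φ).map formula), formula φ]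

namespace PT

section Projections

variable {ι : Type} {a : ι → Dat} {n : ι → ℕ} {φ : ∀ i, Formula (Fin (n i))}

theorem baseFuel (h : PT a (fun i => base (φ i))) :
    PT a (fun i => unary (2 ^ 2 ^ (input (n i) (φ i)).size)) := h.hd

theorem baseSubs (h : PT a (fun i => base (φ i))) :
    PT a (fun i => list ((subs (φ i)).map formula)) := h.tl.hd

theorem baseAssigns (h : PT a (fun i => base (φ i))) :
    PT a (fun i => list ((assigns (φ i)).map assignCode)) := h.tl.tl.hd

theorem baseTables (h : PT a (fun i => base (φ i))) :
    PT a (fun i => list ((assigns (φ i)).sublists'.map tableCode)) := h.tl.tl.tl.hd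

theorem baseLetters (h : PT a (fun i => base (φ i))) :
    PT a (fun i => list ((letters (n i)).map fun l => list (l.map unary))) :=
  h.tl.tl.tl.tl.hd

theorem baseRecList (h : PT a (fun i => base (φ i))) :
    PT a (fun i => list ((recList (φ i)).map formula)) := h.tl.tl.tl.tl.tl.hd

theorem baseFormula (h : PT a (fun i => base (φ i))) :
    PT a (fun i => formula (φ i)) := h.tl.tl.tl.tl.tl.tl.hd

end Projections

/-! ### Bottom-up evaluation of all subformulas. -/

section Eval

variable {ι : Type} {a : ι → Dat} {n : ι → ℕ} {φ : ∀ i, Formula (Fin (n i))}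

open Classical in
variable (a φ) in
/-- The data available in a scan of the subformulas that filters by `Q`. -/
noncomputable abbrev scanCtx (Q : ∀ i, Formula (Fin (n i)) → Prop)
    (p : Suffixes (fun i => subs (φ i))) : Dat :=
  .cons (formula p.2.1.1) (.cons (list ((p.2.1.2.filter (fun y => decide (Q p.1 y))).map formula)) (a p.1))

variable {Q : ∀ i, Formula (Fin (n i)) → Prop} {κ : Type} {r : κ → Suffixes (fun i => subs (φ i))}

/-- Direct subformulas stand behind the current formula in `subs`, so the scan from the end has
already decided them, and their value is membership in the filtered tail. -/
theorem kidBit {ψ : ∀ k, Formula (Fin (n (r k).1))}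
    (hψ : PT (fun k => scanCtx a φ Q (r k)) (fun k => formula (ψ k)))
    (hk : ∀ k, ψ k ∈ (r k).2.1.1.kids) :
    PT (fun k => scanCtx a φ Q (r k)) (fun k => bit (Q (r k).1 (ψ k))) := by
  classical
  refine (bitMemMap (fun _ => formula_injective _) hψ
    (l := fun k => (r k).2.1.2.filter (fun y => decide (Q (r k).1 y))) right.hd).bitCongr fun k => ?_
  rw [List.mem_filter, decide_eq_true_eq, and_iff_right]
  exact (kidsAfter_subs _).mem_of_suffix (r k).2.2 (hk k)

theorem scanAnd (hQ : ∀ i χ ψ, Q i (.and χ ψ) ↔ Q i χ ∧ Q i ψ) {χ ψ : ∀ k, Formula (Fin (n (r k).1))}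
    (e : ∀ k, (r k).2.1.1 = .and (χ k) (ψ k))
    (h1 : PT (fun k => scanCtx a φ Q (r k)) (fun k => formula (χ k)))
    (h2 : PT (fun k => scanCtx a φ Q (r k)) (fun k => formula (ψ k))) :
    PT (fun k => scanCtx a φ Q (r k)) (fun k => bit (Q (r k).1 (r k).2.1.1)) :=
  ((kidBit h1 fun k => by simp [e, Formula.kids]).bitAnd
    (kidBit h2 fun k => by simp [e, Formula.kids])).bitCongr fun k => by rw [e, hQ]

theorem scanOr (hQ : ∀ i χ ψ, Q i (.or χ ψ) ↔ Q i χ ∨ Q i ψ) {χ ψ : ∀ k, Formula (Fin (n (r k).1))}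
    (e : ∀ k, (r k).2.1.1 = .or (χ k) (ψ k))
    (h1 : PT (fun k => scanCtx a φ Q (r k)) (fun k => formula (χ k)))
    (h2 : PT (fun k => scanCtx a φ Q (r k)) (fun k => formula (ψ k))) :
    PT (fun k => scanCtx a φ Q (r k)) (fun k => bit (Q (r k).1 (r k).2.1.1)) :=
  ((kidBit h1 fun k => by simp [e, Formula.kids]).bitOr
    (kidBit h2 fun k => by simp [e, Formula.kids])).bitCongr fun k => by rw [e, hQ]

variable {A : ∀ i, List (Formula (Fin (n i)))}

theorem scanMem (hA : PT a (fun i => assignCode (A i))) : PT (fun k => scanCtx a φ Q (r k))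
    (fun k => bit ((r k).2.1.1 ∈ A (r k).1)) :=
  bitMemMap (fun _ => formula_injective _) left (hA.lift₂ fun k => (r k).1)

theorem scanOfMem (hA : PT a (fun i => assignCode (A i)))
    (hQ : ∀ k, Q (r k).1 (r k).2.1.1 ↔ (r k).2.1.1 ∈ A (r k).1) :
    PT (fun k => scanCtx a φ Q (r k)) (fun k => bit (Q (r k).1 (r k).2.1.1)) :=
  (scanMem hA).bitCongr fun k => (hQ k).symm

open Classical in
/-- The values of all subformulas under an assignment. -/
theorem evalSubs (h : PT a (fun i => base (φ i))) (hA : PT a (fun i => assignCode (A i))) :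
    PT a (fun i => list (((subs (φ i)).filter
    (fun χ => decide (PSat (· ∈ A i) χ))).map formula)) := by
  refine scanFilter (Q := fun i χ => PSat (· ∈ A i) χ) h.baseSubs ?_
  refine formulaCases (a := scanCtx a φ fun i χ => PSat (· ∈ A i) χ) left
    (bitOf fun i => by rw [i.2]; trivial) (bitOfNot fun i => by rw [i.2]; exact id)
    ?_ ?_ ?_ ?_ ?_ ?_ ?_ ?_ ?_
  · exact fun κ r p e _ => scanOfMem hA fun k => by rw [e]; rfl
  · exact fun κ r p e _ => scanOfMem hA fun k => by rw [e]; rfl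
  · exact fun κ r φ ψ e h1 h2 => scanAnd (fun _ _ _ => Iff.rfl) e h1 h2
  · exact fun κ r φ ψ e h1 h2 => scanOr (fun _ _ _ => Iff.rfl) e h1 h2
  · exact fun κ r p e _ => scanOfMem hA fun k => by rw [e]; rfl
  · exact fun κ r p e _ => scanOfMem hA fun k => by rw [e]; rfl
  · exact fun κ r p e _ => scanOfMem hA fun k => by rw [e]; rfl
  · exact fun κ r p q e _ _ => scanOfMem hA fun k => by rw [e]; rfl
  · exact fun κ r _ _ _ p e _ _ _ _ => scanOfMem hA fun k => by rw [e]; rfl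

/-- After a step `X ψ` becomes `ψ` itself, whose value is needed under the plain assignment, not
under the predicate `Q` of the scan. It is looked up in a separate evaluation. -/
theorem scanArg (h : PT a (fun i => base (φ i))) (hA : PT a (fun i => assignCode (A i)))
    {ψ : ∀ k, Formula (Fin (n (r k).1))}
    (hψ : PT (fun k => scanCtx a φ Q (r k)) (fun k => formula (ψ k)))
    (hk : ∀ k, ψ k ∈ (r k).2.1.1.kids) :
    PT (fun k => scanCtx a φ Q (r k)) (fun k => bit (PSat (· ∈ A (r k).1) (ψ k))) := by
  classical
  refine (bitMemMap (fun _ => formula_injective _) hψ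
    ((evalSubs h hA).lift₂ fun k => (r k).1)).bitCongr fun k => ?_
  rw [List.mem_filter, decide_eq_true_eq, and_iff_right]
  exact ((r k).2.2.subset (List.mem_cons_of_mem _ ((kidsAfter_subs _).mem_of_suffix (r k).2.2 (hk k))))

variable {l : ι → List ℕ}

theorem scanAtom (hl : PT a (fun i => list ((l i).map unary)))
    {p : ∀ k, Fin (n (r k).1)}
    (hp : PT (fun k => scanCtx a φ Q (r k)) (fun k => unary (p k))) :
    PT (fun k => scanCtx a φ Q (r k)) (fun k => bit (p k ∈ letterSet (n (r k).1) (l (r k).1))) :=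
  bitMemMap (x := fun k => (p k : ℕ)) (fun _ => unary_injective) hp (hl.lift₂ fun k => (r k).1)

open Classical in
/-- The values of all subformulas after a step, under an assignment. -/
theorem evalNext (h : PT a (fun i => base (φ i))) (hA : PT a (fun i => assignCode (A i)))
    (hl : PT a (fun i => list ((l i).map unary))) :
    PT a (fun i => list (((subs (φ i)).filter
    (fun χ => decide (PSat (· ∈ A i) (χ.next (letterSet (n i) (l i)))))).map formula)) := by
  refine scanFilter (Q := fun i χ => PSat (· ∈ A i) (χ.next (letterSet (n i) (l i)))) h.baseSubs ?_
  refine formulaCases (a := scanCtx a φ fun i χ => PSat (· ∈ A i) (χ.next (letterSet (n i) (l i)))) left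
    (bitOf fun i => by rw [i.2]; trivial) (bitOfNot fun i => by rw [i.2]; exact id)
    ?_ ?_ ?_ ?_ ?_ ?_ ?_ ?_ ?_
  · exact fun κ r p e hp => (scanAtom hl hp).bitCongr fun k => by
      rw [e]; exact psat_next_atom.symm
  · exact fun κ r p e hp => (scanAtom hl hp).bitNot.bitCongr fun k => by
      rw [e]; exact psat_next_natom.symm
  · exact fun κ r φ ψ e h1 h2 => scanAnd (fun _ _ _ => Iff.rfl) e h1 h2
  · exact fun κ r φ ψ e h1 h2 => scanOr (fun _ _ _ => Iff.rfl) e h1 h2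
  · exact fun κ r p e h1 => (scanArg h hA h1 fun k => by simp [e, Formula.kids]).bitCongr fun k => by
      rw [e]; rfl
  · exact fun κ r p e _ => scanOfMem hA fun k => by rw [e]; rfl
  · exact fun κ r p e _ => scanOfMem hA fun k => by rw [e]; rfl
  · exact fun κ r p q e _ _ => scanOfMem hA fun k => by rw [e]; rfl
  · exact fun κ r _ _ _ p e _ _ _ _ => scanOfMem hA fun k => by rw [e]; rfl

open Classical in
/-- The values of all subformulas after unfolding and a step, under an assignment. -/
theorem evalUnfNext (h : PT a (fun i => base (φ i))) (hA : PT a (fun i => assignCode (A i)))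
    (hl : PT a (fun i => list ((l i).map unary))) :
    PT a (fun i => list (((subs (φ i)).filter
    (fun χ => decide (PSat (· ∈ A i) (χ.unf.next (letterSet (n i) (l i)))))).map formula)) := by
  refine scanFilter (Q := fun i χ => PSat (· ∈ A i) (χ.unf.next (letterSet (n i) (l i)))) h.baseSubs ?_
  refine formulaCases (a := scanCtx a φ fun i χ => PSat (· ∈ A i) (χ.unf.next (letterSet (n i) (l i))))
    left (bitOf fun i => by rw [i.2]; trivial) (bitOfNot fun i => by rw [i.2]; exact id)
    ?_ ?_ ?_ ?_ ?_ ?_ ?_ ?_ ?_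
  · exact fun κ r p e hp => (scanAtom hl hp).bitCongr fun k => by
      rw [e]; exact psat_next_atom.symm
  · exact fun κ r p e hp => (scanAtom hl hp).bitNot.bitCongr fun k => by
      rw [e]; exact psat_next_natom.symm
  · exact fun κ r φ ψ e h1 h2 => scanAnd (fun _ _ _ => Iff.rfl) e h1 h2
  · exact fun κ r φ ψ e h1 h2 => scanOr (fun _ _ _ => Iff.rfl) e h1 h2
  · exact fun κ r p e h1 => (scanArg h hA h1 fun k => by simp [e, Formula.kids]).bitCongr fun k => by
      rw [e]; rfl
  · exact fun κ r p e h1 => ((kidBit h1 fun k => by simp [e, Formula.kids]).bitOr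
      (scanMem hA)).bitCongr fun k => by rw [e]; rfl
  · exact fun κ r p e h1 => ((kidBit h1 fun k => by simp [e, Formula.kids]).bitAnd
      (scanMem hA)).bitCongr fun k => by rw [e]; rfl
  · exact fun κ r p q e h1 h2 => ((kidBit h2 fun k => by simp [e, Formula.kids]).bitOr
      ((kidBit h1 fun k => by simp [e, Formula.kids]).bitAnd (scanMem hA))).bitCongr fun k => by
        rw [e]; rfl
  · exact fun κ r _ _ _ p e _ _ _ _ => (scanMem hA).bitCongr fun k => by
      rw [e]; exact (and_iff_right trivial).symm

end Eval

end PT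

end FLTL

/-! ### Boolean functions and moves of tokens, computed on their codes. -/

namespace FLTL

open Formula Enc

open Classical in
theorem dedup_map_of_injOn {α β : Type*} {f : α → β} {l : List α}
    (hf : ∀ x ∈ l, ∀ y ∈ l, f x = f y → x = y) : (l.map f).dedup = l.dedup.map f := by
  induction l with
  | nil => rfl
  | cons x l ih =>
    have ih := ih fun y hy z hz => hf y (List.mem_cons_of_mem _ hy) z (List.mem_cons_of_mem _ hz)
    by_cases h : x ∈ l
    · rw [List.map_cons, List.dedup_cons_of_mem (List.mem_map_of_mem h), List.dedup_cons_of_mem h, ih]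
    · rw [List.map_cons, List.dedup_cons_of_notMem, List.dedup_cons_of_notMem h, ih, List.map_cons]
      intro h'
      obtain ⟨y, hy, e⟩ := List.mem_map.1 h'
      exact h (hf y (List.mem_cons_of_mem _ hy) x (by simp) e ▸ hy)

theorem supp_of_mem_canon {n : ℕ} {φ χ : Formula (Fin n)} (hm : χ ∈ φ.subformulas)
    {u : List (Set (Fin n))} {ψ : BFun (Fin n)} (h : ψ ∈ canon φ (tokensAt χ u)) : Supp φ ψ :=
  supp_of_mem_tokensAt hm ((canon_perm fun _ hβ => supp_of_mem_tokensAt hm hβ).mem_iff.1 h)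

namespace PT

section Functions

variable {ι : Type} {a : ι → Dat} {n : ι → ℕ} {φ : ∀ i, Formula (Fin (n i))}
  {β : ∀ i, BFun (Fin (n i))} {l : ι → List ℕ} {χ : ∀ i, Formula (Fin (n i))}

open Classical in
/-- Evaluation of a Boolean function under an assignment to the subformulas. -/
theorem bitHolds {V : ∀ i, Formula (Fin (n i)) → Prop} (hs : ∀ i, Supp (φ i) (β i))
    (hβ : PT a (fun i => funCode (φ i) (β i)))
    (hV : PT a (fun i => list (((subs (φ i)).filter (fun χ => decide (V i χ))).map formula))) :
    PT a (fun i => bit ((β i).Holds (V i))) :=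
  (bitMemMap (fun _ => assignCode_injective) hV hβ).bitCongr fun i => filter_mem_table (hs i) (V i)

/-- All assignments are part of `base`, so a table is computed by testing each of them. -/
theorem funOfHolds (h : PT a (fun i => base (φ i)))
    (hQ : PT (fun p : Members (fun i => assigns (φ i)) =>
      .cons (assignCode p.2.1) (a p.1)) (fun p => bit ((β p.1).Holds (· ∈ p.2.1)))) :
    PT a (fun i => funCode (φ i) (β i)) := by
  classical
  exact filter (Q := fun i A => (β i).Holds (· ∈ A)) h.baseAssigns hQ

theorem mkFun (h : PT a (fun i => base (φ i)))
    (hχ : PT a (fun i => formula (χ i))) (hm : ∀ i, χ i ∈ (φ i).subformulas) :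
    PT a (fun i => funCode (φ i) (.mk (χ i))) := by
  classical
  refine funOfHolds h ?_
  refine (bitMemMap (fun _ => formula_injective _) (hχ.lift Sigma.fst)
    (evalSubs (h.lift Sigma.fst) left)).bitCongr fun p => ?_
  rw [List.mem_filter, decide_eq_true_eq, and_iff_right (mem_subs.2 (hm p.1)), BFun.holds_mk]

theorem nextFun (h : PT a (fun i => base (φ i)))
    (hs : ∀ i, Supp (φ i) (β i)) (hβ : PT a (fun i => funCode (φ i) (β i)))
    (hl : PT a (fun i => list ((l i).map unary))) :
    PT a (fun i => funCode (φ i) ((β i).next (letterSet (n i) (l i)))) := by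
  refine funOfHolds h ?_
  exact (bitHolds (fun p => hs p.1) (hβ.lift Sigma.fst)
    (evalNext (h.lift Sigma.fst) left (hl.lift Sigma.fst))).bitCongr fun p => (BFun.holds_next _ _ _).symm

theorem unfNextFun (h : PT a (fun i => base (φ i)))
    (hs : ∀ i, Supp (φ i) (β i)) (hβ : PT a (fun i => funCode (φ i) (β i)))
    (hl : PT a (fun i => list ((l i).map unary))) :
    PT a (fun i => funCode (φ i) ((β i).unfNext (letterSet (n i) (l i)))) := by
  refine funOfHolds h ?_
  exact (bitHolds (fun p => hs p.1) (hβ.lift Sigma.fst)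
    (evalUnfNext (h.lift Sigma.fst) left (hl.lift Sigma.fst))).bitCongr
      fun p => (BFun.holds_unfNext _ _ _).symm

/-- It suffices to test the finitely many letters, and functions over the subformulas are compared
through their tables. -/
theorem bitSink (h : PT a (fun i => base (φ i)))
    (hs : ∀ i, Supp (φ i) (β i)) (hβ : PT a (fun i => funCode (φ i) (β i))) :
    PT a (fun i => bit (β i).IsSink) := by
  refine (bitAll (Q := fun i l => funCode (φ i) ((β i).next (letterSet (n i) l)) = funCode (φ i) (β i))
    h.baseLetters ((nextFun (h.lift Sigma.fst) (fun p => hs p.1) (hβ.lift Sigma.fst) left).bitEq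
      (hβ.lift Sigma.fst))).bitCongr fun i => ?_
  constructor
  · intro h ν
    obtain ⟨l, hl, rfl⟩ := exists_letter ν
    exact (funCode_inj ((hs i).next _) (hs i)).1 (h l hl)
  · exact fun h l _ => by rw [h]

theorem canonFuns (h : PT a (fun i => base (φ i)))
    {m : ∀ i, List (BFun (Fin (n i)))} (hs : ∀ i, ∀ β ∈ m i, Supp (φ i) β)
    (hm : PT a (fun i => list ((m i).map (funCode (φ i))))) :
    PT a (fun i => list ((canon (φ i) (m i)).map (funCode (φ i)))) := by
  classical
  have hm' : PT a (fun i => list (((m i).map (table (φ i))).map tableCode)) :=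
    hm.congr fun i => by rw [List.map_map]; rfl
  refine (flatMap (g := fun i t => (((m i).map (table (φ i))).filter
    (fun s => decide (s = t))).map tableCode) h.baseTables ?_).congr fun i => ?_
  · refine (filter (Q := fun (p : Members fun i => (assigns (φ i)).sublists') s => s = p.2.1)
      (hm'.lift Sigma.fst) ?_).congr fun p => by congr!
    exact (left.bitEq right.hd).bitCongr fun p => tableCode_injective.eq_iff
  · rw [show (canon (φ i) (m i)).map (funCode (φ i)) =
      ((canon (φ i) (m i)).map (table (φ i))).map tableCode by rw [List.map_map]; rfl,
      map_table_canon (hs i), List.map_flatMap]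

end Functions

section Steps

variable {ι : Type} {a : ι → Dat} {n : ι → ℕ} {φ : ∀ i, Formula (Fin (n i))}
  {l : ι → List ℕ} {χ : ∀ i, Formula (Fin (n i))} {u : ∀ i, List (Set (Fin (n i)))}

theorem tokensInit (h : PT a (fun i => base (φ i)))
    (hχ : PT a (fun i => formula (χ i))) (hm : ∀ i, χ i ∈ (φ i).recs) :
    PT a (fun i => tokensCode (φ i) (χ i) []) :=
  canonFuns h (fun i _ hβ => supp_of_mem_tokensAt (mem_recs.1 (hm i)).1 hβ)
    ((mkFun h (hχ.body fun i => (mem_recs.1 (hm i)).2) fun i =>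
      subformulas_trans (mem_recs.1 (hm i)).1 (χ i).body_mem_subformulas).cons nil)

theorem tokensStep (h : PT a (fun i => base (φ i)))
    (hχ : PT a (fun i => formula (χ i))) (hm : ∀ i, χ i ∈ (φ i).recs)
    (hu : PT a (fun i => tokensCode (φ i) (χ i) (u i))) (hl : PT a (fun i => list ((l i).map unary))) :
    PT a (fun i => tokensCode (φ i) (χ i) (letterSet (n i) (l i) :: u i)) := by
  classical
  have hm' : ∀ i, χ i ∈ (φ i).subformulas := fun i => (mem_recs.1 (hm i)).1
  have hsub : ∀ i, ∀ β ∈ moveTokens (χ i) (letterSet (n i) (l i)) (canon (φ i) (tokensAt (χ i) (u i))),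
      Supp (φ i) β := by
    intro i β hβ
    rcases List.mem_cons.1 hβ with rfl | hβ
    · exact .mk (subformulas_trans (hm' i) (χ i).body_mem_subformulas)
    · obtain ⟨γ, hγ, rfl⟩ := List.mem_map.1 hβ
      exact (supp_of_mem_canon (hm' i) (List.mem_filter.1 hγ).1).next _
  have hmove : PT a (fun i => list ((moveTokens (χ i) (letterSet (n i) (l i))
      (canon (φ i) (tokensAt (χ i) (u i)))).map (funCode (φ i)))) := by
    refine (listCons (mkFun h (hχ.body fun i => (mem_recs.1 (hm i)).2) fun i =>
      subformulas_trans (hm' i) (χ i).body_mem_subformulas)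
      (map (g := fun i β => funCode (φ i) (β.next (letterSet (n i) (l i))))
      (filter (Q := fun i β => ¬ β.IsSink) hu ?_) ?_)).congr fun i => ?_
    · exact bitNot (bitSink (h.lift Sigma.fst) (fun p => supp_of_mem_canon (hm' p.1) p.2.2) left)
    · exact nextFun (h.lift Sigma.fst)
        (fun p => supp_of_mem_canon (hm' p.1) (List.mem_filter.1 p.2.2).1) left (hl.lift Sigma.fst)
    · simp only [moveTokens, List.map_cons, List.map_map, Function.comp_def]
      congr!
  -- Only the canonical list is available, not `tokensAt` itself; moving tokens respects
  -- permutations, and a final canonical sorting removes the difference.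
  have hperm : ∀ i, (moveTokens (χ i) (letterSet (n i) (l i)) (canon (φ i) (tokensAt (χ i) (u i)))).Perm
      (moveTokens (χ i) (letterSet (n i) (l i)) (tokensAt (χ i) (u i))) := fun i =>
    ((((canon_perm fun β hβ => supp_of_mem_tokensAt (hm' i) hβ)).filter _).map _).cons _
  have hsub' : ∀ i, ∀ β ∈ moveTokens (χ i) (letterSet (n i) (l i)) (tokensAt (χ i) (u i)),
      Supp (φ i) β := fun i β hβ => hsub i β ((hperm i).mem_iff.2 hβ)
  refine (bitIsFreq hχ).bitCases ?_ ?_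
  · refine (canonFuns (h.precomp Subtype.val) (fun i => hsub i.1) (hmove.precomp Subtype.val)).congr
      fun i => ?_
    rw [tokensCode, tokensAt, if_pos i.2, (canon_eq_iff (hsub i.1) (hsub' i.1)).2 (hperm i.1)]
  · have hd : PT a (fun i => list ((moveTokens (χ i) (letterSet (n i) (l i))
        (canon (φ i) (tokensAt (χ i) (u i)))).dedup.map (funCode (φ i)))) := by
      have := dedup (α := fun _ => Dat) (f := fun _ x => x) (fun _ _ _ e => e)
        (l := fun i => (moveTokens (χ i) (letterSet (n i) (l i))
        (canon (φ i) (tokensAt (χ i) (u i)))).map (funCode (φ i))) (hmove.congr fun i => by rw [List.map_id'])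
      refine this.congr fun i => ?_
      rw [List.map_id', dedup_map_of_injOn fun β hβ γ hγ e => (funCode_inj (hsub i β hβ) (hsub i γ hγ)).1 e]
      congr!
    refine (canonFuns (h.precomp Subtype.val) (fun i β hβ => hsub i.1 β (List.mem_dedup.1 hβ))
      (hd.precomp Subtype.val)).congr fun i => ?_
    rw [tokensCode, tokensAt, if_neg i.2, (canon_eq_iff
      (fun β hβ => hsub i.1 β (List.mem_dedup.1 hβ)) (fun β hβ => hsub' i.1 β (List.mem_dedup.1 hβ))).2
      ((hperm i.1).dedup)]

end Steps

end PT

end FLTL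

namespace FLTL

open Formula Enc

/-! ## Sizes of codes -/

theorem size_le_size_binary (k : ℕ) : k.size ≤ (Enc.binary k).size := by
  have := length_lt_size_list (k.bits.map Enc.bool)
  rw [List.length_map, Nat.size_eq_bits_len] at this
  exact this.le

theorem length_le_size_formula {n : ℕ} (φ : Formula (Fin n)) : φ.length ≤ (formula φ).size := by
  induction φ with
  | freq e c p φ ih =>
    have h1 := size_le_size_binary p.1.num.natAbs
    have h2 := size_le_size_binary p.1.den
    simp only [Formula.length, formula, list, Dat.size, Enc.rat]
    omega
  | _ =>
    simp only [Formula.length, formula, list, Dat.size] at *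
    omega

theorem size_formula_le {n : ℕ} (φ : Formula (Fin n)) : (formula φ).size ≤ (2 * n + 60) * φ.length := by
  induction φ with
  | tt | ff => simp only [Formula.length, formula, list, Dat.size, size_unary]; omega
  | atom a | natom a =>
    have := a.2
    simp only [Formula.length, formula, list, Dat.size, size_unary]; omega
  | and φ ψ ih₁ ih₂ | or φ ψ ih₁ ih₂ | U φ ψ ih₁ ih₂ =>
    simp only [Formula.length, formula, list, Dat.size, size_unary, Nat.mul_add]; omega
  | X φ ih | F φ ih | G φ ih =>
    simp only [Formula.length, formula, list, Dat.size, size_unary, Nat.mul_add]; omega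
  | freq e c p φ ih =>
    have h1 := size_binary_le p.1.num.natAbs
    have h2 := size_binary_le p.1.den
    have h3 : (Enc.ext e).size ≤ 3 := by cases e <;> simp [Enc.ext, Enc.bool, Dat.size]
    have h4 : (Enc.cmp c).size ≤ 3 := by cases c <;> simp [Enc.cmp, Enc.bool, Dat.size]
    have h5 := size_bool_le (decide (p.1 < 0))
    have h6 : p.1.num.natAbs.size * 4 ≤ (2 * n + 60) * p.1.num.natAbs.size := by
      rw [Nat.mul_comm]; exact Nat.mul_le_mul_right _ (by omega)
    have h7 : p.1.den.size * 4 ≤ (2 * n + 60) * p.1.den.size := by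
      rw [Nat.mul_comm]; exact Nat.mul_le_mul_right _ (by omega)
    simp only [Formula.length, formula, list, Dat.size, size_unary, Nat.mul_add, Enc.rat]
    omega

theorem size_input (n : ℕ) (φ : Formula (Fin n)) : n + φ.length + 2 ≤ (input n φ).size := by
  have := length_le_size_formula φ
  simp only [input, Dat.size, size_unary]
  omega

theorem size_input_le (n : ℕ) (φ : Formula (Fin n)) :
    (input n φ).size ≤ (2 * (n + φ.length) + 60) * (n + φ.length) + 2 * (n + φ.length) + 2 := by
  have h1 := size_formula_le φ
  have h2 : (2 * n + 60) * φ.length ≤ (2 * (n + φ.length) + 60) * (n + φ.length) :=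
    Nat.mul_le_mul (by omega) (by omega)
  simp only [input, Dat.size, size_unary]
  omega

section Bounds

variable {n : ℕ} (φ : Formula (Fin n))

theorem card_states_le : 2 ^ 2 ^ φ.length * ((φ.length + 1) * 2 ^ (n * φ.length)) ≤
    2 ^ 2 ^ (input n φ).size := by
  set m := φ.length
  -- Each of the three factors is at most 2^t, and 3t ≤ 4t = 2^(n + m + 2), which the size of the
  -- input dominates.
  set t := 2 ^ (n + m) with ht
  have h1 : 2 ^ m ≤ t := Nat.pow_le_pow_right (by omega) (by omega)
  have h2 : n * m ≤ t := by
    rw [ht, pow_add]; exact Nat.mul_le_mul Nat.lt_two_pow_self.le Nat.lt_two_pow_self.le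
  have h3 : m + 1 ≤ 2 ^ t := (show m + 1 ≤ t from (Nat.lt_two_pow_self (n := m)).trans_le h1).trans
    Nat.lt_two_pow_self.le
  have h4 : t * 4 ≤ 2 ^ (input n φ).size := by
    rw [show t * 4 = 2 ^ (n + m + 2) by rw [pow_add, ← ht]; rfl]
    exact Nat.pow_le_pow_right (by omega) (size_input n φ)
  calc 2 ^ 2 ^ m * ((m + 1) * 2 ^ (n * m)) ≤ 2 ^ t * (2 ^ t * 2 ^ t) :=
        Nat.mul_le_mul (Nat.pow_le_pow_right (by omega) h1)
          (Nat.mul_le_mul h3 (Nat.pow_le_pow_right (by omega) h2))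
    _ = 2 ^ (t + (t + t)) := by rw [pow_add, pow_add]
    _ ≤ _ := Nat.pow_le_pow_right (by omega) (by omega)

theorem fuel_le_base : 2 ^ 2 ^ (input n φ).size ≤ (base φ).size := by
  simp only [base, list, Dat.size, size_unary]; omega

theorem size_assigns_le : (list ((assigns φ).map assignCode)).size ≤ (base φ).size := by
  simp only [base, list, Dat.size]; omega

theorem size_recList_le : (list ((recList φ).map formula)).size ≤ (base φ).size := by
  simp only [base, list, Dat.size]; omega

theorem length_le_base : φ.length + 1 ≤ (base φ).size := by
  have h1 := size_input n φ
  have h2 : (input n φ).size < 2 ^ (input n φ).size := Nat.lt_two_pow_self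
  have h3 : 2 ^ (input n φ).size < 2 ^ 2 ^ (input n φ).size := Nat.lt_two_pow_self
  have h4 := fuel_le_base φ
  omega

theorem size_funCode_le (β : BFun (Fin n)) : (funCode φ β).size ≤ (base φ).size :=
  (size_list_sublist (List.filter_sublist.map _)).trans (size_assigns_le φ)

theorem size_stateCode_le (u : List (Set (Fin n))) : (stateCode φ u).size ≤
    1 + (base φ).size + ((base φ).size * (1 + (base φ).size +
      ((base φ).size * ((base φ).size + 1) + 1) + 1) + 1) := by
  rw [stateCode, Dat.size]
  refine Nat.add_le_add (Nat.add_le_add_left (size_funCode_le φ _) 1) ?_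
  refine (size_list_le (z := 1 + (base φ).size + ((base φ).size * ((base φ).size + 1) + 1)) ?_).trans ?_
  · intro x hx
    obtain ⟨χ, hχ, rfl⟩ := List.mem_map.1 hx
    obtain ⟨h1, h2⟩ := mem_recs.1 (mem_recList.1 hχ)
    rw [Dat.size]
    refine Nat.add_le_add (Nat.add_le_add_left ((size_le_of_mem (List.mem_map_of_mem hχ)).trans
      (size_recList_le φ)) 1) ?_
    refine (size_list_le (z := (base φ).size) ?_).trans ?_
    · intro y hy
      obtain ⟨β, _, rfl⟩ := List.mem_map.1 hy
      exact size_funCode_le φ β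
    · refine Nat.add_le_add_right (Nat.mul_le_mul_right _ ?_) 1
      rw [List.length_map, (canon_perm fun _ hβ => supp_of_mem_tokensAt h1 hβ).length_eq]
      exact (length_tokensAt_le h1 h2 u).trans (length_le_base φ)
  · refine Nat.add_le_add_right (Nat.mul_le_mul_right _ ?_) 1
    have h1 := length_lt_size_list ((recList φ).map formula)
    have h2 := size_recList_le φ
    rw [List.length_map] at h1 ⊢
    omega

end Bounds

/-! ## Exploration of the states -/

section Explore

variable {n : ℕ} (φ : Formula (Fin n))

open Classical in
/-- A history that leads to the state with the given code. -/
noncomputable def decode (d : Dat) : List (Set (Fin n)) :=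
  if h : ∃ u, stateCode φ u = d then h.choose else []

open Classical in
/-- The codes of the states found after `k` rounds. -/
noncomputable def explore : ℕ → List Dat
  | 0 => [stateCode φ []]
  | k + 1 => ((explore k).flatMap fun d => (letters n).map fun l =>
      stateCode φ (letterSet n l :: decode φ d)) ∪ explore k

variable {φ}

theorem stateCode_decode {d : Dat} (h : ∃ u, stateCode φ u = d) : stateCode φ (decode φ d) = d := by
  rw [decode, dif_pos h]; exact h.choose_spec

/-- Codes determine states, so any history decoded from a code serves to compute the successors. -/
theorem stateCode_cons_congr {u u' : List (Set (Fin n))} (h : stateCode φ u = stateCode φ u')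
    (ν : Set (Fin n)) : stateCode φ (ν :: u) = stateCode φ (ν :: u') := by
  rw [stateCode_eq_iff] at h ⊢
  have h1 := step_stateAt φ u ν
  rw [h, step_stateAt] at h1
  exact (Option.some.inj h1).symm

theorem suffix_explore_succ (k : ℕ) : explore φ k <:+ explore φ (k + 1) := by
  classical
  rw [explore]
  convert List.suffix_union_right _ (explore φ k) using 2

theorem mem_explore_succ {k : ℕ} {d : Dat} : d ∈ explore φ (k + 1) ↔
    (∃ d' ∈ explore φ k, ∃ l ∈ letters n, stateCode φ (letterSet n l :: decode φ d') = d) ∨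
      d ∈ explore φ k := by
  classical
  rw [explore, List.mem_union_iff, List.mem_flatMap]
  simp only [List.mem_map]

theorem stateCode_of_mem_explore {k : ℕ} {d : Dat} (h : d ∈ explore φ k) : ∃ u, stateCode φ u = d := by
  induction k generalizing d with
  | zero => exact ⟨[], (List.mem_singleton.1 h).symm⟩
  | succ k ih =>
    rcases mem_explore_succ.1 h with ⟨_, _, l, _, rfl⟩ | h
    · exact ⟨_, rfl⟩
    · exact ih h

theorem nodup_explore (k : ℕ) : (explore φ k).Nodup := by
  induction k with
  | zero => exact List.nodup_singleton _
  | succ k ih => classical exact ih.union _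

/-- Distinct codes decode to histories of distinct reachable states, whose number is bounded by
`reachable_finite`. -/
theorem length_explore_le (k : ℕ) : (explore φ k).length ≤ 2 ^ 2 ^ (input n φ).size := by
  classical
  obtain ⟨hf, hc⟩ := reachable_finite φ
  rw [Nat.card_eq_fintype_card, Fintype.card_fin] at hc
  refine le_trans ?_ (hc.trans (card_states_le φ))
  have hnd := nodup_explore (φ := φ) k
  rw [← List.toFinset_card_of_nodup hnd, ← Set.ncard_coe_finset]
  refine Set.ncard_le_ncard_of_injOn (fun d => stateAt φ (decode φ d)) ?_ ?_ hf
  · exact fun d _ => (reachable_iff_stateAt φ _).2 ⟨_, rfl⟩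
  · intro d hd d' hd' e
    have h1 := stateCode_decode (stateCode_of_mem_explore (List.mem_toFinset.1 hd))
    have h2 := stateCode_decode (stateCode_of_mem_explore (List.mem_toFinset.1 hd'))
    rw [← h1, ← h2]
    exact stateCode_eq_iff.2 e

/-- Each round either leaves the list unchanged, and then so do all later rounds, or makes it
longer. Growth in every round up to this one would exceed the bound on the number of states. -/
theorem explore_closed : explore φ (2 ^ 2 ^ (input n φ).size + 1) = explore φ (2 ^ 2 ^ (input n φ).size) := by
  have key : ∀ k, explore φ (k + 1) = explore φ k ∨ k + 1 ≤ (explore φ k).length := by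
    intro k
    induction k with
    | zero => exact .inr le_rfl
    | succ k ih =>
      by_cases h : explore φ (k + 1) = explore φ k
      · left
        conv_lhs => rw [explore, h]
        rfl
      · right
        have h1 := ih.resolve_left h
        have h2 := (suffix_explore_succ (φ := φ) k).length_le
        have h3 : (explore φ k).length ≠ (explore φ (k + 1)).length := fun e =>
          h ((suffix_explore_succ k).eq_of_length e).symm
        omega
  refine (key _).resolve_right fun h => ?_
  have := length_explore_le (φ := φ) (2 ^ 2 ^ (input n φ).size)
  omega

variable (φ) in
/-- The codes of all states. -/
noncomputable def states : List Dat := explore φ (2 ^ 2 ^ (input n φ).size)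

theorem mem_explore_zero (k : ℕ) : stateCode φ [] ∈ explore φ k := by
  induction k with
  | zero => exact List.mem_singleton.2 rfl
  | succ k ih => exact mem_explore_succ.2 (.inr ih)

theorem stateCode_mem_states (u : List (Set (Fin n))) : stateCode φ u ∈ states φ := by
  induction u with
  | nil => exact mem_explore_zero _
  | cons ν u ih =>
    rw [states, ← explore_closed]
    obtain ⟨l, hl, rfl⟩ := exists_letter ν
    exact mem_explore_succ.2 (.inl ⟨_, ih, l, hl, stateCode_cons_congr (stateCode_decode ⟨u, rfl⟩) _⟩)

end Explore

/-! ### Computation of the list of states. -/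

namespace PT

variable {ι : Type} {a : ι → Dat} {n : ι → ℕ} {φ : ∀ i, Formula (Fin (n i))}
  {l : ι → List ℕ} {u : ∀ i, List (Set (Fin (n i)))}

theorem stateInit (h : PT a (fun i => base (φ i))) :
    PT a (fun i => stateCode (φ i) []) :=
  (mkFun h h.baseFormula fun i => self_mem_subformulas (φ i)).cons
    (map (g := fun i χ => .cons (formula χ) (tokensCode (φ i) χ [])) h.baseRecList
      (left.cons (tokensInit (χ := fun p : Members fun i => recList (φ i) => p.2.1) (h.lift Sigma.fst) left
        fun p => mem_recList.1 p.2.2)))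

theorem stateStep (h : PT a (fun i => base (φ i)))
    (hu : PT a (fun i => stateCode (φ i) (u i)))
    (hl : PT a (fun i => list ((l i).map unary))) :
    PT a (fun i => stateCode (φ i) (letterSet (n i) (l i) :: u i)) := by
  have hm : PT a (fun i => funCode (φ i) (masterAt (φ i) (u i))) := hu.hd.congr fun i => by rw [stateCode, Dat.hd]
  have ht : PT a (fun i => list ((recList (φ i)).map fun χ =>
    .cons (formula χ) (tokensCode (φ i) χ (u i)))) :=
    hu.tl.congr fun i => by rw [stateCode, Dat.tl]
  have hm' : PT a (fun i => funCode (φ i) (masterAt (φ i) (letterSet (n i) (l i) :: u i))) :=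
    (unfNextFun h (fun i => supp_masterAt _ _) hm hl).congr fun i => by rw [← masterAt_cons]
  refine hm'.cons (map (g := fun i χ => .cons (formula χ)
      (tokensCode (φ i) χ (letterSet (n i) (l i) :: u i))) ht ?_)
  have hf : PT (fun p : Members fun i => recList (φ i) => .cons (.cons (formula p.2.1)
      (tokensCode (φ p.1) p.2.1 (u p.1))) (a p.1)) (fun p => formula p.2.1) := left.hd
  exact hf.cons (tokensStep (h.lift Sigma.fst) hf (fun p => mem_recList.1 p.2.2) left.tl
    (hl.lift Sigma.fst))

theorem stateSteps (h : PT a (fun i => base (φ i)))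
    (hu : PT a (fun i => stateCode (φ i) (u i))) :
    PT a (fun i => list ((letters (n i)).map fun l => stateCode (φ i) (letterSet (n i) l :: u i))) :=
  map h.baseLetters (stateStep (h.lift Sigma.fst) (hu.lift Sigma.fst) left)

theorem statesList (h : PT a (fun i => base (φ i))) :
    PT a (fun i => list (states (φ i))) := by
  classical
  have hz : PB a (fun i => 2 ^ 2 ^ (input (n i) (φ i)).size * (1 + (base (φ i)).size +
      ((base (φ i)).size * (1 + (base (φ i)).size +
      ((base (φ i)).size * ((base (φ i)).size + 1) + 1) + 1) + 1) + 1) + 1) := by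
    have hb := h.size
    have h1 := PB.const (a := a) 1
    refine ((hb.mono fun i => fuel_le_base _).mul (((h1.add hb).add ((hb.mul (((h1.add hb).add
      ((hb.mul (hb.add h1)).add h1)).add h1)).add h1)).add h1)).add h1
  -- The unary number in `base` serves as the counter for the rounds of the exploration.
  have := iterate (l := fun i => List.replicate (2 ^ 2 ^ (input (n i) (φ i)).size) Dat.nil)
    (h.baseFuel.congr fun i => unary_eq _) (s := fun i k => list (explore (φ i) k))
    ((stateInit h).cons nil) hz (fun i k => ?_) ?_
  · exact this.congr fun i => by rw [List.length_replicate, states]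
  · refine (size_list_le fun x hx => ?_).trans
      (Nat.add_le_add_right (Nat.mul_le_mul_right _ (length_explore_le k)) 1)
    obtain ⟨u, rfl⟩ := stateCode_of_mem_explore hx
    exact size_stateCode_le _ u
  · refine union (flatMap (α := fun _ => Dat) (f := fun _ x => x)
      (l := fun p : ι × ℕ => explore (φ p.1) p.2) (left.congr fun p => by rw [List.map_id']) ?_) left
    have hb : PT (fun q : Members (fun p : ι × ℕ => explore (φ p.1) p.2) => .cons q.2.1
        (.cons (list (explore (φ q.1.1) q.1.2)) (a q.1.1))) (fun q => base (φ q.1.1)) :=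
      h.lift₂ fun q : Members (fun p : ι × ℕ => explore (φ p.1) p.2) => q.1.1
    have hu : PT (fun q : Members (fun p : ι × ℕ => explore (φ p.1) p.2) => .cons q.2.1
        (.cons (list (explore (φ q.1.1) q.1.2)) (a q.1.1)))
        (fun q => stateCode (φ q.1.1) (decode (φ q.1.1) q.2.1)) :=
      left.congr fun q => (stateCode_decode (stateCode_of_mem_explore q.2.2)).symm
    exact stateSteps hb hu

end PT

end FLTL

namespace FLTL

open Formula Enc

/-! ## The automaton on numbered states -/

section Numbered

/-- Substituting `ff` amounts to evaluating under an assignment from which `Y` has been removed, so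
no substituted formula has to be computed. -/
theorem BFun.holds_substFF_iff {Ap : Type u} (V : Formula Ap → Prop) (Y : Set (Formula Ap)) (β : BFun Ap) :
    (β.substFF Y).Holds V ↔ β.Holds (fun θ => V θ ∧ θ ∉ Y) := by
  induction β using Quotient.inductionOn with
  | h φ =>
    change PSat V (φ.substFF Y) ↔ PSat (fun θ => V θ ∧ θ ∉ Y) φ
    induction φ with
    | tt => exact Iff.rfl
    | ff => exact Iff.rfl
    | and φ ψ ih₁ ih₂ => exact and_congr ih₁ ih₂
    | or φ ψ ih₁ ih₂ => exact or_congr ih₁ ih₂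
    | _ =>
      simp only [Formula.substFF]
      split <;> simp_all [PSat]

theorem mem_gTokens {Ap : Type u} (χ : Formula Ap) (u : List (Set Ap)) (ψ : BFun Ap) :
    ψ ∈ gTokens χ (slaveAt u χ) ↔ χ.tag = 8 ∧ ψ ∈ tokensAt χ u := by
  cases χ with
  | G ξ => exact ⟨fun h => ⟨rfl, (mem_tokensAt _ _ _).2 h⟩, fun h => (mem_tokensAt _ _ _).1 h.2⟩
  | _ => exact ⟨fun h => absurd h (Set.notMem_empty ψ), fun h => by simp [Formula.tag] at h⟩

variable {n : ℕ} {φ : Formula (Fin n)}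

open Classical in
-- Assumptions, tokens and master formula depend only on the subformulas, so the quantifier over all
-- assignments reduces to the finite list `assigns φ`.
theorem proves_extendedAssumptions_iff {R : List (Formula (Fin n))} (hR : ∀ χ ∈ R, χ ∈ φ.recs)
    (u : List (Set (Fin n))) :
    BFun.Proves (extendedAssumptions φ R.toFinset (stateAt φ u).2) (masterAt φ u) ↔
      ∀ A ∈ assigns φ, (∀ χ ∈ R, χ ∈ A) → (∀ χ ∈ R, χ.tag = 8 → ∀ ψ ∈ canon φ (tokensAt χ u),
        ψ.Holds fun θ => θ ∈ A ∧ (θ ∈ recList φ → θ ∈ R)) → (masterAt φ u).Holds (· ∈ A) := by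
  have hs : ∀ χ ∈ R, ∀ ψ ∈ tokensAt χ u, Supp φ ψ := fun χ hχ ψ hψ =>
    supp_of_mem_tokensAt (mem_recs.1 (hR χ hχ)).1 hψ
  have key : ∀ V : Formula (Fin n) → Prop,
      (∀ β ∈ extendedAssumptions φ R.toFinset (stateAt φ u).2, β.Holds V) ↔
      (∀ χ ∈ R, V χ) ∧ (∀ χ ∈ R, χ.tag = 8 → ∀ ψ ∈ canon φ (tokensAt χ u),
        ψ.Holds fun θ => V θ ∧ (θ ∈ recList φ → θ ∈ R)) := by
    intro V
    have hY : ∀ θ, θ ∉ {θ | θ ∈ φ.recs ∧ θ ∉ R.toFinset} ↔ (θ ∈ recList φ → θ ∈ R) := fun θ => by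
      simp [mem_recList]
    constructor
    · refine fun h => ⟨fun χ hχ => ?_, fun χ hχ ht ψ hψ => ?_⟩
      · exact (psat_of_isRec (mem_recs.1 (hR χ hχ)).2).1 (h (.mk χ) (.inl ⟨χ, by simpa using hχ, rfl⟩))
      · have := h _ (.inr ⟨⟨χ, hR χ hχ⟩, by simpa using hχ, ψ, (mem_gTokens χ u ψ).2 ⟨ht, ?_⟩, rfl⟩)
        · rw [BFun.holds_substFF_iff] at this
          simpa only [hY] using this
        · exact (canon_perm (hs χ hχ)).mem_iff.1 hψ
    · rintro ⟨h1, h2⟩ _ (⟨χ, hχ, rfl⟩ | ⟨χ, hχ, ψ, hψ, rfl⟩)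
      · have hχ : χ ∈ R := by simpa using hχ
        exact (psat_of_isRec (mem_recs.1 (hR χ hχ)).2).2 (h1 χ hχ)
      · have hχ : χ.1 ∈ R := by simpa using hχ
        obtain ⟨ht, hm⟩ := (mem_gTokens χ.1 u ψ).1 hψ
        rw [BFun.holds_substFF_iff]
        simpa only [hY] using h2 χ.1 hχ ht ψ ((canon_perm (hs χ.1 hχ)).mem_iff.2 hm)
  constructor
  · exact fun h A _ h1 h2 => h _ ((key _).2 ⟨h1, h2⟩)
  · intro h V hV
    obtain ⟨h1, h2⟩ := (key V).1 hV
    rw [← (supp_masterAt φ u).holds_filter V]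
    have hmem : ∀ θ ∈ φ.subformulas, θ ∈ (subs φ).filter (fun χ => decide (V χ)) ↔ V θ :=
      fun θ hθ => by simp [mem_subs.2 hθ]
    refine h _ (filter_mem_assigns φ _) (fun χ hχ => (hmem χ (mem_recs.1 (hR χ hχ)).1).2 (h1 χ hχ))
      fun χ hχ ht ψ hψ => ?_
    refine (hs χ hχ ψ ((canon_perm (hs χ hχ)).mem_iff.1 hψ) _ _ fun θ hθ => ?_).1 (h2 χ hχ ht ψ hψ)
    rw [hmem θ hθ]

variable (φ) in
/-- A history that leads to the state with the given number. -/
noncomputable def histOf (q : Fin (states φ).length) : List (Set (Fin n)) := decode φ (states φ)[q]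

theorem stateCode_histOf (q : Fin (states φ).length) : stateCode φ (histOf φ q) = (states φ)[q] :=
  stateCode_decode (stateCode_of_mem_explore (List.getElem_mem _))

open Classical in
variable (φ) in
/-- The number of the state that a history leads to. -/
noncomputable def stateIdx (u : List (Set (Fin n))) : Fin (states φ).length :=
  ⟨(states φ).idxOf (stateCode φ u), List.idxOf_lt_length_iff.2 (stateCode_mem_states u)⟩

theorem stateAt_histOf_stateIdx (u : List (Set (Fin n))) :
    stateAt φ (histOf φ (stateIdx φ u)) = stateAt φ u := by
  classical
  rw [← stateCode_eq_iff, stateCode_histOf]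
  exact List.getElem_idxOf _

theorem stateIdx_histOf (q : Fin (states φ).length) : stateIdx φ (histOf φ q) = q := by
  classical
  refine Fin.ext ?_
  change (states φ).idxOf (stateCode φ (histOf φ q)) = q
  rw [stateCode_histOf]
  exact (nodup_explore _).idxOf_getElem _ _

variable (φ) in
/-- The numbering of the states. -/
noncomputable def stateEquiv : Fin (states φ).length ≃ AutState φ :=
  Equiv.ofBijective (fun q => ⟨stateAt φ (histOf φ q), (reachable_iff_stateAt φ _).2 ⟨_, rfl⟩⟩) (by
    constructor
    · intro q q' h
      have h := stateCode_eq_iff.2 (congrArg Subtype.val h)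
      rw [← stateIdx_histOf q, ← stateIdx_histOf q', stateIdx, stateIdx]
      simp only [h]
    · rintro ⟨q, hq⟩
      obtain ⟨u, rfl⟩ := (reachable_iff_stateAt φ q).1 hq
      exact ⟨stateIdx φ u, Subtype.ext (stateAt_histOf_stateIdx u)⟩)

open Classical in
variable (φ) in
/-- The automaton of a formula, with numbered states. -/
noncomputable def numbered : DGRMA (Set (Fin n)) (Fin (states φ).length) where
  init := stateIdx φ []
  step q ν := some (stateIdx φ (ν :: histOf φ q))
  acc := (recList φ).sublists'.map fun R =>
    (masterAcc φ R.toFinset).comap (fun q => stateAt φ (histOf φ q)) ::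
      R.map fun χ => (slaveAcc (BFun.mk '' {θ | θ ∈ R}) χ).comap (fun q => slaveAt (histOf φ q) χ)

theorem comap_comap {Q Q' Q'' : Type v} (f : Q' → Q) (g : Q'' → Q') (x : AccVar Q) :
    (x.comap f).comap g = x.comap (f ∘ g) := by
  cases x <;> rfl

open Classical in
theorem clause_numbered {R : List (Formula (Fin n))} (hR : R ∈ (recList φ).sublists') :
    (((masterAcc φ R.toFinset).comap (fun q => stateAt φ (histOf φ q)) ::
      R.map fun χ => (slaveAcc (BFun.mk '' {θ | θ ∈ R}) χ).comap (fun q => slaveAt (histOf φ q) χ) :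
      List (AccVar (Fin (states φ).length))) : Multiset (AccVar (Fin (states φ).length))) =
    ((((clause φ R.toFinset).map (AccVar.comap Subtype.val)).map (AccVar.comap (stateEquiv φ)) :
      List (AccVar (Fin (states φ).length))) : Multiset (AccVar (Fin (states φ).length))) := by
  have hR' := List.mem_sublists'.1 hR
  rw [clause, List.map_cons, List.map_cons, List.map_map, List.map_map, comap_comap, Multiset.coe_eq_coe]
  refine List.Perm.cons _ ?_
  have hsub : ∀ χ ∈ R, χ ∈ φ.recs := fun χ hχ => mem_recList.1 (hR'.subset hχ)
  have hset : ((R.toFinset : Finset (Formula (Fin n))) : Set (Formula (Fin n))) = {θ | θ ∈ R} := by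
    ext; simp
  -- The order of the conjuncts in `clause` is an arbitrary enumeration of a finite set; it agrees
  -- with the computable order up to permutation.
  have hperm : (φ.recs.attach.filter (fun χ => χ.1 ∈ R.toFinset)).toList.Perm
      (R.attach.map fun χ => ⟨χ.1, hsub χ.1 χ.2⟩) := by
    refine (List.perm_ext_iff_of_nodup (Finset.nodup_toList _) ?_).2 fun χ => ?_
    · refine (List.nodup_attach.2 (hR'.nodup (nodup_recList φ))).map fun x y h => ?_
      exact Subtype.ext (Subtype.mk.inj h)
    · simp only [Finset.mem_toList, Finset.mem_filter, Finset.mem_attach, true_and, List.mem_toFinset,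
        List.mem_map, List.mem_attach]
      exact ⟨fun h => ⟨⟨χ.1, h⟩, rfl⟩, by rintro ⟨x, rfl⟩; exact x.2⟩
  refine List.Perm.trans ?_ (hperm.map _).symm
  have hatt : ∀ F : Formula (Fin n) → AccVar (Fin (states φ).length),
      R.map F = R.attach.map fun χ => F χ.1 := fun F => by simp
  rw [List.map_map, hatt]
  refine List.Perm.of_eq (List.map_congr_left fun χ _ => ?_)
  simp only [Function.comp_apply, comap_comap, hset]
  rfl

theorem same_iff {Q : Type v} {α β : GRMAcc Q} : α.Same β ↔
    (α.map (Multiset.ofList : _ → Multiset (AccVar Q))).Perm (β.map Multiset.ofList) := by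
  rw [GRMAcc.Same, Multiset.coe_eq_coe, List.map_id', List.map_id', List.bind_eq_flatMap,
    List.bind_eq_flatMap, List.map_eq_flatMap, List.map_eq_flatMap]
  rfl

theorem numbered_isIso : (numbered φ).IsIso (automaton φ) (stateEquiv φ) := by
  classical
  refine ⟨?_, fun q ν => ?_, ?_⟩
  · exact Subtype.ext ((stateAt_histOf_stateIdx []).trans (stateAt_nil φ))
  · simp only [numbered, Option.map_some, automaton, DGRMA.reach, LTS.reach, Option.pmap_eq_some_iff]
    refine ⟨_, .step (stateEquiv φ q).2 (step_stateAt φ (histOf φ q) ν), step_stateAt φ (histOf φ q) ν, ?_⟩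
    exact Subtype.ext (stateAt_histOf_stateIdx _)
  · have hacc : (automaton φ).acc.comap (stateEquiv φ) = φ.recs.powerset.toList.map fun R =>
        ((clause φ R).map (AccVar.comap Subtype.val)).map (AccVar.comap (stateEquiv φ)) := by
      change ((φ.recs.powerset.toList.map (clause φ)).map _).map _ = _
      rw [List.map_map, List.map_map]
      rfl
    -- Since `recList φ` has no duplicates, its sublists correspond bijectively to the sets `R`.
    have hperm : φ.recs.powerset.toList.Perm ((recList φ).sublists'.map List.toFinset) := by
      refine (List.perm_ext_iff_of_nodup (Finset.nodup_toList _) ?_).2 fun R => ?_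
      · refine List.Nodup.map_on ?_ (List.nodup_sublists'.2 (nodup_recList φ))
        intro x hx y hy h
        refine (nodup_recList φ).perm_iff_eq_of_sublist (List.mem_sublists'.1 hx) (List.mem_sublists'.1 hy) |>.1 ?_
        exact List.perm_of_nodup_nodup_toFinset_eq ((List.mem_sublists'.1 hx).nodup (nodup_recList φ))
          ((List.mem_sublists'.1 hy).nodup (nodup_recList φ)) h
      · simp only [Finset.mem_toList, Finset.mem_powerset, List.mem_map, List.mem_sublists']
        constructor
        · intro h
          refine ⟨(recList φ).filter (fun χ => decide (χ ∈ R)), List.filter_sublist, ?_⟩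
          ext χ
          simp only [List.mem_toFinset, List.mem_filter, decide_eq_true_eq, mem_recList]
          exact ⟨fun h => h.2, fun h' => ⟨h h', h'⟩⟩
        · rintro ⟨l, hl, rfl⟩ χ hχ
          exact mem_recList.1 (hl.subset (List.mem_toFinset.1 hχ))
    rw [hacc, same_iff, List.map_map]
    refine List.Perm.trans ?_ (hperm.map _).symm
    rw [numbered, List.map_map, List.map_map]
    exact List.Perm.of_eq (List.map_congr_left fun R hR => clause_numbered hR)

end Numbered

end FLTL

namespace FLTL

open Formula Enc

/-! ## The code of the automaton -/

section Output

variable {n : ℕ} {φ : Formula (Fin n)}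

theorem stateSet_eq {S : Set (Fin (states φ).length)} {P : Dat → Prop}
    (h : ∀ q : Fin (states φ).length, q ∈ S ↔ P (states φ)[q]) :
    stateSet S = list ((states φ).map fun d => bit (P d)) := by
  rw [← List.ofFn_getElem_eq_map]
  unfold stateSet bit
  congr 2
  funext q
  congr 2
  exact propext (h q)

theorem rat_natCast (k : ℕ) : Enc.rat (k : ℚ) = list [Enc.bool false, Enc.binary k, Enc.binary 1] := by
  simp [Enc.rat, not_lt.2 (Nat.cast_nonneg (α := ℚ) k)]

/-- The acceptance condition of the slave of `χ` on the numbered states. -/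
noncomputable def slaveVar (φ : Formula (Fin n)) (R : List (Formula (Fin n))) (χ : Formula (Fin n)) :
    AccVar (Fin (states φ).length) :=
  (slaveAcc (BFun.mk '' {θ | θ ∈ R}) χ).comap (fun q => slaveAt (histOf φ q) χ)

variable {R : List (Formula (Fin n))} {χ : Formula (Fin n)}

theorem mem_canon_iff (hχ : χ ∈ φ.recs) (u : List (Set (Fin n))) (ψ : BFun (Fin n)) :
    ψ ∈ canon φ (tokensAt χ u) ↔ ψ ∈ tokenSet χ.body (hist u) u.length := by
  rw [(canon_perm fun _ hβ => supp_of_mem_tokensAt (mem_recs.1 hχ).1 hβ).mem_iff, mem_tokensAt]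

theorem proves_mk_iff (hR : ∀ θ ∈ R, θ ∈ φ.recs) (ψ : BFun (Fin n)) :
    BFun.Proves (BFun.mk '' {θ | θ ∈ R}) ψ ↔ ψ.Holds (· ∈ R) :=
  BFun.proves_iff (fun θ hθ => isRec_of_mem_recs (hR θ hθ)) ψ

theorem accVar_slaveVar_F (hR : ∀ θ ∈ R, θ ∈ φ.recs) (hχ : χ ∈ φ.recs) (ht : χ.tag = 7) :
    accVar (slaveVar φ R χ) = list [unary 0, list ((states φ).map fun d =>
      bit (∃ ψ ∈ canon φ (tokensAt χ (decode φ d)), ψ.IsSink ∧ ψ.Holds (· ∈ R)))] := by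
  cases χ with
  | F ξ =>
    simp only [slaveVar, slaveAcc, AccVar.comap, accVar]
    congr 3
    refine stateSet_eq fun q => exists_congr fun ψ => ?_
    exact and_congr (mem_canon_iff hχ _ ψ).symm (and_congr Iff.rfl (proves_mk_iff hR ψ))
  | _ => simp [Formula.tag] at ht

theorem accVar_slaveVar_G (hR : ∀ θ ∈ R, θ ∈ φ.recs) (hχ : χ ∈ φ.recs) (ht : χ.tag = 8) :
    accVar (slaveVar φ R χ) = list [unary 1, list ((states φ).map fun d =>
      bit (∃ ψ ∈ canon φ (tokensAt χ (decode φ d)), ψ.IsSink ∧ ¬ ψ.Holds (· ∈ R)))] := by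
  cases χ with
  | G ξ =>
    simp only [slaveVar, slaveAcc, AccVar.comap, accVar]
    congr 3
    refine stateSet_eq fun q => exists_congr fun ψ => ?_
    exact and_congr (mem_canon_iff hχ _ ψ).symm (and_congr Iff.rfl (not_congr (proves_mk_iff hR ψ)))
  | _ => simp [Formula.tag] at ht

open Classical in
theorem accVar_slaveVar_freq (hR : ∀ θ ∈ R, θ ∈ φ.recs) (hχ : χ ∈ φ.recs) (ht : χ.tag = 10) :
    accVar (slaveVar φ R χ) = list [unary 2, (formula χ).tl.hd, (formula χ).tl.tl.hd,
      (formula χ).tl.tl.tl.hd, list ((states φ).map fun d =>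
        list [Enc.bool false, Enc.binary ((canon φ (tokensAt χ (decode φ d))).filter
          (fun ψ => decide (ψ.IsSink ∧ ψ.Holds (· ∈ R)))).length, Enc.binary 1])] := by
  cases χ with
  | freq e c p ξ =>
    simp only [slaveVar, slaveAcc, AccVar.comap, accVar]
    congr 6
    rw [← List.ofFn_getElem_eq_map]
    congr 2
    funext q
    rw [← rat_natCast]
    congr 1
    -- The reward is a sum over token counts; these are the multiplicities in the canonical token
    -- list, so the reward is the length of a filtered list.
    have h1 : tokenCount ξ (hist (histOf φ q)) (histOf φ q).length =
        tally (canon φ (tokensAt (.freq e c p ξ) (histOf φ q))) := by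
      rw [tally_eq_iff.2 (canon_perm fun _ hβ => supp_of_mem_tokensAt (mem_recs.1 hχ).1 hβ),
        tally_tokensAt rfl]
      rfl
    refine (congrArg (fun f : BFun (Fin n) →₀ ℕ => f.sum fun ψ k =>
      if ψ.IsSink ∧ BFun.Proves (BFun.mk '' {θ | θ ∈ R}) ψ then (k : ℚ) else 0) h1).trans ?_
    simp only [proves_mk_iff hR]
    rw [sum_tally]
    · change _ = ((((canon φ (tokensAt (.freq e c p ξ) (histOf φ q))).filter _).length : ℕ) : ℚ)
      generalize canon φ (tokensAt (.freq e c p ξ) (histOf φ q)) = m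
      induction m with
      | nil => simp
      | cons ψ m ih =>
        rw [List.map_cons, List.sum_cons, ih]
        by_cases h : ψ.IsSink ∧ ψ.Holds (· ∈ R)
        · rw [if_pos h, List.filter_cons_of_pos (by simpa using h), List.length_cons]
          push_cast
          ring
        · rw [if_neg h, List.filter_cons_of_neg (by simpa using h), zero_add]
    · intro ψ; split <;> simp
    · intro ψ i j; split <;> simp
  | _ => simp [Formula.tag] at ht

open Classical in
-- All entries are expressed through the codes in `states φ`, so that the output arises by mapping
-- over this list.
theorem automaton_numbered : Enc.automaton (numbered φ) =
    list [unary ((states φ).idxOf (stateCode φ [])),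
      list ((states φ).map fun d => list ((letters n).map fun l =>
        .cons (unary ((states φ).idxOf (stateCode φ (letterSet n l :: decode φ d)))) .nil)),
      list ((recList φ).sublists'.map fun R => list (list [unary 1, list ((states φ).map fun d =>
        bit (¬ BFun.Proves (extendedAssumptions φ R.toFinset (stateAt φ (decode φ d)).2)
          (masterAt φ (decode φ d))))] :: R.map fun χ => accVar (slaveVar φ R χ)))] := by
  have h1 : ∀ d, (letters n).map (fun l => Dat.cons
      (unary ((states φ).idxOf (stateCode φ (letterSet n l :: decode φ d)))) .nil) = _ := fun d =>
    map_letterSet_letters (fun ν => Dat.cons (unary ((states φ).idxOf (stateCode φ (ν :: decode φ d)))) .nil)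
  simp only [h1]
  rw [Enc.automaton, ← List.ofFn_getElem_eq_map (states φ)]
  congr 3
  congr 1
  simp only [numbered]
  rw [List.map_map]
  refine congrArg list (List.map_congr_left fun R _ => ?_)
  simp only [Function.comp_apply, List.map_cons, List.map_map]
  congr 2
  simp only [masterAcc, AccVar.comap, accVar]
  congr 3
  exact stateSet_eq fun q => Iff.rfl

end Output

/-! ### Computation of the acceptance condition and of the whole output. -/

namespace PT

section Acceptance

variable {ι : Type} {a : ι → Dat} {n : ι → ℕ} {φ : ∀ i, Formula (Fin (n i))}
  {χ : ∀ i, Formula (Fin (n i))} {u : ∀ i, List (Set (Fin (n i)))}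
  {R A : ∀ i, List (Formula (Fin (n i)))}

/-- A state code stores the tokens keyed by formula; as `recList` has no duplicates, filtering by
the key leaves one entry. -/
theorem tokensOf (hu : PT a (fun i => stateCode (φ i) (u i))) (hχ : PT a (fun i => formula (χ i)))
    (hm : ∀ i, χ i ∈ (φ i).recs) : PT a (fun i => tokensCode (φ i) (χ i) (u i)) := by
  classical
  have ht : PT a (fun i => list ((recList (φ i)).map fun χ =>
    .cons (formula χ) (tokensCode (φ i) χ (u i)))) := hu.tl.congr fun i => by rw [stateCode, Dat.tl]
  refine (filter (Q := fun i θ => θ = χ i) ht ?_).hd.tl.congr fun i => ?_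
  · exact (left.hd.bitEq (hχ.lift Sigma.fst)).bitCongr fun p => (formula_injective _).eq_iff
  · have : (recList (φ i)).filter (fun θ => decide (θ = χ i)) = [χ i] := by
      have h1 := List.filter_eq (l := recList (φ i)) (χ i)
      rw [List.count_eq_one_of_mem (nodup_recList _) (mem_recList.2 (hm i))] at h1
      exact h1
    rw [this]
    rfl

theorem filterMem (h : PT a (fun i => base (φ i)))
    (hA : PT a (fun i => assignCode (A i))) :
    PT a (fun i => list (((subs (φ i)).filter (fun θ =>
      @decide (θ ∈ A i) (Classical.propDecidable _))).map formula)) :=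
  filter (Q := fun i θ => θ ∈ A i) h.baseSubs
    (bitMemMap (fun _ => formula_injective _) left (hA.lift Sigma.fst))

open Classical in
theorem bitTokensHold {V : ∀ i, Formula (Fin (n i)) → Prop}
    (hu : PT a (fun i => stateCode (φ i) (u i)))
    (hχ : PT a (fun i => formula (χ i))) (hm : ∀ i, χ i ∈ (φ i).recs)
    (hV : PT a (fun i => list (((subs (φ i)).filter (fun θ => decide (V i θ))).map formula))) :
    PT a (fun i => bit (∀ ψ ∈ canon (φ i) (tokensAt (χ i) (u i)), ψ.Holds (V i))) :=
  bitAll (Q := fun i ψ => ψ.Holds (V i)) (tokensOf hu hχ hm)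
    (bitHolds (fun p => supp_of_mem_canon (mem_recs.1 (hm p.1)).1 p.2.2) left (hV.lift Sigma.fst))

open Classical in
theorem bitAssumptionsHold {V : ∀ i, Formula (Fin (n i)) → Prop}
    (hu : PT a (fun i => stateCode (φ i) (u i)))
    (hR : PT a (fun i => assignCode (R i))) (hm : ∀ i, ∀ χ ∈ R i, χ ∈ (φ i).recs)
    (hV : PT a (fun i => list (((subs (φ i)).filter (fun θ => decide (V i θ))).map formula))) :
    PT a (fun i => bit (∀ χ ∈ R i, χ.tag = 8 → ∀ ψ ∈ canon (φ i) (tokensAt χ (u i)), ψ.Holds (V i))) := by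
  refine bitAll (Q := fun i χ => χ.tag = 8 → ∀ ψ ∈ canon (φ i) (tokensAt χ (u i)), ψ.Holds (V i)) hR ?_
  have hχ : PT (fun p : Members R => .cons (formula p.2.1) (a p.1)) (fun p => formula p.2.1) := left
  exact ((hχ.tag.bitEq (const (unary 8))).bitCongr fun p => unary_eq_unary).bitImp
    (bitTokensHold (hu.lift Sigma.fst) hχ (fun p => hm p.1 _ p.2.2) (hV.lift Sigma.fst))

theorem bitAssignment (h : PT a (fun i => base (φ i)))
    (hu : PT a (fun i => stateCode (φ i) (u i)))
    (hR : PT a (fun i => assignCode (R i))) (hm : ∀ i, ∀ χ ∈ R i, χ ∈ (φ i).recs)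
    (hA : PT a (fun i => assignCode (A i))) :
    PT a (fun i => bit ((∀ χ ∈ R i, χ ∈ A i) → (∀ χ ∈ R i, χ.tag = 8 →
      ∀ ψ ∈ canon (φ i) (tokensAt χ (u i)),
        ψ.Holds fun θ => θ ∈ A i ∧ (θ ∈ recList (φ i) → θ ∈ R i)) →
      (masterAt (φ i) (u i)).Holds (· ∈ A i))) := by
  classical
  have h1 : PT a (fun i => bit (∀ χ ∈ R i, χ ∈ A i)) :=
    bitAll (Q := fun i χ => χ ∈ A i) hR
      (bitMemMap (fun _ => formula_injective _) left (hA.lift Sigma.fst))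
  have hV : PT a (fun i => list (((subs (φ i)).filter (fun θ => decide (θ ∈ A i ∧
      (θ ∈ recList (φ i) → θ ∈ R i)))).map formula)) := by
    refine (filter (Q := fun i θ => θ ∈ A i ∧ (θ ∈ recList (φ i) → θ ∈ R i)) h.baseSubs
      ((bitMemMap (fun _ => formula_injective _) left (hA.lift Sigma.fst)).bitAnd
        ((bitMemMap (fun _ => formula_injective _) left (h.baseRecList.lift Sigma.fst)).bitImp
        (bitMemMap (fun _ => formula_injective _) left (hR.lift Sigma.fst))))).congr fun i => by congr!
  have hm' : PT a (fun i => funCode (φ i) (masterAt (φ i) (u i))) :=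
    hu.hd.congr fun i => by rw [stateCode, Dat.hd]
  have hV' := bitAssumptionsHold (V := fun i θ => θ ∈ A i ∧ (θ ∈ recList (φ i) → θ ∈ R i)) hu hR hm
    (hV.congr fun i => by congr!)
  exact h1.bitImp (hV'.bitImp (bitHolds (V := fun i θ => θ ∈ A i)
    (fun i => supp_masterAt _ _) hm' (filterMem h hA)))

open Classical in
theorem bitMaster (h : PT a (fun i => base (φ i)))
    (hu : PT a (fun i => stateCode (φ i) (u i)))
    (hR : PT a (fun i => assignCode (R i))) (hm : ∀ i, ∀ χ ∈ R i, χ ∈ (φ i).recs) :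
    PT a (fun i => bit (BFun.Proves (extendedAssumptions (φ i) (R i).toFinset (stateAt (φ i) (u i)).2)
      (masterAt (φ i) (u i)))) := by
  refine (bitAll h.baseAssigns (bitAssignment (h.lift Sigma.fst) (hu.lift Sigma.fst) (hR.lift Sigma.fst)
    (fun p => hm p.1) left)).bitCongr fun i => (proves_extendedAssumptions_iff (hm i) (u i)).symm

/-- A listed code is itself the code of the state reached by its decoded history, so histories never
have to be computed. -/
theorem mapStates (h : PT a (fun i => base (φ i)))
    {g : ι → Dat → Dat}
    (hg : ∀ (κ : Type) (r : κ → ι) (d : κ → Dat) (_ : ∀ k, d k ∈ states (φ (r k))),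
      PT (fun k => .cons (d k) (a (r k))) (fun k => stateCode (φ (r k)) (decode (φ (r k)) (d k))) →
      PT (fun k => .cons (d k) (a (r k))) (fun k => g (r k) (d k))) :
    PT a (fun i => list ((states (φ i)).map (g i))) :=
  map (α := fun _ => Dat) (f := fun _ x => x) ((statesList h).congr fun _ => by
    rw [List.map_id'])
    (hg (Members fun i => states (φ i)) Sigma.fst (fun p => p.2.1) (fun p => p.2.2) (left.congr fun p =>
      (stateCode_decode (stateCode_of_mem_explore p.2.2)).symm))

theorem slaveVarCode (h : PT a (fun i => base (φ i)))
    (hR : PT a (fun i => assignCode (R i))) (hm : ∀ i, ∀ χ ∈ R i, χ ∈ (φ i).recs)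
    (hχ : PT a (fun i => formula (χ i))) (hχm : ∀ i, χ i ∈ (φ i).recs) :
    PT a (fun i => accVar (slaveVar (φ i) (R i) (χ i))) := by
  classical
  have hV := filterMem h hR
  have hsink : ∀ (κ : Type) (r : κ → ι) (d : κ → Dat),
      PT (fun p : Members (fun k => canon (φ (r k)) (tokensAt (χ (r k)) (decode (φ (r k)) (d k)))) =>
        .cons (funCode (φ (r p.1)) p.2.1) (.cons (d p.1) (a (r p.1)))) (fun p => bit p.2.1.IsSink) ∧
      PT (fun p : Members (fun k => canon (φ (r k)) (tokensAt (χ (r k)) (decode (φ (r k)) (d k)))) =>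
        .cons (funCode (φ (r p.1)) p.2.1) (.cons (d p.1) (a (r p.1))))
        (fun p => bit (p.2.1.Holds (· ∈ R (r p.1)))) := fun κ r d =>
    let M := Members (fun k => canon (φ (r k)) (tokensAt (χ (r k)) (decode (φ (r k)) (d k))))
    ⟨bitSink (h.lift₂ fun p : M => r p.1) (fun p => supp_of_mem_canon (mem_recs.1 (hχm _)).1 p.2.2) left,
      bitHolds (V := fun (p : M) θ => θ ∈ R (r p.1))
        (fun p => supp_of_mem_canon (mem_recs.1 (hχm _)).1 p.2.2) left (hV.lift₂ fun p : M => r p.1)⟩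
  have htag : ∀ k, PT a (fun i => bit ((χ i).tag = k)) := fun k =>
    (hχ.tag.bitEq (const (unary k))).bitCongr fun i => unary_eq_unary
  have hF : PT a (fun i => list [unary 0, list ((states (φ i)).map fun d =>
      bit (∃ ψ ∈ canon (φ i) (tokensAt (χ i) (decode (φ i) d)), ψ.IsSink ∧ ψ.Holds (· ∈ R i)))]) :=
    (const _).cons ((mapStates h fun κ r d _ hd => bitEx (tokensOf hd (hχ.lift r) fun k => hχm (r k))
      ((hsink κ r d).1.bitAnd (hsink κ r d).2)).cons nil)
  have hG : PT a (fun i => list [unary 1, list ((states (φ i)).map fun d =>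
      bit (∃ ψ ∈ canon (φ i) (tokensAt (χ i) (decode (φ i) d)), ψ.IsSink ∧ ¬ ψ.Holds (· ∈ R i)))]) :=
    (const _).cons ((mapStates h fun κ r d _ hd => bitEx (tokensOf hd (hχ.lift r) fun k => hχm (r k))
      ((hsink κ r d).1.bitAnd (hsink κ r d).2.bitNot)).cons nil)
  have hfreq : PT a (fun i => list [unary 2, (formula (χ i)).tl.hd, (formula (χ i)).tl.tl.hd,
      (formula (χ i)).tl.tl.tl.hd, list ((states (φ i)).map fun d =>
        list [Enc.bool false, Enc.binary ((canon (φ i) (tokensAt (χ i) (decode (φ i) d))).filter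
          (fun ψ => decide (ψ.IsSink ∧ ψ.Holds (· ∈ R i)))).length, Enc.binary 1])]) := by
    refine (const _).cons (hχ.tl.hd.cons (hχ.tl.tl.hd.cons (hχ.tl.tl.tl.hd.cons
      ((mapStates h fun κ r d _ hd => (const _).cons (PT.cons ?_ ((const _).cons nil))).cons nil))))
    have := filter (Q := fun k ψ => ψ.IsSink ∧ ψ.Holds (· ∈ R (r k)))
      (tokensOf hd (hχ.lift r) fun k => hχm (r k)) ((hsink κ r d).1.bitAnd (hsink κ r d).2)
    exact this.binaryLength.congr fun k => by rw [List.length_map]; congr!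
  refine (htag 7).bitCases ((hF.precomp Subtype.val).congr fun i =>
    (accVar_slaveVar_F (hm i.1) (hχm i.1) i.2).symm) ?_
  refine ((htag 8).precomp Subtype.val).bitCases (((hG.precomp Subtype.val).precomp Subtype.val).congr
    fun i => (accVar_slaveVar_G (hm i.1.1) (hχm i.1.1) i.2).symm) ?_
  refine ((hfreq.precomp Subtype.val).precomp Subtype.val).congr fun i => ?_
  refine (accVar_slaveVar_freq (hm i.1.1) (hχm i.1.1) ?_).symm
  have h1 := isRec_of_mem_recs (hχm i.1.1)
  have h2 := i.2
  have h3 := i.1.2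
  revert h1 h2 h3
  cases χ i.1.1 <;> simp [Formula.tag, isRec]

theorem automatonCode (h : PT a (fun i => base (φ i))) :
    PT a (fun i => Enc.automaton (numbered (φ i))) := by
  classical
  have hst := statesList h
  have hinit : PT a (fun i => unary ((states (φ i)).idxOf (stateCode (φ i) []))) := idxOf (stateInit h) hst
  have hstep : PT a (fun i => list ((states (φ i)).map fun d => list ((letters (n i)).map fun l =>
      .cons (unary ((states (φ i)).idxOf (stateCode (φ i) (letterSet (n i) l :: decode (φ i) d)))) .nil))) := by
    refine mapStates h fun κ r d _ hd => ?_
    have hb : PT (fun k => .cons (d k) (a (r k))) (fun k => base (φ (r k))) := h.lift r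
    refine map hb.baseLetters ?_
    exact (idxOf (stateStep (hb.lift Sigma.fst) (hd.lift Sigma.fst) left)
      (hst.lift₂ fun p : Members (fun k => letters (n (r k))) => r p.1)).cons nil
  have hrec : PT a (fun i => list ((recList (φ i)).sublists'.map assignCode)) := by
    refine sublists h.baseRecList (h.size.mono fun i => le_trans ?_ (fuel_le_base _))
    refine Nat.pow_le_pow_right (by omega) (le_trans ?_ Nat.lt_two_pow_self.le)
    have h1 := (List.length_filter_le isRec (subs (φ i))).trans (length_subs_le (φ i))
    have h2 := size_input (n i) (φ i)
    exact h1.trans (by omega)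
  have hacc : PT a (fun i => list ((recList (φ i)).sublists'.map fun R => list (list [unary 1,
      list ((states (φ i)).map fun d => bit (¬ BFun.Proves (extendedAssumptions (φ i) R.toFinset
        (stateAt (φ i) (decode (φ i) d)).2) (masterAt (φ i) (decode (φ i) d))))] ::
      R.map fun χ => accVar (slaveVar (φ i) R χ)))) := by
    refine map hrec ?_
    have hb : PT (fun p : Members (fun i => (recList (φ i)).sublists') => .cons (assignCode p.2.1) (a p.1))
      (fun p => base (φ p.1)) := h.lift Sigma.fst
    have hR : PT (fun p : Members (fun i => (recList (φ i)).sublists') => .cons (assignCode p.2.1) (a p.1))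
      (fun p => assignCode p.2.1) := left
    have hm : ∀ p : Members (fun i => (recList (φ i)).sublists'), ∀ χ ∈ p.2.1, χ ∈ (φ p.1).recs :=
      fun p χ hχ => mem_recList.1 ((List.mem_sublists'.1 p.2.2).subset hχ)
    refine listCons ((const _).cons ((mapStates hb fun κ r d _ hd => ?_).cons nil)) (map hR ?_)
    · exact (bitMaster (hb.lift r) hd (hR.lift r) fun k => hm (r k)).bitNot
    · exact slaveVarCode (hb.lift Sigma.fst) (hR.lift Sigma.fst) (fun p => hm p.1) left
        fun p => hm p.1 _ p.2.2
  refine (hinit.cons (hstep.cons (hacc.cons nil))).congr fun i => ?_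
  rw [automaton_numbered]
  rfl

end Acceptance

end PT

end FLTL

namespace FLTL

open Formula Enc

/-! ## The subformulas of a formula -/

/-- One step of a traversal of the subformulas: the formulae still to be visited, and those visited. -/
def visit {n : ℕ} : List (Formula (Fin n)) × List (Formula (Fin n)) →
    List (Formula (Fin n)) × List (Formula (Fin n))
  | (χ :: t, out) => (χ.kids ++ t, χ :: out)
  | ([], out) => ([], out)

/-- The code of a stage of the traversal. -/
def visitCode {n : ℕ} (s : List (Formula (Fin n)) × List (Formula (Fin n))) : Dat :=
  .cons (list (s.1.map formula)) (list (s.2.map formula))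

theorem Formula.subformulas_eq {Ap : Type u} (χ : Formula Ap) :
    χ.subformulas = χ :: χ.kids.flatMap subformulas := by
  cases χ <;> simp [subformulas, kids]

/-- The direct subformulas replace the formula at the front of the agenda, so formulae are visited
in the order of `subformulas`. -/
theorem visit_invariant {n : ℕ} (s : List (Formula (Fin n)) × List (Formula (Fin n))) :
    (visit s).2.reverse ++ (visit s).1.flatMap subformulas = s.2.reverse ++ s.1.flatMap subformulas := by
  obtain ⟨_ | ⟨χ, t⟩, out⟩ := s
  · rfl
  · simp only [visit, List.flatMap_append, List.flatMap_cons, List.reverse_cons, χ.subformulas_eq]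
    simp

theorem Formula.sum_length_kids_lt {Ap : Type u} (χ : Formula Ap) :
    (χ.kids.map Formula.length).sum < χ.length := by
  cases χ <;> simp [kids, Formula.length]

theorem size_formula_le_of_mem {n : ℕ} {φ χ : Formula (Fin n)} (h : χ ∈ φ.subformulas) :
    (formula χ).size ≤ (formula φ).size := by
  induction φ with
  | and φ ψ ih₁ ih₂ | or φ ψ ih₁ ih₂ | U φ ψ ih₁ ih₂ =>
    simp only [subformulas, List.mem_cons, List.mem_append] at h
    rcases h with rfl | h | h
    · exact le_rfl
    · have := ih₁ h; simp only [formula, list, Dat.size]; omega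
    · have := ih₂ h; simp only [formula, list, Dat.size]; omega
  | X φ ih | F φ ih | G φ ih | freq e c p φ ih =>
    simp only [subformulas, List.mem_cons] at h
    rcases h with rfl | h
    · exact le_rfl
    · have := ih h; simp only [formula, list, Dat.size]; omega
  | _ =>
    simp only [subformulas, List.mem_singleton] at h
    rw [h]

theorem PT.visit : PT (fun s : {s : (n : ℕ) × List (Formula (Fin n)) × List (Formula (Fin n)) //
      (visitCode s.2).hd ≠ .nil} => visitCode s.1.2) (fun s => visitCode (FLTL.visit s.1.2)) := by
  have h : PT (fun p : (n : ℕ) × Formula (Fin n) × List (Formula (Fin n)) × List (Formula (Fin n)) =>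
      visitCode (p.2.1 :: p.2.2.1, p.2.2.2))
      (fun p => visitCode (FLTL.visit (p.2.1 :: p.2.2.1, p.2.2.2))) := by
    have hχ : PT (fun p : (n : ℕ) × Formula (Fin n) × List (Formula (Fin n)) × List (Formula (Fin n)) =>
      visitCode (p.2.1 :: p.2.2.1, p.2.2.2)) (fun p => formula p.2.1) := PT.refl.hd.hd
    have ht : PT (fun p : (n : ℕ) × Formula (Fin n) × List (Formula (Fin n)) × List (Formula (Fin n)) =>
      visitCode (p.2.1 :: p.2.2.1, p.2.2.2)) (fun p => list (p.2.2.1.map formula)) := PT.refl.hd.tl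
    have hout : PT (fun p : (n : ℕ) × Formula (Fin n) × List (Formula (Fin n)) × List (Formula (Fin n)) =>
      visitCode (p.2.1 :: p.2.2.1, p.2.2.2)) (fun p => list (p.2.2.2.map formula)) := PT.refl.tl
    refine ((hχ.kids.append ht).cons (hχ.cons hout)).congr fun p => ?_
    simp [visitCode, FLTL.visit, list]
  have hs : ∀ s : {s : (n : ℕ) × List (Formula (Fin n)) × List (Formula (Fin n)) //
      (visitCode s.2).hd ≠ .nil}, ∃ p : (n : ℕ) × Formula (Fin n) × List (Formula (Fin n)) ×
        List (Formula (Fin n)), s.1 = ⟨p.1, p.2.1 :: p.2.2.1, p.2.2.2⟩ := by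
    rintro ⟨⟨n, _ | ⟨χ, t⟩, out⟩, h⟩
    exacts [absurd rfl h, ⟨⟨n, χ, t, out⟩, rfl⟩]
  choose r hr using hs
  exact ((h.precomp r).congr_left fun s => by rw [hr s]).congr fun s => by rw [hr s]

namespace PT

variable {ι : Type} {a : ι → Dat} {n : ι → ℕ} {φ : ∀ i, Formula (Fin (n i))}

theorem subformulas (h : PT a (fun i => formula (φ i))) :
    PT a (fun i => list ((φ i).subformulas.map formula)) := by
  set F : (n : ℕ) × List (Formula (Fin n)) × List (Formula (Fin n)) →
    (n : ℕ) × List (Formula (Fin n)) × List (Formula (Fin n)) := fun s => ⟨s.1, FLTL.visit s.2⟩ with hF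
  have hiter : ∀ (i : ι) (j : ℕ), F^[j] ⟨n i, [φ i], []⟩ = ⟨n i, FLTL.visit^[j] ([φ i], [])⟩ := by
    intro i j
    induction j with
    | zero => rfl
    | succ j ih => rw [Function.iterate_succ_apply', ih, Function.iterate_succ_apply', hF]
  have hinv : ∀ (i : ι) (j : ℕ), (FLTL.visit^[j] ([φ i], [])).2.reverse ++
      (FLTL.visit^[j] ([φ i], [])).1.flatMap Formula.subformulas = (φ i).subformulas := by
    intro i j
    induction j with
    | zero => simp
    | succ j ih => rw [Function.iterate_succ_apply', visit_invariant, ih]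
  have hμ : ∀ s : (n : ℕ) × List (Formula (Fin n)) × List (Formula (Fin n)),
      (visitCode s.2).hd ≠ .nil →
        ((F s).2.1.map Formula.length).sum < (s.2.1.map Formula.length).sum := by
    rintro ⟨k, _ | ⟨χ, t⟩, out⟩ hs
    · exact absurd rfl hs
    · have := χ.sum_length_kids_lt
      change ((χ.kids ++ t).map Formula.length).sum < _
      simp only [List.map_append, List.sum_append, List.map_cons, List.sum_cons]
      omega
  -- By the invariant, everything on the agenda or visited is a subformula of `φ i`, and each of the
  -- two lists is no longer than `subformulas`.
  have hsz : ∀ (i : ι) (j : ℕ), (visitCode (F^[j] ⟨n i, [φ i], []⟩).2).size ≤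
      1 + ((formula (φ i)).size * ((formula (φ i)).size + 1) + 1) +
      ((formula (φ i)).size * ((formula (φ i)).size + 1) + 1) := by
    intro i j
    rw [hiter]
    have h5 := hinv i j
    revert h5
    generalize FLTL.visit^[j] ([φ i], []) = s
    intro h5
    have hlen := congrArg List.length h5
    have hl : s.1.length ≤ (s.1.flatMap Formula.subformulas).length := by
      generalize s.1 = t
      induction t with
      | nil => simp
      | cons χ t ih =>
        rw [List.flatMap_cons, List.length_append, χ.subformulas_eq, List.length_cons, List.length_cons]
        omega
    have hφ := (φ i).length_subformulas_le.trans (length_le_size_formula (φ i))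
    rw [List.length_append, List.length_reverse] at hlen
    have hmem : ∀ χ, (χ ∈ s.1 ∨ χ ∈ s.2) → (formula χ).size ≤ (formula (φ i)).size := by
      intro χ hχ
      refine size_formula_le_of_mem ?_
      rw [← h5, List.mem_append, List.mem_reverse, List.mem_flatMap]
      rcases hχ with hχ | hχ
      exacts [.inr ⟨χ, hχ, self_mem_subformulas χ⟩, .inl hχ]
    have hb : ∀ t : List (Formula (Fin (n i))), t.length ≤ (formula (φ i)).size →
        (∀ χ ∈ t, (formula χ).size ≤ (formula (φ i)).size) → (list (t.map formula)).size ≤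
          (formula (φ i)).size * ((formula (φ i)).size + 1) + 1 := by
      intro t ht hm
      refine (size_list_le (z := (formula (φ i)).size) fun x hx => ?_).trans
        (Nat.add_le_add_right (Nat.mul_le_mul_right _ (by rwa [List.length_map])) 1)
      obtain ⟨χ, hχ, rfl⟩ := List.mem_map.1 hx
      exact hm χ hχ
    simp only [visitCode, Dat.size]
    exact Nat.add_le_add (Nat.add_le_add_left (hb _ (by omega) fun χ hχ => hmem χ (.inl hχ)) 1)
      (hb _ (by omega) fun χ hχ => hmem χ (.inr hχ))
  obtain ⟨m, h1, -, h3⟩ := whileLoop (a := a)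
    (e := fun s : (n : ℕ) × List (Formula (Fin n)) × List (Formula (Fin n)) => visitCode s.2)
    (F := F) (μ := fun s => (s.2.1.map Formula.length).sum) PT.visit hμ
    (s := fun i => ⟨n i, [φ i], []⟩) ((h.cons nil).cons nil)
    (((PB.const 1).add ((h.size.mul (h.size.add (.const 1))).add (.const 1))).add
      ((h.size.mul (h.size.add (.const 1))).add (.const 1))) hsz
    (h.size.mono fun i => by simpa using length_le_size_formula (φ i))
  refine h3.tl.reverse.congr fun i => ?_
  have h4 := h1 i
  have h5 := hinv i (m i)
  rw [hiter] at h4 ⊢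
  revert h4 h5
  generalize FLTL.visit^[m i] ([φ i], []) = s
  obtain ⟨_ | ⟨χ, t⟩, out⟩ := s
  · intro _ h5
    rw [← h5]
    simp
  · intro h4
    simp [visitCode, list, Dat.hd] at h4

theorem range (h : PT a (fun i => unary (n i))) :
    PT a (fun i => list ((List.range (n i)).reverse.map unary)) := by
  have := listRec (α := fun _ => Dat) (f := fun _ x => x) (l := fun i => List.replicate (n i) Dat.nil)
    (h.congr fun i => by rw [List.map_id', unary_eq])
    (fun i t => .cons (unary t.length) (list ((List.range t.length).reverse.map unary)))
    (z := fun i => 1 + (unary (n i)).size + ((unary (n i)).size * ((unary (n i)).size + 1) + 1))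
    (((PB.const 1).add h.size).add ((h.size.mul (h.size.add (.const 1))).add (.const 1))) ?_
    (const _) ?_
  · exact this.tl.congr fun i => by rw [List.length_replicate]; rfl
  · intro i t ht
    have ht := ht.length_le
    rw [List.length_replicate] at ht
    have hs : ∀ k ≤ n i, (unary k).size ≤ (unary (n i)).size := fun k hk => by
      rw [size_unary, size_unary]; omega
    have hn : n i ≤ (unary (n i)).size := by rw [size_unary]; omega
    rw [Dat.size]
    refine Nat.add_le_add (Nat.add_le_add_left (hs _ ht) 1) ?_
    refine (size_list_le (z := (unary (n i)).size) fun x hx => ?_).trans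
      (Nat.add_le_add_right (Nat.mul_le_mul_right _ ?_) 1)
    · obtain ⟨k, hk, rfl⟩ := List.mem_map.1 hx
      rw [List.mem_reverse, List.mem_range] at hk
      exact hs k (by omega)
    · rw [List.length_map, List.length_reverse, List.length_range]
      omega
  · refine ((nil.cons right.hd.hd).cons (right.hd.hd.cons right.hd.tl)).congr fun p => ?_
    simp [List.range_succ, list, unary, Dat.hd, Dat.tl]

/-- The preparations, in time polynomial in the bound on the number of states. -/
theorem baseCode : PT (fun i : (n : ℕ) × Formula (Fin n) =>
    .cons (unary (2 ^ 2 ^ (input i.1 i.2).size)) (input i.1 i.2)) (fun i => base i.2) := by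
  classical
  set a : (n : ℕ) × Formula (Fin n) → Dat := fun i =>
    .cons (unary (2 ^ 2 ^ (input i.1 i.2).size)) (input i.1 i.2) with ha
  have hfuel : PB a (fun i => 2 ^ 2 ^ (input i.1 i.2).size) := PB.self.mono fun i => by
    simp only [ha, Dat.size, size_unary]; omega
  have hn : PT a (fun i => unary i.1) := right.hd
  have hφ : PT a (fun i => formula i.2) := right.tl
  have hsubs : PT a (fun i => list ((subs i.2).map formula)) :=
    (hφ.subformulas.dedup fun i => formula_injective i.1).congr fun i => by rw [subs]
  have hlen : ∀ i : (n : ℕ) × Formula (Fin n), (subs i.2).length ≤ (input i.1 i.2).size := fun i => by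
    have h1 := length_subs_le i.2
    have h2 := size_input i.1 i.2
    omega
  have hassigns : PT a (fun i => list ((assigns i.2).map assignCode)) :=
    sublists hsubs (hfuel.mono fun i => Nat.pow_le_pow_right (by omega)
      ((hlen i).trans Nat.lt_two_pow_self.le))
  -- This enumeration has length 2^(2^k) for `k` subformulas; it dictates the size of the unary
  -- number.
  have htables : PT a (fun i => list ((assigns i.2).sublists'.map tableCode)) :=
    sublists hassigns (hfuel.mono fun i => Nat.pow_le_pow_right (by omega) (by
      rw [assigns, List.length_sublists']
      exact Nat.pow_le_pow_right (by omega) (hlen i)))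
  have hletters : PT a (fun i => list ((letters i.1).map fun l => list (l.map unary))) :=
    sublists hn.range (hfuel.mono fun i => Nat.pow_le_pow_right (by omega) (by
      have h2 := size_input i.1 i.2
      rw [List.length_reverse, List.length_range]
      exact (show i.1 ≤ (input i.1 i.2).size by omega).trans Nat.lt_two_pow_self.le))
  have hrec : PT a (fun i => list ((recList i.2).map formula)) :=
    (filter (Q := fun _ χ => χ.isRec = true) hsubs (bitIsRec left)).congr fun i => by
      rw [recList]; congr 2; exact List.filter_congr (by simp)
  exact left.cons (hsubs.cons (hassigns.cons (htables.cons (hletters.cons (hrec.cons (hφ.cons nil))))))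

end PT

/-- Doubly exponential time in the size of the input. -/
theorem runs_automaton : ∃ (T : (n : ℕ) × Formula (Fin n) → ℕ) (d : ℕ),
    Runs (fun i : (n : ℕ) × Formula (Fin n) => input i.1 i.2) (fun i => Enc.automaton (numbered i.2)) T ∧
      ∀ i, T i ≤ 2 ^ 2 ^ ((input i.1 i.2).size + d) := by
  set I : (n : ℕ) × Formula (Fin n) → Dat := fun i => input i.1 i.2 with hI
  set F : (n : ℕ) × Formula (Fin n) → Dat := fun i => unary (2 ^ 2 ^ (I i).size) with hF
  obtain ⟨T₀, r0, b0, -⟩ : PT I (fun i => unary (I i).size) := PT.refl.treeSize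
  obtain ⟨T₁, r1, b1⟩ := Runs.exp fun i => (I i).size
  obtain ⟨T₂, r2, b2⟩ := Runs.exp fun i => 2 ^ (I i).size
  obtain ⟨T₃, r3, b3, -⟩ : PT I I := PT.refl
  obtain ⟨T₄, r4, b4, -⟩ := PT.automatonCode PT.baseCode
  have h1 : PB F (fun i => 2 ^ (I i).size) := PB.self.mono fun i => by
    have : 2 ^ (I i).size < 2 ^ 2 ^ (I i).size := Nat.lt_two_pow_self
    simp only [hF, size_unary]; omega
  have h0 : PB F (fun i => (I i).size) := h1.mono fun i => Nat.lt_two_pow_self.le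
  have h1' : PB F (fun i => (unary (2 ^ (I i).size)).size) := by
    simp only [size_unary]; exact ((PB.const 2).mul h1).add (.const 1)
  -- The size of the input is computed and exponentiated twice; the result is paired with the input
  -- and handed to the polynomial-time construction. Every stage is polynomial in the doubly
  -- exponential `F`.
  have r5 := (((r0.comp r1).comp r2).cons r3).comp r4
  obtain ⟨d, hd⟩ := ((PB.const (a := F) 1).add ((((((((PB.const 1).add (((PB.const 1).add
    (.of_size h0 b0)).add (.of_size h1' b1))).add b2).add (.of_size h0 b3)).add
      ((PB.const 2).mul h0)).add .self).add h0).add (.const 8))).add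
      (PB.of_size (b := fun i => Dat.cons (F i) (I i)) (((PB.const 1).add .self).add h0) b4)
  refine ⟨_, d + 2, r5, fun i => (hd i).trans ?_⟩
  set s := (I i).size
  -- A fixed power `d` of a doubly exponential number only adds a constant to the upper exponent:
  -- (2^s + 2)·d ≤ 2^(s + d + 2).
  have e1 : (F i).size + 1 ≤ 2 ^ (2 ^ s + 2) := by
    have : 1 ≤ 2 ^ 2 ^ s := Nat.one_le_two_pow
    rw [hF]
    simp only [size_unary, pow_add]
    change 2 * 2 ^ 2 ^ s + 1 + 1 ≤ 2 ^ 2 ^ s * 4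
    omega
  have e2 : 2 ^ s + 2 ≤ 2 ^ (s + 2) := by
    have : 1 ≤ 2 ^ s := Nat.one_le_two_pow
    rw [pow_add]; omega
  refine (Nat.pow_le_pow_left e1 d).trans ?_
  rw [← pow_mul]
  refine Nat.pow_le_pow_right (by omega) ?_
  calc (2 ^ s + 2) * d ≤ 2 ^ (s + 2) * 2 ^ d := Nat.mul_le_mul e2 Nat.lt_two_pow_self.le
    _ = 2 ^ (s + (d + 2)) := by rw [← pow_add]; congr 1; omega

/-- The time bound is in terms of the size of the input tree, which is quadratic in `n + φ.length`:
propositions are written in unary and may occur at every literal. -/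
theorem exists_program : ∃ (prog : Prog) (P : Polynomial ℕ), ∀ (n : ℕ) (φ : Formula (Fin n)),
    prog.OutputsWithin (input n φ) (Enc.automaton (numbered φ)) (2 ^ 2 ^ P.eval (n + φ.length)) := by
  obtain ⟨T, d, ⟨c, hc⟩, hT⟩ := runs_automaton
  refine ⟨c 0, (2 * .X + 60) * .X + 2 * .X + 2 + .C d, fun n φ => ?_⟩
  obtain ⟨t, σ', h1, h2, -, h4⟩ := hc ⟨n, φ⟩ 0 (Function.update (fun _ => Dat.nil) 0 (input n φ)) (by simp)
  refine ⟨t, h4.trans ((hT ⟨n, φ⟩).trans ?_), σ', h1, h2⟩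
  refine Nat.pow_le_pow_right (by omega) (Nat.pow_le_pow_right (by omega) ?_)
  simp only [Polynomial.eval_add, Polynomial.eval_mul, Polynomial.eval_X, Polynomial.eval_C,
    Polynomial.eval_ofNat]
  exact Nat.add_le_add_right (size_input_le n φ) d

end FLTL

theorem theorem2 :
    (∀ (Ap : Type u) [Finite Ap] (φ : FLTL.Formula Ap), φ.NoUUnderG →
      Finite (FLTL.AutState φ) ∧
      (∀ w : FLTL.Word Ap, w ∈ (FLTL.automaton φ).language → FLTL.Sat w φ) ∧
      (∀ w : FLTL.Word Ap, FLTL.Sat w φ → w ∈ (FLTL.automaton φ).language)) ∧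
    (∃ c : ℕ, ∀ (Ap : Type u) [Finite Ap] (φ : FLTL.Formula Ap), φ.NoUUnderG →
      (FLTL.automaton φ).acc.size ≤ 2 ^ (c * φ.length)) ∧
    (∃ (prog : FLTL.Prog) (P : Polynomial ℕ), ∀ (n : ℕ) (φ : FLTL.Formula (Fin n)), φ.NoUUnderG →
      ∃ (N : ℕ) (B : FLTL.DGRMA (Set (Fin n)) (Fin N)) (e : Fin N ≃ FLTL.AutState φ),
        B.IsIso (FLTL.automaton φ) e ∧
        prog.OutputsWithin (FLTL.Enc.input n φ) (FLTL.Enc.automaton B)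
          (2 ^ 2 ^ P.eval (n + φ.length))) := by
  refine ⟨fun Ap _ φ hφ => ⟨FLTL.finite_autState φ, FLTL.sound φ, fun w h => FLTL.complete hφ h⟩,
    ⟨3, fun Ap _ φ _ => FLTL.acc_size_le φ⟩, ?_⟩
  obtain ⟨prog, P, h⟩ := FLTL.exists_program
  exact ⟨prog, P, fun n φ _ => ⟨_, FLTL.numbered φ, FLTL.stateEquiv φ, FLTL.numbered_isIso, h n φ⟩⟩
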